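/- **Setting.** Let $d\ge 1$ and $A\in Sp(2d,\mathbb Z)$ (with respect to $J=\begin{pmatrix}0&-\mathrm{Id}\\ \mathrm{Id}&0\end{pmatrix}$, $\sigma(\rho,\rho')=\langle\rho,J\rho'\rangle$) be such that $1$ is not an eigenvalue of $A$ and $A$ has an eigenvalue of modulus larger than $1$. Put $\lambda_{\max}=\max\{\log|\beta|:\beta\in\mathrm{sp}(A)\}>0$. Fix a symplectic reduction $A=Q(A_0\diamond A_1\diamond\cdots\diamond A_r)Q^{-1}$, with $Q\in Sp(2d,\mathbb R)$, $A_0\in Sp(2d_0,\mathbb R)$ with spectrum on the unit circle, and $A_i=\mathrm{diag}(D_i,(D_i^{*})^{-1})$ with $D_i\in GL(d_i,\mathbb R)$ whose spectrum lies in $\{|z|=e^{\lambda_i}\}$, $0<\lambda_1<\dots<\lambda_r$, $d_0+d_1+\dots+d_r=d$. Here $M_1\diamond M_2$ is the matrix of the direct sum of the symplectic maps $M_1,M_2$ in the coordinates $(x_1,x_2,\xi_1,\xi_2)$. Fix $0<\epsilon_0\le\lambda_{\max}$ and $0<\epsilon<1$. For an integer $N\ge1$ let $\hbar=1/(2\pi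 N)$ and let $U_\hbar(x,\xi)$ be the Heisenberg translation $(U_\hbar(x,\xi)\psi)(y)=e^{\frac{i}{\hbar}(\langle\xi,y\rangle-\frac12\langle\xi,x\rangle)}\psi(y-x)$. For $\kappa=(\kappa_1,\kappa_2)\in[0,2\pi)^{2d}$ let $\mathcal H_N(\kappa)$ be the space of $\psi\in\mathcal S'(\mathbb R^d)$ with $U_\hbar(q,p)\psi=e^{\frac{i}{2\hbar}\langle q,p\rangle}e^{-i\langle\kappa_1,q\rangle+i\langle\kappa_2,p\rangle}\psi$ for all $(q,p)\in\mathbb Z^{2d}$; it consists of Dirac combs $\sum_{k\in\mathbb Z^d}c_k\,\delta_{(k+\kappa_2/2\pi)/N}$ and carries the scalar product $N^d\sum_{k\in\{0,\dots,N-1\}^d}\overline{c_k}\,c_k'$, for which every $U_\hbar(r/N)$, $r\in\mathbb Z^{2d}$, is unitary. Let $M(A)$ be the metaplectic operator of $A$: the operator, unique up to a phase, which is unitary on $L^2(\mathbb R^d)$, preserves $\mathcal S(\mathbb R^d)$ (and is extended to $\mathcal S'(\mathbb R^d)$ by duality) and satisfies $M(A)U_\hbar(\rho)M(A)^{-1}=U_\hbar(A\rho)$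 for all $\rho\in\mathbb R^{2d}$. If $M(A)\mathcal H_N(\kappa)=\mathcal H_N(\kappa)$, let $M_\kappa(A)$ be its restriction to $\mathcal H_N(\kappa)$. Let $B(\hbar)=Q\,\mathrm{diag}(D_1(\hbar),D_1(\hbar))\,Q^{-1}$, where $D_1(\hbar)$ is the diagonal matrix with entries $\hbar^{-\epsilon_0/(2\lambda_{\max})}$ ($d_0$ times) and $\hbar^{-\lambda_i/(2\lambda_{\max})}$ ($d_i$ times, $1\le i\le r$), and let $G_\hbar(\rho)=2^{d/2}|\det B(\hbar)|^{1/2}e^{-\pi\|B(\hbar)\rho\|^2}$. For $a\in C^\infty(\mathbb T^{2d})$ with $a(\rho)=\sum_{r\in\mathbb Z^{2d}}a_re^{-2i\pi\langle Jr,\rho\rangle}$ let $\mathrm{Op}^w_\kappa(a)=\sum_ra_rU_\hbar(r/N)$ on $\mathcal H_N(\kappa)$, and $\mathrm{Op}^+_\kappa(a)=\mathrm{Op}^w_\kappa\big(a\star(G_\hbar\sharp G_\hbar)\big)$, where $\star$ is the convolution on $\mathbb R^{2d}$ and $\sharp$ is the Moyal product $$(f\sharp g)(\rho)=(\pi\hbar)^{-2d}\iint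 e^{-\frac{2i}{\hbar}\sigma(w_1,w_2)}f(\rho+w_1)\,g(\rho+w_2)\,dw_1\,dw_2 .$$ For a unit vector $\psi\in\mathcal H_N(\kappa)$ put $\mu_\psi(a)=\langle\psi,\mathrm{Op}^+_\kappa(a)\psi\rangle_{\mathcal H_N(\kappa)}$. Let $\mathcal P=(P_i)_{i=1}^K$ be functions in $C^\infty(\mathbb T^{2d},[0,1])$ with $\sum_{i=1}^KP_i^2=1$. For $m\ge0$ and $\alpha=(\alpha_{-m},\dots,\alpha_{m-1})\in\{1,\dots,K\}^{2m}$ let $\mathbf P_\alpha=\prod_{j=-m}^{m-1}P_{\alpha_j}\circ A^j$, and let $$h_{2m}(\psi,\mathcal P)=-\sum_{|\alpha|=2m}\mu_\psi(\mathbf P_\alpha^2)\log\mu_\psi(\mathbf P_\alpha^2)\qquad(0\log0=0).$$ Let $m_E(N)=\left\lfloor\frac{(1-\epsilon)\log N}{2\lambda_{\max}}\right\rfloor$. **Lemma.** There is a function $R(m_0,N)$ (depending on $A$, its fixed reduction, $\epsilon_0$, $\epsilon$ and $\mathcal P$, but not on $\kappa$ or $\psi$) with $\lim_{N\to\infty}R(m_0,N)=0$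 for every integer $m_0\ge1$, such that for all integers $m_0\ge1$ and $N\ge1$ with $m_E(N)\ge1$, every $\kappa\in[0,2\pi)^{2d}$ with $M(A)\mathcal H_N(\kappa)=\mathcal H_N(\kappa)$, and every unit eigenvector $\psi_N\in\mathcal H_N(\kappa)$ of $M_\kappa(A)$, $$\frac1{2m_E(N)}h_{2m_E(N)}(\psi_N,\mathcal P)\le\frac1{2m_0}h_{2m_0}(\psi_N,\mathcal P)+R(m_0,N).$$ -/

import Mathlib

open scoped SchwartzMap ContDiff Matrix

noncomputable section

namespace CatMap

/-! ### Phase space -/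

/-- Configuration space `ℝ^d`. -/
abbrev Conf (d : ℕ) : Type := Fin d → ℝ

/-- Phase space `ℝ^{2d}`; the point `ρ = (x, ξ)` has `x j = ρ (Sum.inl j)`, `ξ j = ρ (Sum.inr j)`.
Only the measure, the coordinatewise scalar product `⬝ᵥ` and the smooth structure are used. -/
abbrev Phase (d : ℕ) : Type := Fin d ⊕ Fin d → ℝ

/-- Matrices acting on phase space. -/
abbrev PMat (d : ℕ) (R : Type*) : Type _ := Matrix (Fin d ⊕ Fin d) (Fin d ⊕ Fin d) R

/-- `Sp(2d, ℤ)`, with respect to `J = (0, -1; 1, 0)`. -/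
abbrev SpZ (d : ℕ) : Type := Matrix.symplecticGroup (Fin d) ℤ

variable {d : ℕ}

/-- The symplectic form `σ(ρ, ρ') = ⟨ρ, J ρ'⟩`. -/
def symp (ρ ρ' : Phase d) : ℝ := ρ ⬝ᵥ (Matrix.J (Fin d) ℝ *ᵥ ρ')

/-- An integral point of phase space. -/
def intPt (r : Fin d ⊕ Fin d → ℤ) : Phase d := fun i => (r i : ℝ)

/-- The integer matrix `A` as a real matrix. -/
def realMat (A : SpZ d) : PMat d ℝ := (A : PMat d ℤ).map (Int.cast : ℤ → ℝ)

/-- The linear action of `A ∈ Sp(2d, ℤ)` on phase space. -/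
def act (A : SpZ d) (ρ : Phase d) : Phase d := realMat A *ᵥ ρ

/-- The complex spectrum of `A`. -/
def spec (A : SpZ d) : Set ℂ := spectrum ℂ ((A : PMat d ℤ).map (Int.cast : ℤ → ℂ))

/-- `A` is quantizable: `1` is not an eigenvalue of `A`. -/
def Quantizable (A : SpZ d) : Prop := (1 : ℂ) ∉ spec A

/-- `λ_max = sup {log |β| : β ∈ spec A}`. -/
def lamMax (A : SpZ d) : ℝ := sSup ((fun β : ℂ => Real.log ‖β‖) '' spec A)

/-! ### The Heisenberg translations and the space of quantum states -/

/-- Planck's constant, `2π ħ N = 1`. -/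
def hbar (N : ℕ) : ℝ := 1 / (2 * Real.pi * N)

/-- The phase factor `y ↦ exp ((i/ħ) (⟨ξ, y⟩ - ⟨ξ, x⟩ / 2))` of the translation by `ρ = (x, ξ)`. -/
def heisPhase (N : ℕ) (ρ : Phase d) (y : Conf d) : ℂ :=
  Complex.exp (((((ρ ∘ Sum.inr) ⬝ᵥ y - (ρ ∘ Sum.inr) ⬝ᵥ (ρ ∘ Sum.inl) / 2) / hbar N : ℝ) : ℂ)
    * Complex.I)

/-- `U_ħ(x, ξ) = exp ((i/ħ) σ((x, ξ), (Q, P)))` on Schwartz functions, that is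
`(U_ħ(x, ξ) φ)(y) = exp ((i/ħ) (⟨ξ, y⟩ - ⟨ξ, x⟩ / 2)) φ(y - x)`. -/
def heis (N : ℕ) (ρ : Phase d) : 𝓢(Conf d, ℂ) →L[ℂ] 𝓢(Conf d, ℂ) :=
  SchwartzMap.smulLeftCLM ℂ (heisPhase N ρ) ∘L SchwartzMap.compSubConstCLM ℂ (ρ ∘ Sum.inl)

lemma iteratedDeriv_expI (n : ℕ) :
    iteratedDeriv n (fun t : ℝ => Complex.exp ((t : ℂ) * Complex.I)) =
      fun t : ℝ => Complex.I ^ n * Complex.exp ((t : ℂ) * Complex.I) := by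
  induction n with
  | zero => simp
  | succ n ih =>
    rw [iteratedDeriv_succ, ih]
    funext t
    have h : HasDerivAt (fun t : ℝ => Complex.exp ((t : ℂ) * Complex.I))
        (Complex.exp ((t : ℂ) * Complex.I) * (1 * Complex.I)) t :=
      ((Complex.ofRealCLM.hasDerivAt (x := t)).mul_const Complex.I).cexp
    rw [(h.const_mul (Complex.I ^ n)).deriv]
    ring

lemma expI_hasTemperateGrowth :
    (fun t : ℝ => Complex.exp ((t : ℂ) * Complex.I)).HasTemperateGrowth := by
  refine ⟨?_, fun n => ⟨0, 1, fun t => ?_⟩⟩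
  · exact (Complex.ofRealCLM.contDiff.mul contDiff_const).cexp
  · rw [norm_iteratedFDeriv_eq_norm_iteratedDeriv, iteratedDeriv_expI]
    simp [Complex.norm_exp_ofReal_mul_I]

lemma heisPhase_hasTemperateGrowth (N : ℕ) (ρ : Phase d) :
    (heisPhase N ρ).HasTemperateGrowth := by
  have h2 : (fun y : Conf d => (ρ ∘ Sum.inr) ⬝ᵥ y).HasTemperateGrowth :=
    (LinearMap.toContinuousLinearMap (dotProductBilin ℝ ℝ (ρ ∘ Sum.inr))).hasTemperateGrowth
  have h1 : (fun y : Conf d => ((ρ ∘ Sum.inr) ⬝ᵥ y - (ρ ∘ Sum.inr) ⬝ᵥ (ρ ∘ Sum.inl) / 2)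
      / hbar N).HasTemperateGrowth := by
    simp only [div_eq_mul_inv]
    fun_prop
  exact expI_hasTemperateGrowth.comp h1

lemma heis_apply (N : ℕ) (ρ : Phase d) (φ : 𝓢(Conf d, ℂ)) (y : Conf d) :
    heis N ρ φ y = heisPhase N ρ y * φ (y - ρ ∘ Sum.inl) := by
  simp [heis, SchwartzMap.smulLeftCLM_apply_apply (heisPhase_hasTemperateGrowth N ρ)]

/-- `U_ħ(x, ξ)` on tempered distributions, as the transpose of `U_ħ(-x, ξ)`:
for a function `ψ`, `∫ (U_ħ(x, ξ) ψ) φ = ∫ ψ (U_ħ(-x, ξ) φ)`. -/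
def heisDist (N : ℕ) (ρ : Phase d) : 𝓢'(Conf d, ℂ) →L[ℂ] 𝓢'(Conf d, ℂ) :=
  PointwiseConvergenceCLM.precomp ℂ
    (heis N (Sum.elim (-(ρ ∘ Sum.inl)) (ρ ∘ Sum.inr)))

/-- The space `𝓗_N(κ)` of quantum states on the torus: the tempered distributions `ψ` with
`U_ħ(q, p) ψ = exp ((i/2ħ) ⟨q, p⟩) exp (-i ⟨κ₁, q⟩ + i ⟨κ₂, p⟩) ψ` for all `(q, p) ∈ ℤ^{2d}`. -/
def states (N : ℕ) (κ : Phase d) : Submodule ℂ 𝓢'(Conf d, ℂ) where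
  carrier := {ψ | ∀ r : Fin d ⊕ Fin d → ℤ, heisDist N (intPt r) ψ =
    Complex.exp ((((intPt r ∘ Sum.inl) ⬝ᵥ (intPt r ∘ Sum.inr) / (2 * hbar N)
      - (κ ∘ Sum.inl) ⬝ᵥ (intPt r ∘ Sum.inl)
      + (κ ∘ Sum.inr) ⬝ᵥ (intPt r ∘ Sum.inr) : ℝ) : ℂ) * Complex.I) • ψ}
  add_mem' := by
    intro a b ha hb r
    rw [map_add, ha r, hb r, smul_add]
  zero_mem' := by
    intro r
    rw [map_zero, smul_zero]
  smul_mem' := by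
    intro c a ha r
    rw [map_smul, ha r, smul_comm]

/-! ### The Hilbert structure of `𝓗_N(κ)`

An element of `𝓗_N(κ)` is a Dirac comb `∑_{k ∈ ℤ^d} c_k δ_{x_k}` on the lattice
`x_k = (k + κ₂ / 2π) / N`, with `c_{k + N q} = exp (i ⟨κ₁, q⟩) c_k` for `q ∈ ℤ^d`.  The Hilbert
structure, which is characterised up to a positive factor by the unitarity of all `U_ħ(r/N)`,
`r ∈ ℤ^{2d}`, is `N^d ∑_{k ∈ {0, …, N-1}^d} conj c_k c'_k`. -/

/-- The point `x_k = (k + κ₂ / 2π) / N`. -/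
def node (N : ℕ) (κ : Phase d) (k : Fin d → ℤ) : Conf d :=
  fun j => ((k j : ℝ) + κ (Sum.inr j) / (2 * Real.pi)) / N

/-- A smooth bump at `x`, equal to `1` near `x` and supported in the closed ball of radius
`1 / (N + 1)` (for the sup norm), which is less than the mesh `1 / N` of the lattice. -/
def bump (N : ℕ) (x : Conf d) : ContDiffBump x where
  rIn := 1 / (N + 2)
  rOut := 1 / (N + 1)
  rIn_pos := by positivity
  rIn_lt_rOut := by
    apply one_div_lt_one_div_of_lt
    · positivity
    · linarith

/-- The bump as a Schwartz function. -/
def bumpS (N : ℕ) (x : Conf d) : 𝓢(Conf d, ℂ) :=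
  HasCompactSupport.toSchwartzMap (f := fun y => ((bump N x y : ℝ) : ℂ))
    ((bump N x).hasCompactSupport.comp_left Complex.ofReal_zero)
    (Complex.ofRealCLM.contDiff.comp (bump N x).contDiff)

/-- The coefficient `c_k` of the Dirac mass at `x_k`. -/
def coef (N : ℕ) (κ : Phase d) (ψ : 𝓢'(Conf d, ℂ)) (k : Fin d → ℤ) : ℂ :=
  ψ (bumpS N (node N κ k))

/-- The scalar product of `𝓗_N(κ)`, linear in the second variable. -/
def stateInner (N : ℕ) (κ : Phase d) (ψ ψ' : 𝓢'(Conf d, ℂ)) : ℂ :=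
  (N : ℂ) ^ d * ∑ k : Fin d → Fin N,
    (starRingEnd ℂ) (coef N κ ψ fun j => ((k j : ℕ) : ℤ)) * coef N κ ψ' fun j => ((k j : ℕ) : ℤ)

/-! ### The quantum propagator -/

/-- Complex conjugation of Schwartz functions. -/
def conjS : 𝓢(Conf d, ℂ) →SL[starRingEnd ℂ] 𝓢(Conf d, ℂ) :=
  { toFun := fun φ => SchwartzMap.postcompCLM (𝕜 := ℝ) (Complex.conjCLE : ℂ →L[ℝ] ℂ) φ
    map_add' := fun φ φ' => map_add _ φ φ'
    map_smul' := fun c φ => by ext y; simp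
    cont := (SchwartzMap.postcompCLM (𝕜 := ℝ) (Complex.conjCLE : ℂ →L[ℝ] ℂ)).continuous }

lemma conjS_apply (φ : 𝓢(Conf d, ℂ)) (y : Conf d) : conjS φ y = (starRingEnd ℂ) (φ y) := rfl

/-- A quantum propagator of `A`: a metaplectic operator `M(A)`, i.e. an operator that preserves the
Schwartz space, is unitary for the scalar product of `L²(ℝ^d)`, and satisfies
`M(A) U_ħ(ρ) M(A)⁻¹ = U_ħ(A ρ)` for all `ρ ∈ ℝ^{2d}`.  It is unique up to a phase. -/
structure Propagator (N : ℕ) (A : SpZ d) where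
  /-- The operator on Schwartz functions. -/
  op : 𝓢(Conf d, ℂ) ≃L[ℂ] 𝓢(Conf d, ℂ)
  unitary : ∀ φ : 𝓢(Conf d, ℂ), ∫ y, ‖op φ y‖ ^ 2 = ∫ y, ‖φ y‖ ^ 2
  intertwines : ∀ (ρ : Phase d) (φ : 𝓢(Conf d, ℂ)), op (heis N ρ φ) = heis N (act A ρ) (op φ)

/-- The extension of `M(A)` to tempered distributions, determined by
`⟨M(A) φ | M(A) ψ⟩ = ⟨φ | ψ⟩`, where `⟨φ | ψ⟩ = ψ(conj φ)`. -/
def Propagator.onDist {N : ℕ} {A : SpZ d} (M : Propagator N A) :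
    𝓢'(Conf d, ℂ) →L[ℂ] 𝓢'(Conf d, ℂ) :=
  PointwiseConvergenceCLM.precomp ℂ
    ((conjS.comp ((M.op.symm : 𝓢(Conf d, ℂ) →L[ℂ] 𝓢(Conf d, ℂ)).comp conjS)) :
      𝓢(Conf d, ℂ) →L[ℂ] 𝓢(Conf d, ℂ))

lemma Propagator.onDist_apply {N : ℕ} {A : SpZ d} (M : Propagator N A) (ψ : 𝓢'(Conf d, ℂ))
    (φ : 𝓢(Conf d, ℂ)) : M.onDist ψ (conjS (M.op φ)) = ψ (conjS φ) := by
  have h : conjS (conjS (M.op φ)) = M.op φ := by ext y; simp [conjS_apply]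
  change ψ (conjS (M.op.symm (conjS (conjS (M.op φ))))) = _
  rw [h, ContinuousLinearEquiv.symm_apply_apply]

/-! ### Weyl quantization on the torus

Functions on the torus are represented by `ℤ^{2d}`-periodic functions on `ℝ^{2d}`. -/

/-- The Fourier coefficient `a_r` of the periodic function `a`, for the expansion
`a(ρ) = ∑_r a_r exp (-2iπ ⟨J r, ρ⟩)`. -/
def fcoef (a : Phase d → ℂ) (r : Fin d ⊕ Fin d → ℤ) : ℂ :=
  ∫ ρ in Set.univ.pi fun _ : Fin d ⊕ Fin d => Set.Ico (0 : ℝ) 1,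
    a ρ * Complex.exp (((2 * Real.pi * ((Matrix.J (Fin d) ℝ *ᵥ intPt r) ⬝ᵥ ρ) : ℝ) : ℂ)
      * Complex.I)

/-- The Weyl quantization `Op^w(a) = ∑_r a_r U_ħ(r/N)` of a smooth periodic `a`. -/
def opWeyl (N : ℕ) (a : Phase d → ℂ) (ψ : 𝓢'(Conf d, ℂ)) : 𝓢'(Conf d, ℂ) :=
  ∑' r : Fin d ⊕ Fin d → ℤ, fcoef a r • heisDist N ((N : ℝ)⁻¹ • intPt r) ψ

/-! ### Reduction of `A` and the positive quantization adapted to it -/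

/-- The `⋄`-product of two matrices in block form. -/
def diamond {m n : Type*} (M₁ : Matrix (m ⊕ m) (m ⊕ m) ℝ) (M₂ : Matrix (n ⊕ n) (n ⊕ n) ℝ) :
    Matrix ((m ⊕ n) ⊕ (m ⊕ n)) ((m ⊕ n) ⊕ (m ⊕ n)) ℝ :=
  Matrix.fromBlocks
    (Matrix.fromBlocks M₁.toBlocks₁₁ 0 0 M₂.toBlocks₁₁)
    (Matrix.fromBlocks M₁.toBlocks₁₂ 0 0 M₂.toBlocks₁₂)
    (Matrix.fromBlocks M₁.toBlocks₂₁ 0 0 M₂.toBlocks₂₁)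
    (Matrix.fromBlocks M₁.toBlocks₂₂ 0 0 M₂.toBlocks₂₂)

/-- A symplectic reduction `A = Q (A₀ ⋄ A₁ ⋄ ⋯ ⋄ A_r) Q⁻¹` adapted to the Lyapunov exponents, with
`A_i = diag (D_i, (D_i*)⁻¹)` for `1 ≤ i ≤ r`.  (The product `A₁ ⋄ ⋯ ⋄ A_r` is the matrix
`diag (diag (D_i), diag ((D_i*)⁻¹))`.) -/
structure Reduction (A : SpZ d) where
  /-- Half the dimension of the neutral space. -/
  d₀ : ℕ
  /-- The number of distinct positive exponents. -/
  r : ℕ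
  /-- The multiplicities. -/
  dim : Fin r → ℕ
  dim_pos : ∀ i, 0 < dim i
  /-- The positive exponents, in increasing order. -/
  lam : Fin r → ℝ
  lam_pos : ∀ i, 0 < lam i
  lam_strictMono : StrictMono lam
  /-- The identification of the coordinates of `ℝ^{d₀} ⊕ ℝ^{d₁} ⊕ ⋯ ⊕ ℝ^{d_r}` with those of
  `ℝ^d`. -/
  idx : Fin d₀ ⊕ (Σ i, Fin (dim i)) ≃ Fin d
  /-- The neutral block. -/
  A₀ : Matrix.symplecticGroup (Fin d₀) ℝ
  A₀_spec : ∀ z ∈ spectrum ℂ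
    ((A₀ : Matrix (Fin d₀ ⊕ Fin d₀) (Fin d₀ ⊕ Fin d₀) ℝ).map (Complex.ofReal : ℝ → ℂ)), ‖z‖ = 1
  /-- The unstable blocks. -/
  D : (i : Fin r) → GL (Fin (dim i)) ℝ
  D_spec : ∀ i, ∀ z ∈ spectrum ℂ
    ((D i : Matrix (Fin (dim i)) (Fin (dim i)) ℝ).map (Complex.ofReal : ℝ → ℂ)),
    ‖z‖ = Real.exp (lam i)
  /-- The symplectic change of coordinates. -/
  Q : Matrix.symplecticGroup (Fin d) ℝ
  conj_eq : realMat A = (Q : PMat d ℝ) *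
    Matrix.reindex (Equiv.sumCongr idx idx) (Equiv.sumCongr idx idx)
      (diamond (A₀ : Matrix (Fin d₀ ⊕ Fin d₀) (Fin d₀ ⊕ Fin d₀) ℝ)
        (Matrix.fromBlocks
          (Matrix.blockDiagonal' fun i => (D i : Matrix (Fin (dim i)) (Fin (dim i)) ℝ)) 0 0
          (Matrix.blockDiagonal' fun i =>
            (((D i)⁻¹ : GL (Fin (dim i)) ℝ) : Matrix (Fin (dim i)) (Fin (dim i)) ℝ)ᵀ))) *
    ((Q⁻¹ : Matrix.symplecticGroup (Fin d) ℝ) : PMat d ℝ)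

variable {A : SpZ d}

/-- The diagonal matrix `D₁(ħ)`, with entries `ħ^{-ε₀/(2λ_max)}` on the neutral coordinates and
`ħ^{-λ_i/(2λ_max)}` on the coordinates of the `i`-th block. -/
def Reduction.D₁ (S : Reduction A) (ε₀ : ℝ) (N : ℕ) : Matrix (Fin d) (Fin d) ℝ :=
  Matrix.reindex S.idx S.idx (Matrix.diagonal
    (Sum.elim (fun _ => hbar N ^ (-(ε₀ / (2 * lamMax A))))
      (fun s => hbar N ^ (-(S.lam s.1 / (2 * lamMax A))))))

/-- `B(ħ) = Q diag (D₁(ħ), D₁(ħ)) Q⁻¹`. -/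
def Reduction.B (S : Reduction A) (ε₀ : ℝ) (N : ℕ) : PMat d ℝ :=
  (S.Q : PMat d ℝ) * Matrix.fromBlocks (S.D₁ ε₀ N) 0 0 (S.D₁ ε₀ N) *
    ((S.Q⁻¹ : Matrix.symplecticGroup (Fin d) ℝ) : PMat d ℝ)

/-- The Gaussian `G(ρ) = exp (-π ‖ρ‖²)`, for the Euclidean norm. -/
def gauss (ρ : Phase d) : ℝ := Real.exp (-Real.pi * (ρ ⬝ᵥ ρ))

/-- `G_ħ = 2^{d/2} |det B(ħ)|^{1/2} G ∘ B(ħ)`. -/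
def Reduction.gaussB (S : Reduction A) (ε₀ : ℝ) (N : ℕ) (ρ : Phase d) : ℝ :=
  2 ^ ((d : ℝ) / 2) * |(S.B ε₀ N).det| ^ (1 / 2 : ℝ) * gauss (S.B ε₀ N *ᵥ ρ)

/-- The Moyal product
`(a ♯ b)(ρ) = (πħ)^{-2d} ∫∫ exp (-(2i/ħ) σ(w₁, w₂)) a(ρ + w₁) b(ρ + w₂) dw₁ dw₂`,
the Weyl symbol of `Op^w(a) ∘ Op^w(b)`, for Schwartz functions `a`, `b` on phase space. -/
def moyal (N : ℕ) (a b : Phase d → ℂ) (ρ : Phase d) : ℂ :=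
  (((Real.pi * hbar N) ^ (2 * d) : ℝ) : ℂ)⁻¹ *
    ∫ w : Phase d × Phase d,
      Complex.exp (((-(2 / hbar N) * symp w.1 w.2 : ℝ) : ℂ) * Complex.I) *
        a (ρ + w.1) * b (ρ + w.2)

/-- The convolution `a ⋆ (G_ħ ♯ G_ħ)`. -/
def Reduction.smoothed (S : Reduction A) (ε₀ : ℝ) (N : ℕ) (a : Phase d → ℂ) (ρ : Phase d) : ℂ :=
  ∫ ρ₀ : Phase d, a ρ₀ *
    moyal N (fun w => (S.gaussB ε₀ N w : ℂ)) (fun w => (S.gaussB ε₀ N w : ℂ)) (ρ - ρ₀)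

/-- The positive quantization `Op^+(a) = Op^w(a ⋆ (G_ħ ♯ G_ħ))`. -/
def Reduction.opPos (S : Reduction A) (ε₀ : ℝ) (N : ℕ) (a : Phase d → ℂ) (ψ : 𝓢'(Conf d, ℂ)) :
    𝓢'(Conf d, ℂ) :=
  opWeyl N (S.smoothed ε₀ N a) ψ

/-- `μ^N(a) = ⟨ψ | Op^+(a) ψ⟩` in `𝓗_N(κ)`, for real `a` (the scalar product is then real). -/
def Reduction.mu (S : Reduction A) (ε₀ : ℝ) (N : ℕ) (κ : Phase d) (ψ : 𝓢'(Conf d, ℂ))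
    (a : Phase d → ℝ) : ℝ :=
  (stateInner N κ ψ (S.opPos ε₀ N (fun ρ => (a ρ : ℂ)) ψ)).re

/-! ### Smooth partitions and the quantum entropy -/

/-- A smooth partition of the torus: smooth `ℤ^{2d}`-periodic functions with values in `[0, 1]`
and `∑_i P_i² = 1`. -/
structure IsSmoothPartition {K : ℕ} (P : Fin K → Phase d → ℝ) : Prop where
  smooth : ∀ i, ContDiff ℝ ∞ (P i)
  periodic : ∀ i (r : Fin d ⊕ Fin d → ℤ) (ρ : Phase d), P i (ρ + intPt r) = P i ρ
  mem_Icc : ∀ i ρ, P i ρ ∈ Set.Icc (0 : ℝ) 1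
  sum_sq : ∀ ρ, ∑ i, P i ρ ^ 2 = 1

/-- `P_α = ∏_{j=-m}^{m-1} P_{α_j} ∘ A^j`; the letter `α_j` is `α k` with `k = j + m`. -/
def refined (A : SpZ d) {K : ℕ} (P : Fin K → Phase d → ℝ) (m : ℕ) (α : Fin (2 * m) → Fin K)
    (ρ : Phase d) : ℝ :=
  ∏ k : Fin (2 * m), P (α k) (act (A ^ (((k : ℕ) : ℤ) - (m : ℤ))) ρ)

/-- The quantum entropy `h_{2m}(ψ, P) = -∑_{|α| = 2m} μ^N(P_α²) log μ^N(P_α²)`. -/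
def Reduction.entropy (S : Reduction A) (ε₀ : ℝ) (N : ℕ) (κ : Phase d) {K : ℕ}
    (P : Fin K → Phase d → ℝ) (m : ℕ) (ψ : 𝓢'(Conf d, ℂ)) : ℝ :=
  ∑ α : Fin (2 * m) → Fin K, Real.negMulLog (S.mu ε₀ N κ ψ fun ρ => refined A P m α ρ ^ 2)

/-- The Ehrenfest time `m_E(N) = ⌊(1 - ε) log N / (2 λ_max)⌋`. -/
def ehrenfest (A : SpZ d) (ε : ℝ) (N : ℕ) : ℕ :=
  ⌊(1 - ε) * Real.log N / (2 * lamMax A)⌋₊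

/-- `ψ` is a unit eigenvector of `M_κ(A)`, the restriction of `M(A)` to `𝓗_N(κ)`, where `κ` is an
element of `[0, 2π)^{2d}` such that `M(A) 𝓗_N(κ) = 𝓗_N(κ)`. -/
structure IsUnitEigenstate (N : ℕ) (A : SpZ d) (κ : Phase d) (ψ : 𝓢'(Conf d, ℂ)) : Prop where
  kappa_mem : ∀ i, κ i ∈ Set.Ico (0 : ℝ) (2 * Real.pi)
  mem : ψ ∈ states N κ
  unit : stateInner N κ ψ ψ = 1
  eigen : ∃ M : Propagator N A,
    (states N κ).map (M.onDist : 𝓢'(Conf d, ℂ) →ₗ[ℂ] 𝓢'(Conf d, ℂ)) = states N κ ∧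
    ∃ z : ℂ, M.onDist ψ = z • ψ

end CatMap

end

open CatMap

noncomputable section
namespace CatMap

/-! ### Shannon entropy of finite distributions -/

/-! For a fixed eigenstate ψ the numbers w(j, L, β) = μ_ψ((∏ P_{β_i} ∘ A^{j+i})²) behave like the
laws of the words of a classical process. They are nonnegative because the quantization is positive,
and consistent under summing out letters on either side because μ_ψ is linear, gives mass one to the
constant 1, and ∑ P_i² = 1 (`IsSmoothPartition.isProcess`). Shannon entropy is therefore subadditive
on words. The window of length 2m_E is cut into blocks of length 2m₀ and a remainder shorter than
2m₀, which costs at most 2m₀ log K. If each block has nearly the law of the central block, the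
inequality follows, since the number K^{2m₀} of words in a block does not depend on N and -t log t
is uniformly continuous on [0, 1] (`IsProcess.entropy_rate_le`).

Approximate stationarity is proved on the Fourier side. Write a = ∑ a_r e_r. Smoothing by G_ħ ♯ G_ħ
is a Fourier multiplier, so μ_ψ(a) is the real part of ∑ a_r k(r) ⟨ψ, U(r/N) ψ⟩ with k =
`kernelHat`. For an eigenstate the expectation of U(r/N) is exactly invariant under r ↦ Ar
(`IsUnitEigenstate.expect_actZ`). Hence μ_ψ(a ∘ A^j) - μ_ψ(a) only involves the differences k(A^{-j}
r) - k(r).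

A Gaussian computation (`kernelHat_eq`) gives k(r) = exp(-(π/2) ‖B⁻¹ r‖²) exp(-(π/2) ‖B r / 2N‖²).
On the block of exponent λ_i, A^{±j} grows like e^{λ_i |j|}, which is at most N^{(1-ε) λ_i / 2λ_max}
up to the Ehrenfest time, apart from an arbitrarily small loss in the exponent. B⁻¹ contracts this
block by about N^{-λ_i / 2λ_max}, and B/2N contracts it at least as fast because λ_i ≤ λ_max. The
neutral block has exponent 0 and dilation rate ε₀, so the same holds there. Thus k(A^j r) - 1 is
O(N^{-2γ} ‖r‖²), uniformly for |j| ≤ m_E (`Reduction.exists_kernelHat_act_le`), and dominated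
convergence over the absolutely convergent Fourier series finishes the estimate.

Two facts about the quantum side are proved directly. A state is a Dirac comb determined by finitely
many coefficients (`states_eq_zero_of_coef`), and the lattice translations act irreducibly. The
propagator therefore preserves the scalar product up to a constant (`exists_stateInner_map`), which
gives the exact invariance. For positivity, k(r-s) ⟨ψ, U((r-s)/N) ψ⟩ is shown to be a Gram kernel in
(r, s) (`kernelHat_mul_expect`). -/

open Real in
lemma negMulLog_le_of_mul {p a b : ℝ} (hp : 0 ≤ p) (ha : p ≤ a) (hb : p ≤ b) :
    negMulLog p ≤ -(p * log a) - p * log b + (a * b - p) := by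
  rcases hp.eq_or_lt with rfl | hp
  · simp only [negMulLog_zero, zero_mul, neg_zero, sub_zero, zero_add]
    exact mul_nonneg ha hb
  have ha' := hp.trans_le ha
  have hb' := hp.trans_le hb
  -- This is Gibbs' inequality before summation. The bounds p ≤ a and p ≤ b only serve to make a and
  -- b positive here.
  have h1 : log (a * b / p) ≤ a * b / p - 1 := log_le_sub_one_of_pos (by positivity)
  rw [log_div (by positivity) hp.ne', log_mul ha'.ne' hb'.ne'] at h1
  have h2 := mul_le_mul_of_nonneg_left h1 hp.le
  have h3 : p * (a * b / p - 1) = a * b - p := by field_simp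
  rw [h3] at h2
  simp only [negMulLog]
  linarith

-- Gibbs' inequality comparing the joint law with the product of its marginals: the corrections a b
-- - p sum to 1 - 1 = 0.
open Real in
lemma sum_negMulLog_joint_le {α β : Type*} [Fintype α] [Fintype β] (p : α → β → ℝ)
    (hp : ∀ a b, 0 ≤ p a b) (hs : ∑ a, ∑ b, p a b = 1) :
    ∑ a, ∑ b, negMulLog (p a b) ≤
      ∑ a, negMulLog (∑ b, p a b) + ∑ b, negMulLog (∑ a, p a b) := by
  have h1 : ∀ a b, p a b ≤ ∑ b, p a b := fun a b =>
    Finset.single_le_sum (f := fun b => p a b) (fun i _ => hp a i) (Finset.mem_univ b)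
  have h2 : ∀ a b, p a b ≤ ∑ a, p a b := fun a b =>
    Finset.single_le_sum (f := fun a => p a b) (fun i _ => hp i b) (Finset.mem_univ a)
  have hs' : ∑ b, ∑ a, p a b = 1 := by rw [Finset.sum_comm]; exact hs
  have key : ∑ a, ∑ b, negMulLog (p a b) ≤ ∑ a, ∑ b,
      (-(p a b * log (∑ b, p a b)) - p a b * log (∑ a, p a b) +
        ((∑ b, p a b) * (∑ a, p a b) - p a b)) :=
    Finset.sum_le_sum fun a _ => Finset.sum_le_sum fun b _ =>
      negMulLog_le_of_mul (hp a b) (h1 a b) (h2 a b)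
  refine key.trans (le_of_eq ?_)
  simp only [Finset.sum_add_distrib, Finset.sum_sub_distrib, Finset.sum_neg_distrib]
  have e1 : ∑ a, ∑ b, p a b * log (∑ b, p a b) = -∑ a, negMulLog (∑ b, p a b) := by
    rw [← Finset.sum_neg_distrib]
    refine Finset.sum_congr rfl fun a _ => ?_
    rw [← Finset.sum_mul]; simp [negMulLog]
  have e2 : ∑ a, ∑ b, p a b * log (∑ a, p a b) = -∑ b, negMulLog (∑ a, p a b) := by
    rw [Finset.sum_comm, ← Finset.sum_neg_distrib]
    refine Finset.sum_congr rfl fun a _ => ?_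
    rw [← Finset.sum_mul]; simp [negMulLog]
  have e3 : ∑ a, ∑ b, (∑ b, p a b) * (∑ a, p a b) = 1 := by
    rw [← Finset.sum_mul_sum, hs, hs', one_mul]
  rw [e1, e2, e3, hs]; ring

-- Gibbs' inequality against the uniform law.
open Real in
lemma sum_negMulLog_le_log_card {α : Type*} [Fintype α] (p : α → ℝ)
    (hp : ∀ a, 0 ≤ p a) (hs : ∑ a, p a = 1) :
    ∑ a, negMulLog (p a) ≤ log (Fintype.card α) := by
  have hne : Nonempty α := by
    by_contra h
    rw [not_nonempty_iff] at h
    simp at hs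
  have hK : (0 : ℝ) < Fintype.card α := by exact_mod_cast Fintype.card_pos
  have h : ∀ a, negMulLog (p a) ≤ p a * log (Fintype.card α) +
      ((Fintype.card α : ℝ)⁻¹ - p a) := by
    intro a
    have h1 : p a ≤ 1 := hs ▸ Finset.single_le_sum (fun i _ => hp i) (Finset.mem_univ a)
    rcases (hp a).eq_or_lt with h0 | h0
    · rw [← h0]; simp
    have h3 : log ((Fintype.card α : ℝ)⁻¹ / p a) ≤ (Fintype.card α : ℝ)⁻¹ / p a - 1 :=
      log_le_sub_one_of_pos (by positivity)
    rw [log_div (by positivity) h0.ne', log_inv] at h3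
    have h2 := mul_le_mul_of_nonneg_left h3 h0.le
    have h4 : p a * ((Fintype.card α : ℝ)⁻¹ / p a - 1) = (Fintype.card α : ℝ)⁻¹ - p a := by
      field_simp
    rw [h4] at h2
    simp only [negMulLog]
    linarith
  refine (Finset.sum_le_sum fun a _ => h a).trans (le_of_eq ?_)
  rw [Finset.sum_add_distrib, Finset.sum_sub_distrib, ← Finset.sum_mul, hs]
  simp

/-! ### Entropy of a process on words -/

/-- The laws `w j L` of the words of length `L` starting at time `j` of a process with letters in
`Fin K`. -/
structure IsProcess {K : ℕ} (w : ℤ → (L : ℕ) → (Fin L → Fin K) → ℝ) : Prop where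
  nonneg : ∀ j L β, 0 ≤ w j L β
  empty : ∀ j β, w j 0 β = 1
  sum_right : ∀ j L L' α, ∑ β : Fin L' → Fin K, w j (L + L') (Fin.append α β) = w j L α
  sum_left : ∀ j L L' β, ∑ α : Fin L → Fin K, w j (L + L') (Fin.append α β) = w (j + L) L' β

/-- The Shannon entropy of the words of length `L` starting at time `j`. -/
def wordEntropy {K : ℕ} (w : ℤ → (L : ℕ) → (Fin L → Fin K) → ℝ) (j : ℤ) (L : ℕ) : ℝ :=
  ∑ β, Real.negMulLog (w j L β)

lemma sum_append {K L L' : ℕ} (F : (Fin (L + L') → Fin K) → ℝ) :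
    ∑ α, ∑ β, F (Fin.append α β) = ∑ γ, F γ := by
  rw [← Fintype.sum_prod_type' (f := fun α β => F (Fin.append α β))]
  exact Fintype.sum_equiv (Fin.appendEquiv L L') _ _ fun x => rfl

namespace IsProcess

variable {K : ℕ} {w : ℤ → (L : ℕ) → (Fin L → Fin K) → ℝ}

lemma sum_eq_one (hw : IsProcess w) (j : ℤ) (L : ℕ) : ∑ β, w j L β = 1 := by
  have h := hw.sum_left j L 0 Fin.elim0
  rw [hw.empty] at h
  rw [← h]
  refine Finset.sum_congr rfl fun α _ => ?_
  congr 1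
  exact (Fin.append_elim0 α).symm

lemma le_one (hw : IsProcess w) (j : ℤ) (L : ℕ) (β) : w j L β ≤ 1 :=
  hw.sum_eq_one j L ▸ Finset.single_le_sum (fun i _ => hw.nonneg j L i) (Finset.mem_univ β)

lemma entropy_nonneg (hw : IsProcess w) (j : ℤ) (L : ℕ) : 0 ≤ wordEntropy w j L :=
  Finset.sum_nonneg fun β _ => Real.negMulLog_nonneg (hw.nonneg j L β) (hw.le_one j L β)

/-- A word of length L + L' is a pair of words, and consistency identifies both marginals; only the
right one has its starting time moved. -/
lemma entropy_add_le (hw : IsProcess w) (j : ℤ) (L L' : ℕ) :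
    wordEntropy w j (L + L') ≤ wordEntropy w j L + wordEntropy w (j + L) L' := by
  have h := sum_negMulLog_joint_le (fun α β => w j (L + L') (Fin.append α β))
    (fun _ _ => hw.nonneg _ _ _) (by rw [sum_append]; exact hw.sum_eq_one _ _)
  rw [sum_append (fun γ => Real.negMulLog (w j (L + L') γ))] at h
  simp only [hw.sum_left, hw.sum_right] at h
  exact h

lemma entropy_le_mul_log (hw : IsProcess w) (j : ℤ) (L : ℕ) : wordEntropy w j L ≤ L * Real.log K := by
  induction L generalizing j with
  | zero => simp [wordEntropy, hw.empty]
  | succ L ih =>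
    have h1 : wordEntropy w (j + L) 1 ≤ Real.log K := by
      have := sum_negMulLog_le_log_card (w (j + L) 1) (fun _ => hw.nonneg _ _ _)
        (hw.sum_eq_one _ _)
      simpa [wordEntropy] using this
    have := hw.entropy_add_le j L 1
    have := ih j
    push_cast
    linarith

/-- Subadditivity over the q full blocks; the s leftover letters are charged the trivial bound log K
each. -/
lemma entropy_blocks_le (hw : IsProcess w) (j : ℤ) (L₀ q s : ℕ) :
    wordEntropy w j (q * L₀ + s) ≤
      ∑ i ∈ Finset.range q, wordEntropy w (j + (i * L₀ : ℕ)) L₀ + s * Real.log K := by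
  have h : ∀ q : ℕ, wordEntropy w j (q * L₀) ≤
      ∑ i ∈ Finset.range q, wordEntropy w (j + (i * L₀ : ℕ)) L₀ := by
    intro q
    induction q with
    | zero => rw [Nat.zero_mul]; simp [wordEntropy, hw.empty]
    | succ q ih =>
      rw [Finset.sum_range_succ, add_mul, one_mul]
      exact (hw.entropy_add_le _ _ _).trans (by linarith)
  have h1 := hw.entropy_add_le j (q * L₀) s
  have h2 := hw.entropy_le_mul_log (j + (q * L₀ : ℕ)) s
  have := h q
  linarith

end IsProcess

/-- A modulus of continuity of `t ↦ -t log t` on `[0, 1]`. -/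
def entropyModulus (δ : ℝ) : ℝ :=
  sSup {t | ∃ x ∈ Set.Icc (0 : ℝ) 1, ∃ y ∈ Set.Icc (0 : ℝ) 1, |x - y| ≤ δ ∧
    t = |Real.negMulLog x - Real.negMulLog y|}

lemma negMulLog_unif : UniformContinuousOn Real.negMulLog (Set.Icc (0 : ℝ) 1) :=
  isCompact_Icc.uniformContinuousOn_of_continuous Real.continuous_negMulLog.continuousOn

lemma bddAbove_entropyModulus (δ : ℝ) :
    BddAbove {t | ∃ x ∈ Set.Icc (0 : ℝ) 1, ∃ y ∈ Set.Icc (0 : ℝ) 1, |x - y| ≤ δ ∧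
      t = |Real.negMulLog x - Real.negMulLog y|} := by
  obtain ⟨C, hC⟩ := (isCompact_Icc (a := (0 : ℝ)) (b := 1)).exists_bound_of_continuousOn
    Real.continuous_negMulLog.continuousOn
  refine ⟨C + C, ?_⟩
  rintro t ⟨x, hx, y, hy, -, rfl⟩
  exact (abs_sub _ _).trans (add_le_add (hC x hx) (hC y hy))

lemma abs_negMulLog_sub_le {x y δ : ℝ} (hx : x ∈ Set.Icc (0 : ℝ) 1) (hy : y ∈ Set.Icc (0 : ℝ) 1)
    (h : |x - y| ≤ δ) : |Real.negMulLog x - Real.negMulLog y| ≤ entropyModulus δ :=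
  le_csSup (bddAbove_entropyModulus δ) ⟨x, hx, y, hy, h, rfl⟩

lemma entropyModulus_nonneg {δ : ℝ} (hδ : 0 ≤ δ) : 0 ≤ entropyModulus δ :=
  (abs_nonneg _).trans (abs_negMulLog_sub_le (x := 0) (y := 0) (by simp) (by simp) (by simpa))

lemma tendsto_entropyModulus {δ : ℕ → ℝ} (h0 : ∀ n, 0 ≤ δ n)
    (h : Filter.Tendsto δ Filter.atTop (nhds 0)) :
    Filter.Tendsto (fun n => entropyModulus (δ n)) Filter.atTop (nhds 0) := by
  rw [Metric.tendsto_atTop]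
  intro e he
  obtain ⟨d, hd, H⟩ := Metric.uniformContinuousOn_iff.1 negMulLog_unif (e / 2) (by linarith)
  obtain ⟨n₀, hn⟩ := Metric.tendsto_atTop.1 h d hd
  refine ⟨n₀, fun n hnn => ?_⟩
  have h1 : entropyModulus (δ n) ≤ e / 2 := by
    refine csSup_le ⟨_, 0, by simp, 0, by simp, by simpa using h0 n, rfl⟩ ?_
    rintro t ⟨x, hx, y, hy, hxy, rfl⟩
    refine (H x hx y hy ?_).le
    have := hn n hnn
    rw [Real.dist_eq, sub_zero, abs_of_nonneg (h0 n)] at this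
    exact hxy.trans_lt this
  rw [Real.dist_eq, sub_zero, abs_of_nonneg (entropyModulus_nonneg (h0 n))]
  linarith

/-- Subadditivity of the entropy of a process that is approximately stationary on a time window. -/
lemma IsProcess.entropy_rate_le {K : ℕ} {w : ℤ → (L : ℕ) → (Fin L → Fin K) → ℝ}
    (hw : IsProcess w) {m m₀ : ℕ} (hm : 1 ≤ m) (hm₀ : 1 ≤ m₀) (hK : 1 ≤ K)
    {δ : ℝ} (hδ : 0 ≤ δ)
    (hst : ∀ j : ℤ, |j| ≤ m → ∀ β, |w (-m₀ + j) (2 * m₀) β - w (-m₀) (2 * m₀) β| ≤ δ) :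
    1 / (2 * (m : ℝ)) * wordEntropy w (-m) (2 * m) ≤
      1 / (2 * (m₀ : ℝ)) * wordEntropy w (-m₀) (2 * m₀) +
        (1 / (2 * (m₀ : ℝ)) * ((K : ℝ) ^ (2 * m₀) * entropyModulus δ) +
          1 / (2 * (m : ℝ)) * ((2 * m₀ : ℝ) * Real.log K)) := by
  -- When m < m₀ this gives q = 0, and the whole window is remainder.
  set q := 2 * m / (2 * m₀) with hq
  set s := 2 * m % (2 * m₀) with hs
  have hdiv : q * (2 * m₀) + s = 2 * m := by
    rw [mul_comm]; exact Nat.div_add_mod _ _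
  have hslt : s < 2 * m₀ := Nat.mod_lt _ (by omega)
  have h1 := hw.entropy_blocks_le (-m) (2 * m₀) q s
  rw [hdiv] at h1
  have hblock : ∀ i ∈ Finset.range q, wordEntropy w (-m + (i * (2 * m₀) : ℕ)) (2 * m₀) ≤
      wordEntropy w (-m₀) (2 * m₀) + (K : ℝ) ^ (2 * m₀) * entropyModulus δ := by
    intro i hi
    rw [Finset.mem_range] at hi
    have hi2 : i * (2 * m₀) + 2 * m₀ ≤ 2 * m := by
      calc i * (2 * m₀) + 2 * m₀ = (i + 1) * (2 * m₀) := by ring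
        _ ≤ q * (2 * m₀) := Nat.mul_le_mul_right _ hi
        _ ≤ 2 * m := by omega
    -- Block i is the central block shifted by 2m₀i - m + m₀. The shift stays in the window because
    -- the block ends no later than time m.
    have hj : |((i * (2 * m₀) : ℕ) : ℤ) - m + m₀| ≤ m := by
      rw [abs_le]; constructor <;> omega
    have hst' := hst _ hj
    have e : -(m₀ : ℤ) + (((i * (2 * m₀) : ℕ) : ℤ) - m + m₀) = -m + (i * (2 * m₀) : ℕ) := by ring
    rw [e] at hst'
    have : wordEntropy w (-m + (i * (2 * m₀) : ℕ)) (2 * m₀) ≤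
        ∑ β : Fin (2 * m₀) → Fin K, (Real.negMulLog (w (-m₀) (2 * m₀) β) + entropyModulus δ) := by
      refine Finset.sum_le_sum fun β _ => ?_
      have := abs_negMulLog_sub_le ⟨hw.nonneg _ _ β, hw.le_one _ _ β⟩
        ⟨hw.nonneg _ _ β, hw.le_one _ _ β⟩ (hst' β)
      linarith [le_abs_self (Real.negMulLog (w (-m + (i * (2 * m₀) : ℕ)) (2 * m₀) β) -
        Real.negMulLog (w (-m₀) (2 * m₀) β))]
    refine this.trans (le_of_eq ?_)
    rw [Finset.sum_add_distrib]
    simp [wordEntropy]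
  have h2 := Finset.sum_le_sum hblock
  rw [Finset.sum_const, Finset.card_range, nsmul_eq_mul] at h2
  set E := wordEntropy w (-m₀) (2 * m₀) + (K : ℝ) ^ (2 * m₀) * entropyModulus δ with hE
  -- The sign matters: the blocks fill the window only up to the remainder, so q/2m ≤ 1/2m₀ is an
  -- inequality that gets multiplied by E.
  have hE0 : 0 ≤ E := add_nonneg (hw.entropy_nonneg _ _)
    (mul_nonneg (by positivity) (entropyModulus_nonneg hδ))
  have hlog : 0 ≤ Real.log K := Real.log_nonneg (by exact_mod_cast hK)
  have hm' : (0 : ℝ) < m := by exact_mod_cast hm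
  have hm₀' : (0 : ℝ) < m₀ := by exact_mod_cast hm₀
  have hqm : (q : ℝ) * (2 * m₀) ≤ 2 * m := by
    have : q * (2 * m₀) ≤ 2 * m := by omega
    exact_mod_cast this
  have h3 : (s : ℝ) * Real.log K ≤ (2 * m₀ : ℝ) * Real.log K := by
    refine mul_le_mul_of_nonneg_right ?_ hlog
    exact_mod_cast hslt.le
  have h4 : 1 / (2 * (m : ℝ)) * (q * E) ≤ 1 / (2 * (m₀ : ℝ)) * E := by
    rw [← mul_assoc]
    refine mul_le_mul_of_nonneg_right ?_ hE0
    rw [div_mul_eq_mul_div, one_mul, div_le_div_iff₀ (by positivity) (by positivity)]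
    linarith
  calc 1 / (2 * (m : ℝ)) * wordEntropy w (-m) (2 * m)
      ≤ 1 / (2 * (m : ℝ)) * (q * E + (2 * m₀ : ℝ) * Real.log K) := by
        refine mul_le_mul_of_nonneg_left ?_ (by positivity)
        linarith
    _ ≤ _ := by rw [mul_add, ← add_assoc, ← mul_add]; linarith

end CatMap
end

/-! ### Division of smooth functions by linear factors -/

noncomputable section
namespace CatMap

open MeasureTheory in
/-- Hadamard's lemma. -/
lemma exists_hadamard {E F : Type*} [NormedAddCommGroup E] [NormedSpace ℝ E]
    [NormedAddCommGroup F] [NormedSpace ℝ F] [CompleteSpace F] {φ : E → F} (hφ : ContDiff ℝ ∞ φ)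
    (x : E) :
    ∃ h : E → E →L[ℝ] F, ContDiff ℝ ∞ h ∧ h x = fderiv ℝ φ x ∧
      ∀ y, φ y - φ x = h y (y - x) := by
  have hD : ContDiff ℝ ∞ (fderiv ℝ φ) := hφ.fderiv_right (by simp)
  -- The quotient is ∫₀¹ Dφ(x + t(p - x)) dt. It is written as a convolution at 0 of the indicator
  -- of (0, 1] with a function depending on the parameter p, so that smoothness in p follows from
  -- the smoothness of convolutions with parameters. The cutoff θ supplies the compact support and
  -- equals 1 where the indicator lives; convolution evaluates at -t, whence the minus sign in g.
  let θ : ContDiffBump (0 : ℝ) := ⟨2, 3, by norm_num, by norm_num⟩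
  let g : E → ℝ → E →L[ℝ] F := fun p u => θ u • fderiv ℝ φ (x - u • (p - x))
  let f : ℝ → ℝ := Set.indicator (Set.Ioc 0 1) 1
  let h : E → E →L[ℝ] F := fun p => convolution f (g p) (ContinuousLinearMap.lsmul ℝ ℝ) volume 0
  have hh : ∀ p, h p = ∫ t in (0 : ℝ)..1, fderiv ℝ φ (x + t • (p - x)) := by
    intro p
    rw [intervalIntegral.integral_of_le zero_le_one, ← integral_indicator measurableSet_Ioc]
    refine integral_congr_ae (Filter.Eventually.of_forall fun t => ?_)
    by_cases ht : t ∈ Set.Ioc (0 : ℝ) 1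
    · have : θ (-t) = 1 := θ.one_of_mem_closedBall (by
        rw [mem_closedBall_zero_iff, norm_neg, Real.norm_eq_abs, abs_of_pos ht.1]
        exact ht.2.trans (by norm_num [θ]))
      simp [f, g, ht, this]
    · simp [f, ht]
  refine ⟨h, ?_, ?_, ?_⟩
  · rw [← contDiffOn_univ]
    refine contDiffOn_convolution_right_with_param_comp (n := ⊤) (k := Metric.closedBall 0 3)
      (ContinuousLinearMap.lsmul ℝ ℝ) contDiffOn_const isOpen_univ (isCompact_closedBall _ _) ?_ ?_ ?_
    · intro p u _ hu
      have : θ u = 0 := θ.zero_of_le_dist (by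
        rw [Metric.mem_closedBall, not_le] at hu; exact hu.le)
      simp [g, this]
    · exact ((integrable_indicator_iff measurableSet_Ioc).2
        (integrableOn_const (C := (1 : ℝ)) (by simp))).locallyIntegrable
    · refine ContDiff.contDiffOn ?_
      refine (θ.contDiff.comp contDiff_snd).smul (hD.comp ?_)
      exact contDiff_const.sub (contDiff_snd.smul (contDiff_fst.sub contDiff_const))
  · rw [hh]; simp
  · intro y
    have hd : ∀ t : ℝ, HasDerivAt (fun t : ℝ => φ (x + t • (y - x)))
        (fderiv ℝ φ (x + t • (y - x)) (y - x)) t := by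
      intro t
      have h1 : HasDerivAt (fun t : ℝ => x + t • (y - x)) (y - x) t := by
        simpa using ((hasDerivAt_id t).smul_const (y - x)).const_add x
      exact ((hφ.differentiable (by simp)) _).hasFDerivAt.comp_hasDerivAt t h1
    have hc : Continuous fun t : ℝ => fderiv ℝ φ (x + t • (y - x)) :=
      hD.continuous.comp (by fun_prop)
    have h2 := intervalIntegral.integral_eq_sub_of_hasDerivAt (a := 0) (b := 1)
      (fun t _ => hd t) ((hc.clm_apply continuous_const).intervalIntegrable _ _)
    rw [hh, ContinuousLinearMap.intervalIntegral_apply (hc.intervalIntegrable _ _), h2]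
    simp

lemma exists_hadamard_pi {d : ℕ} {φ : Conf d → ℂ} (hφ : ContDiff ℝ ∞ φ) (x : Conf d) :
    ∃ g : Fin d → Conf d → ℂ, (∀ j, ContDiff ℝ ∞ (g j)) ∧
      ∀ y, φ y - φ x = ∑ j, ((y j - x j : ℝ) : ℂ) * g j y := by
  obtain ⟨h, hs, -, hh⟩ := exists_hadamard hφ x
  refine ⟨fun j y => h y (Pi.single j 1), fun j => hs.clm_apply contDiff_const, fun y => ?_⟩
  have h1 := (h y : Conf d →ₗ[ℝ] ℂ).pi_apply_eq_sum_univ (y - x)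
  rw [ContinuousLinearMap.coe_coe] at h1
  rw [hh, h1]
  refine Finset.sum_congr rfl fun j _ => ?_
  have : (Pi.single j 1 : Conf d) = fun i => if j = i then 1 else 0 := by
    ext i; simp [Pi.single_apply, eq_comm]
  simp [this]

/-- The zeros of e^{it} - 1 are the multiples of 2π, and the one at 0 is simple (derivative i), so
dividing by t removes the only zero in |t| < 2π. -/
lemma exists_expI_sub_one : ∃ E : ℝ → ℂ, ContDiff ℝ ∞ E ∧
    (∀ t : ℝ, Complex.exp ((t : ℂ) * Complex.I) - 1 = t * E t) ∧
    ∀ t : ℝ, |t| < 2 * Real.pi → E t ≠ 0 := by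
  have hs : ContDiff ℝ ∞ (fun t : ℝ => Complex.exp ((t : ℂ) * Complex.I)) :=
    (Complex.ofRealCLM.contDiff.mul contDiff_const).cexp
  obtain ⟨h, hc, h0, hh⟩ := exists_hadamard hs 0
  have key : ∀ t : ℝ, Complex.exp ((t : ℂ) * Complex.I) - 1 = t * h t 1 := by
    intro t
    have := hh t
    simp only [Complex.ofReal_zero, zero_mul, Complex.exp_zero, sub_zero] at this
    rw [this]
    have e : t = t • (1 : ℝ) := by simp
    conv_lhs => rw [e]
    rw [map_smul]; simp
  refine ⟨fun t => h t 1, hc.clm_apply contDiff_const, key, fun t ht h1 => ?_⟩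
  rcases eq_or_ne t 0 with rfl | ht0
  · simp only [h0] at h1
    have hd : HasDerivAt (fun t : ℝ => Complex.exp ((t : ℂ) * Complex.I))
        (Complex.exp (((0:ℝ) : ℂ) * Complex.I) * (1 * Complex.I)) 0 :=
      ((Complex.ofRealCLM.hasDerivAt (x := 0)).mul_const Complex.I).cexp
    rw [fderiv_apply_one_eq_deriv, hd.deriv] at h1
    simp at h1
  · have h2 := key t
    simp only [h1, mul_zero, sub_eq_zero] at h2
    rw [Complex.exp_eq_one_iff] at h2
    obtain ⟨n, hn⟩ := h2
    have h3 : (t : ℂ) = ((n * (2 * Real.pi) : ℝ) : ℂ) := by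
      have : (t : ℂ) * Complex.I = ((n * (2 * Real.pi) : ℝ) : ℂ) * Complex.I := by
        rw [hn]; push_cast; ring
      exact mul_right_cancel₀ Complex.I_ne_zero this
    have h4 : t = n * (2 * Real.pi) := by exact_mod_cast h3
    have hn0 : n ≠ 0 := by rintro rfl; simp at h4; exact ht0 h4
    have : (1 : ℝ) ≤ |(n : ℝ)| := by exact_mod_cast Int.one_le_abs hn0
    rw [h4, abs_mul, abs_of_pos Real.two_pi_pos] at ht
    nlinarith [Real.two_pi_pos]

/-! ### The local structure of a state -/

variable {d : ℕ} {N : ℕ} {κ : Phase d}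

/-- The momentum lattice translation by the `j`-th unit vector, minus its eigenvalue on the states,
is multiplication by this function. -/
def latticeSymbol (N : ℕ) (κ : Phase d) (j : Fin d) (y : Conf d) : ℂ :=
  Complex.exp (((2 * Real.pi * N * y j : ℝ) : ℂ) * Complex.I) -
    Complex.exp ((κ (Sum.inr j) : ℂ) * Complex.I)

lemma latticeSymbol_contDiff (j : Fin d) : ContDiff ℝ ∞ (latticeSymbol N κ j) := by
  refine ContDiff.sub (ContDiff.cexp (ContDiff.mul ?_ contDiff_const)) contDiff_const
  exact Complex.ofRealCLM.contDiff.comp (contDiff_const.mul (contDiff_apply ℝ ℝ j))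

/-- The integer momentum vector `(0, e_j)`. -/
def unitMomentum (j : Fin d) : Fin d ⊕ Fin d → ℤ := Sum.elim 0 (Pi.single j 1)

lemma heisPhase_unitMomentum (j : Fin d) (y : Conf d) :
    heisPhase N (intPt (unitMomentum j)) y =
      Complex.exp (((2 * Real.pi * N * y j : ℝ) : ℂ) * Complex.I) := by
  have h1 : (intPt (unitMomentum j) ∘ Sum.inr : Conf d) = Pi.single j 1 := by
    ext i; by_cases h : i = j
    · subst h; simp [intPt, unitMomentum]
    · simp [intPt, unitMomentum, h]
  have h2 : (intPt (unitMomentum j) ∘ Sum.inl : Conf d) = 0 := by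
    ext i; simp [intPt, unitMomentum]
  rw [heisPhase, h1, h2]
  simp only [single_dotProduct, dotProduct_zero, one_mul, zero_div, sub_zero, hbar]
  congr 3
  rw [one_div, div_inv_eq_mul, mul_comm]

/-- Translation by (0, e_j) is multiplication by a character, and a state is an eigenvector of it
with eigenvalue e^{iκ_{2,j}}. The difference is multiplication by `latticeSymbol`, so a state
annihilates the ideal generated by these symbols. -/
lemma states_apply_latticeSymbol {ψ : 𝓢'(Conf d, ℂ)} (hψ : ψ ∈ states N κ) (j : Fin d)
    {φ h : 𝓢(Conf d, ℂ)} (hh : ∀ y, φ y = latticeSymbol N κ j y * h y) : ψ φ = 0 := by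
  have h0 := congrArg (fun u : 𝓢'(Conf d, ℂ) => u h) (hψ (unitMomentum j))
  have h1 : (intPt (unitMomentum j) ∘ Sum.inr : Conf d) = Pi.single j 1 := by
    ext i; by_cases h : i = j
    · subst h; simp [intPt, unitMomentum]
    · simp [intPt, unitMomentum, h]
  have h2 : (intPt (unitMomentum j) ∘ Sum.inl : Conf d) = 0 := by
    ext i; simp [intPt, unitMomentum]
  have h3 : Sum.elim (-(intPt (unitMomentum j) ∘ Sum.inl)) (intPt (unitMomentum j) ∘ Sum.inr)
      = (intPt (unitMomentum j) : Phase d) := by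
    rw [h2, neg_zero]; ext i
    rcases i with i | i
    · simp [intPt, unitMomentum]
    · rfl
  have h4 : φ = heis N (intPt (unitMomentum j)) h -
      Complex.exp ((κ (Sum.inr j) : ℂ) * Complex.I) • h := by
    ext y
    rw [hh, sub_apply, heis_apply, heisPhase_unitMomentum, h2]
    simp [latticeSymbol, sub_mul]
  have h5 : heisDist N (intPt (unitMomentum j)) ψ h = ψ (heis N (intPt (unitMomentum j)) h) := by
    rw [heisDist, h3]; rfl
  simp only [h5, h1, h2] at h0
  rw [h4, map_sub, h0, map_smul]
  simp

lemma states_apply_sum {ψ : 𝓢'(Conf d, ℂ)} (hψ : ψ ∈ states N κ)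
    {φ : Conf d → ℂ} (hφ : ContDiff ℝ ∞ φ) (hc : HasCompactSupport φ) {h : Fin d → Conf d → ℂ}
    (hs : ∀ j, ContDiff ℝ ∞ (h j)) (hhc : ∀ j, HasCompactSupport (h j))
    (hh : ∀ y, φ y = ∑ j, latticeSymbol N κ j y * h j y) :
    ψ (hc.toSchwartzMap hφ) = 0 := by
  have hs' : ∀ j, ContDiff ℝ ∞ (fun y => latticeSymbol N κ j y * h j y) := fun j =>
    (latticeSymbol_contDiff j).mul (hs j)
  have hc' : ∀ j, HasCompactSupport (fun y => latticeSymbol N κ j y * h j y) := fun j =>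
    (hhc j).mul_left
  have e : hc.toSchwartzMap hφ = ∑ j, (hc' j).toSchwartzMap (hs' j) := by
    ext y
    rw [sum_apply]
    exact hh y
  rw [e, map_sum]
  refine Finset.sum_eq_zero fun j _ => ?_
  exact states_apply_latticeSymbol hψ j (h := (hhc j).toSchwartzMap (hs j)) fun y => rfl

lemma latticeSymbol_eq (hN : 1 ≤ N) (k : Fin d → ℤ) (j : Fin d) (y : Conf d) :
    latticeSymbol N κ j y = Complex.exp ((κ (Sum.inr j) : ℂ) * Complex.I) *
      (Complex.exp (((2 * Real.pi * N * (y j - node N κ k j) : ℝ) : ℂ) * Complex.I) - 1) := by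
  have hN' : (N : ℝ) ≠ 0 := by positivity
  rw [latticeSymbol, mul_sub, ← Complex.exp_add, mul_one]
  congr 1
  rw [Complex.exp_eq_exp_iff_exists_int]
  refine ⟨k j, ?_⟩
  have : 2 * Real.pi * N * (y j - node N κ k j) =
      2 * Real.pi * N * y j - k j * (2 * Real.pi) - κ (Sum.inr j) := by
    simp only [node]
    field_simp
    ring
  rw [this]; push_cast; ring

lemma exists_node_of_latticeSymbol (hN : 1 ≤ N) {y : Conf d}
    (hy : ∀ j, latticeSymbol N κ j y = 0) : ∃ k : Fin d → ℤ, y = node N κ k := by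
  have hN' : (N : ℝ) ≠ 0 := by positivity
  have h : ∀ j, ∃ n : ℤ, 2 * Real.pi * N * y j = κ (Sum.inr j) + n * (2 * Real.pi) := by
    intro j
    have := hy j
    rw [latticeSymbol, sub_eq_zero, Complex.exp_eq_exp_iff_exists_int] at this
    obtain ⟨n, hn⟩ := this
    refine ⟨n, ?_⟩
    have h2 : ((2 * Real.pi * N * y j : ℝ) : ℂ) * Complex.I =
      ((κ (Sum.inr j) + n * (2 * Real.pi) : ℝ) : ℂ) * Complex.I := by
      rw [hn]; push_cast; ring
    exact_mod_cast mul_right_cancel₀ Complex.I_ne_zero h2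
  choose k hk using h
  refine ⟨k, funext fun j => ?_⟩
  have := hk j
  simp only [node]
  field_simp
  linarith

lemma one_div_le_dist_node (hN : 1 ≤ N) {k l : Fin d → ℤ} (h : k ≠ l) :
    1 / (N : ℝ) ≤ dist (node N κ k) (node N κ l) := by
  obtain ⟨j, hj⟩ := Function.ne_iff.1 h
  have hN' : (0 : ℝ) < N := by positivity
  refine le_trans ?_ (dist_le_pi_dist _ _ j)
  have : node N κ k j - node N κ l j = ((k j - l j : ℤ) : ℝ) / N := by
    simp only [node]; push_cast; ring
  rw [Real.dist_eq, this, abs_div, abs_of_pos hN']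
  gcongr
  rw [← Int.cast_abs]
  exact_mod_cast Int.one_le_abs (sub_ne_zero.2 hj)

lemma one_div_succ_lt (hN : 1 ≤ N) : 1 / ((N : ℝ) + 1) < 1 / (N : ℝ) := by
  apply one_div_lt_one_div_of_lt
  · positivity
  · linarith

lemma bump_node_of_ne (hN : 1 ≤ N) {k l : Fin d → ℤ} (h : k ≠ l) :
    ∀ᶠ y in nhds (node N κ l), bump N (node N κ k) y = 0 := by
  have : node N κ l ∉ tsupport (bump N (node N κ k)) := by
    rw [(bump N (node N κ k)).tsupport_eq, Metric.mem_closedBall, not_le]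
    exact (one_div_succ_lt hN).trans_le (one_div_le_dist_node hN h.symm)
  exact notMem_tsupport_iff_eventuallyEq.1 this

lemma bump_node_self (k : Fin d → ℤ) :
    ∀ᶠ y in nhds (node N κ k), bump N (node N κ k) y = 1 :=
  (bump N (node N κ k)).eventuallyEq_one

lemma bumpS_node (hN : 1 ≤ N) (k l : Fin d → ℤ) :
    bumpS N (node N κ k) (node N κ l) = if k = l then 1 else 0 := by
  change ((bump N (node N κ k) (node N κ l) : ℝ) : ℂ) = _
  split_ifs with h
  · subst h; rw [(bump_node_self (κ := κ) k).self_of_nhds]; simp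
  · rw [(bump_node_of_ne hN h).self_of_nhds]; simp

/-- The symbols have simple zeros at a node with independent differentials, so near it they generate
all functions vanishing there. This is what excludes derivatives of Dirac masses from a state. -/
lemma states_apply_bump_mul (hN : 1 ≤ N) {ψ : 𝓢'(Conf d, ℂ)} (hψ : ψ ∈ states N κ)
    (k : Fin d → ℤ) {φ : Conf d → ℂ} (hφ : ContDiff ℝ ∞ φ) (h0 : φ (node N κ k) = 0)
    (hc : HasCompactSupport fun y => ((bump N (node N κ k) y : ℝ) : ℂ) * φ y)
    (hs : ContDiff ℝ ∞ fun y => ((bump N (node N κ k) y : ℝ) : ℂ) * φ y) :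
    ψ (hc.toSchwartzMap hs) = 0 := by
  obtain ⟨g, hg, hgφ⟩ := exists_hadamard_pi hφ (node N κ k)
  obtain ⟨E, hE, hE1, hE0⟩ := exists_expI_sub_one
  have hN' : (0 : ℝ) < N := by positivity
  set x := node N κ k with hx
  let e : Fin d → Conf d → ℂ := fun j y => E (2 * Real.pi * N * (y j - x j))
  have he : ∀ j, ContDiff ℝ ∞ (e j) := fun j =>
    hE.comp (contDiff_const.mul ((contDiff_apply ℝ ℝ j).sub contDiff_const))
  -- Within distance 1/N of the node the argument of E stays in (-2π, 2π). The support of the bump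
  -- has radius 1/(N+1) < 1/N, so the quotient below is formed only where its denominator is
  -- nonzero.
  have hne : ∀ j y, dist y x < 1 / N → e j y ≠ 0 := by
    intro j y hy
    refine hE0 _ ?_
    have h1 : |y j - x j| < 1 / N := (dist_le_pi_dist y x j).trans_lt hy
    rw [abs_mul, abs_of_pos (by positivity)]
    calc 2 * Real.pi * N * |y j - x j| < 2 * Real.pi * N * (1 / N) := by gcongr
      _ = 2 * Real.pi := by field_simp
  let c : Fin d → ℂ := fun j => Complex.exp ((κ (Sum.inr j) : ℂ) * Complex.I) *
    ((2 * Real.pi * N : ℝ) : ℂ)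
  have hcne : ∀ j, c j ≠ 0 := fun j => mul_ne_zero (Complex.exp_ne_zero _)
    (by exact_mod_cast (by positivity : (2 * Real.pi * N : ℝ) ≠ 0))
  have hfar : ∀ y, ¬ dist y x < 1 / N → ∀ᶠ z in nhds y, bump N x z = 0 := by
    intro y hy
    have : y ∉ tsupport (bump N x) := by
      rw [(bump N x).tsupport_eq, Metric.mem_closedBall, not_le]
      exact (one_div_succ_lt hN).trans_le (not_lt.1 hy)
    exact notMem_tsupport_iff_eventuallyEq.1 this
  have hb : ContDiff ℝ ∞ fun y => ((bump N x y : ℝ) : ℂ) :=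
    Complex.ofRealCLM.contDiff.comp (bump N x).contDiff
  have hbc : HasCompactSupport fun y => ((bump N x y : ℝ) : ℂ) :=
    (bump N x).hasCompactSupport.comp_left Complex.ofReal_zero
  refine states_apply_sum hψ hs hc (h := fun j y => ((bump N x y : ℝ) : ℂ) *
    (g j y * (c j * e j y)⁻¹)) ?_ (fun j => hbc.mul_right) ?_
  · intro j
    rw [contDiff_iff_contDiffAt]
    intro y
    by_cases hy : dist y x < 1 / N
    · exact hb.contDiffAt.mul ((hg j).contDiffAt.mul
        (ContDiffAt.inv (contDiffAt_const.mul (he j).contDiffAt)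
          (mul_ne_zero (hcne j) (hne j y hy))))
    · refine (contDiffAt_const (c := (0 : ℂ))).congr_of_eventuallyEq ?_
      filter_upwards [hfar y hy] with z hz
      simp [hz]
  · intro y
    by_cases hy : dist y x < 1 / N
    · have h1 : φ y = ∑ j, ((y j - x j : ℝ) : ℂ) * g j y := by
        rw [← hgφ, h0, sub_zero]
      rw [h1, Finset.mul_sum]
      refine Finset.sum_congr rfl fun j _ => ?_
      rw [latticeSymbol_eq hN k, hE1]
      have h2 : E (2 * Real.pi * N * (y j - node N κ k j)) = e j y := rfl
      rw [h2]
      have h3 := hne j y hy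
      have h4 := hcne j
      simp only [c] at h4 ⊢
      rw [← hx]
      have h5 := left_ne_zero_of_mul h4
      have h6 := right_ne_zero_of_mul h4
      have h7 : (N : ℂ) ≠ 0 := by exact_mod_cast hN'.ne'
      push_cast at h6 ⊢
      field_simp
    · have := (hfar y hy).self_of_nhds
      simp [this]

end CatMap

end

/-! ### Density of compactly supported functions; states as Dirac combs -/

noncomputable section
namespace CatMap

-- Precomposing with a contraction does not increase the derivatives, so the cutoffs of growing
-- support have uniformly bounded derivatives.
open ContinuousMultilinearMap in
lemma exists_bound_iteratedFDeriv_scaled {E : Type*} [NormedAddCommGroup E] [NormedSpace ℝ E]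
    {θ : E → ℂ} (hs : ContDiff ℝ ∞ θ) (hc : HasCompactSupport θ) (i : ℕ) :
    ∃ C, ∀ (n : ℕ) (y : E), ‖iteratedFDeriv ℝ i (fun y => θ (((n : ℝ) + 1)⁻¹ • y)) y‖ ≤ C := by
  obtain ⟨C, hC⟩ := (hc.iteratedFDeriv i).exists_bound_of_continuous
    (hs.continuous_iteratedFDeriv (m := i) (by exact_mod_cast le_top))
  refine ⟨C, fun n y => ?_⟩
  let g : E →L[ℝ] E := ((n : ℝ) + 1)⁻¹ • ContinuousLinearMap.id ℝ E
  have hg : ‖g‖ ≤ 1 := by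
    refine (norm_smul_le ((n : ℝ) + 1)⁻¹ (ContinuousLinearMap.id ℝ E)).trans ?_
    rw [norm_inv, Real.norm_of_nonneg (by positivity)]
    have h1 : ((n : ℝ) + 1)⁻¹ ≤ 1 := inv_le_one_of_one_le₀ (by linarith [n.cast_nonneg (α := ℝ)])
    exact mul_le_one₀ h1 (norm_nonneg _) ContinuousLinearMap.norm_id_le
  have e : (fun y => θ (((n : ℝ) + 1)⁻¹ • y)) = θ ∘ g := rfl
  rw [e, g.iteratedFDeriv_comp_right hs y (by exact_mod_cast le_top)]
  refine (norm_compContinuousLinearMap_le _ _).trans ?_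
  refine (mul_le_mul (hC _) (Finset.prod_le_one (fun _ _ => norm_nonneg _) fun _ _ => hg)
    (Finset.prod_nonneg fun _ _ => norm_nonneg _) ((norm_nonneg _).trans (hC 0))).trans ?_
  rw [mul_one]

/-- Compactly supported functions are dense in the Schwartz space. -/
lemma dense_compactSupport {E : Type*} [NormedAddCommGroup E] [NormedSpace ℝ E]
    [FiniteDimensional ℝ E] :
    Dense {φ : 𝓢(E, ℂ) | HasCompactSupport φ} := by
  intro φ
  let b : ContDiffBump (0 : E) := ⟨1, 2, by norm_num, by norm_num⟩
  let θ : E → ℂ := fun y => ((b y : ℝ) : ℂ)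
  have hθ : ContDiff ℝ ∞ θ := Complex.ofRealCLM.contDiff.comp b.contDiff
  have hθc : HasCompactSupport θ := b.hasCompactSupport.comp_left Complex.ofReal_zero
  let θn : ℕ → E → ℂ := fun n y => θ (((n : ℝ) + 1)⁻¹ • y)
  have hθn : ∀ n, ContDiff ℝ ∞ (θn n) := fun n => hθ.comp (contDiff_const_smul _)
  have hθnc : ∀ n, HasCompactSupport (θn n) := fun n =>
    hθc.comp_smul (by positivity)
  have hc : ∀ n, HasCompactSupport fun y => θn n y * φ y := fun n => (hθnc n).mul_right
  have hs : ∀ n, ContDiff ℝ ∞ fun y => θn n y * φ y := fun n => (hθn n).mul (φ.smooth ⊤)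
  let φn : ℕ → 𝓢(E, ℂ) := fun n => (hc n).toSchwartzMap (hs n)
  have hnear : ∀ (n : ℕ) (y : E), ‖y‖ < n + 1 → ∀ᶠ z in nhds y, θn n z - 1 = 0 := by
    intro n y hy
    have ho : {z : E | ‖z‖ < n + 1} ∈ nhds y :=
      (isOpen_lt continuous_norm continuous_const).mem_nhds hy
    filter_upwards [ho] with z hz
    have : b (((n : ℝ) + 1)⁻¹ • z) = 1 := b.one_of_mem_closedBall (by
      rw [mem_closedBall_zero_iff, norm_smul, norm_inv, Real.norm_of_nonneg (by positivity),
        inv_mul_le_iff₀ (by positivity)]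
      have hz' : ‖z‖ < n + 1 := hz
      simpa [b] using hz'.le)
    simp [θn, θ, this]
  -- The function θ_n - 1 vanishes for ‖y‖ < n + 1, and elsewhere ‖y‖/(n+1) ≥ 1 comes for free. One
  -- power of ‖y‖, absorbed by the next Schwartz seminorm, thus buys the decay 1/(n+1).
  have hbound : ∀ i, ∃ C, 0 ≤ C ∧ ∀ (n : ℕ) (y : E),
      ‖iteratedFDeriv ℝ i (fun y => θn n y - 1) y‖ ≤ C * (‖y‖ / (n + 1)) := by
    intro i
    obtain ⟨C, hC⟩ := exists_bound_iteratedFDeriv_scaled hθ hθc i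
    obtain ⟨C', hC'⟩ : ∃ C', ∀ (n : ℕ) (y : E), ‖iteratedFDeriv ℝ i (fun y => θn n y - 1) y‖ ≤ C' := by
      refine ⟨C + 1, fun n y => ?_⟩
      have e : (fun y => θn n y - 1) = θn n - fun _ => (1 : ℂ) := rfl
      rw [e, iteratedFDeriv_sub ((hθn n).of_le (by exact_mod_cast le_top)) contDiff_const]
      refine (norm_sub_le _ _).trans (add_le_add (hC n y) ?_)
      rcases Nat.eq_zero_or_pos i with rfl | hi
      · simp
      · rw [iteratedFDeriv_const_of_ne hi.ne']; simp
    have hC'0 : 0 ≤ C' := (norm_nonneg _).trans (hC' 0 0)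
    refine ⟨C', hC'0, fun n y => ?_⟩
    by_cases hy : ‖y‖ < n + 1
    · have : (fun y => θn n y - 1) =ᶠ[nhds y] fun _ => (0 : ℂ) := hnear n y hy
      rw [(this.iteratedFDeriv (𝕜 := ℝ) i).self_of_nhds]
      have : iteratedFDeriv ℝ i (fun _ : E => (0 : ℂ)) y = 0 := by
        rw [iteratedFDeriv_fun_zero]; rfl
      rw [this, norm_zero]; positivity
    · refine (hC' n y).trans (le_mul_of_one_le_right hC'0 ?_)
      rw [one_le_div (by positivity)]
      exact not_lt.1 hy
  have hlim : Filter.Tendsto φn Filter.atTop (nhds φ) := by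
    rw [(schwartz_withSeminorms ℂ E ℂ).tendsto_nhds]
    rintro ⟨k, m⟩ ε hε
    choose C hC0 hC using hbound
    set D := ∑ i ∈ Finset.range (m + 1), (m.choose i : ℝ) * C i *
      SchwartzMap.seminorm ℂ (k + 1) (m - i) φ with hD
    have hle : ∀ n : ℕ, SchwartzMap.seminorm ℂ k m (φn n - φ) ≤ D / (n + 1) := by
      intro n
      have hD0 : 0 ≤ D := Finset.sum_nonneg fun i _ =>
        mul_nonneg (mul_nonneg (by positivity) (hC0 i)) (apply_nonneg _ _)
      refine SchwartzMap.seminorm_le_bound ℂ k m _ (by positivity) fun y => ?_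
      have e : ((φn n - φ : 𝓢(E, ℂ)) : E → ℂ) = fun y => (θn n y - 1) * φ y := by
        funext y
        rw [sub_apply, sub_mul, one_mul]; rfl
      rw [e]
      have h1 := norm_iteratedFDeriv_mul_le (𝕜 := ℝ) (f := fun y => θn n y - 1) (g := φ) (N := ∞)
        ((hθn n).sub contDiff_const) (φ.smooth ⊤) y (n := m) (by exact_mod_cast le_top)
      refine (mul_le_mul_of_nonneg_left h1 (by positivity)).trans ?_
      rw [hD, Finset.mul_sum, Finset.sum_div]
      refine Finset.sum_le_sum fun i _ => ?_
      have h2 := hC i n y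
      have h3 := SchwartzMap.le_seminorm ℂ (k + 1) (m - i) φ y
      calc ‖y‖ ^ k * ((m.choose i : ℝ) * ‖iteratedFDeriv ℝ i (fun y => θn n y - 1) y‖ *
            ‖iteratedFDeriv ℝ (m - i) φ y‖)
          ≤ ‖y‖ ^ k * ((m.choose i : ℝ) * (C i * (‖y‖ / (n + 1))) *
            ‖iteratedFDeriv ℝ (m - i) φ y‖) := by gcongr
        _ = (m.choose i : ℝ) * C i * (‖y‖ ^ (k + 1) * ‖iteratedFDeriv ℝ (m - i) φ y‖) / (n + 1) := by
            rw [pow_succ]; ring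
        _ ≤ _ := by
            have := hC0 i
            gcongr
    have hl : Filter.Tendsto (fun n : ℕ => D / ((n : ℝ) + 1)) Filter.atTop (nhds 0) :=
      tendsto_const_nhds.div_atTop
        (Filter.tendsto_atTop_add_const_right _ _ tendsto_natCast_atTop_atTop)
    filter_upwards [hl.eventually_lt_const hε] with n hn
    exact (hle n).trans_lt hn
  exact mem_closure_of_tendsto hlim (Filter.Eventually.of_forall fun n => hc n)

lemma tempered_ext_compactSupport {d : ℕ} {ψ ψ' : 𝓢'(Conf d, ℂ)}
    (h : ∀ φ : 𝓢(Conf d, ℂ), HasCompactSupport φ → ψ φ = ψ' φ) : ψ = ψ' := by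
  have h1 : (fun φ => ψ φ) = fun φ => ψ' φ :=
    Continuous.ext_on dense_compactSupport (map_continuous ψ) (map_continuous ψ') h
  ext φ
  exact congrFun h1 φ

variable {d : ℕ} {N : ℕ} {κ : Phase d}

/-- The sum W of the squared moduli of the symbols vanishes only at the nodes, where φ is locally
zero. So φ is the sum over j of symbol_j times φ · conj(symbol_j)/W, with smooth quotients. -/
lemma states_apply_of_eventually (hN : 1 ≤ N) {ψ : 𝓢'(Conf d, ℂ)} (hψ : ψ ∈ states N κ)
    {φ : 𝓢(Conf d, ℂ)} (hc : HasCompactSupport φ)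
    (h0 : ∀ k, ∀ᶠ y in nhds (node N κ k), φ y = 0) : ψ φ = 0 := by
  let W : Conf d → ℂ := fun y => ∑ j, latticeSymbol N κ j y * (starRingEnd ℂ) (latticeSymbol N κ j y)
  have hconj : ∀ j, ContDiff ℝ ∞ fun y => (starRingEnd ℂ) (latticeSymbol N κ j y) := fun j =>
    Complex.conjCLE.contDiff.comp (latticeSymbol_contDiff j)
  have hW : ContDiff ℝ ∞ W := ContDiff.sum fun j _ => (latticeSymbol_contDiff j).mul (hconj j)
  have hW0 : ∀ y, W y = 0 → ∃ k, y = node N κ k := by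
    intro y hy
    refine exists_node_of_latticeSymbol hN fun j => ?_
    have h1 : ∑ j, Complex.normSq (latticeSymbol N κ j y) = 0 := by
      simp only [W, Complex.mul_conj] at hy
      exact_mod_cast hy
    rw [Finset.sum_eq_zero_iff_of_nonneg fun _ _ => Complex.normSq_nonneg _] at h1
    exact Complex.normSq_eq_zero.1 (h1 j (Finset.mem_univ j))
  have e : φ = hc.toSchwartzMap (φ.smooth ⊤) := rfl
  rw [e]
  refine states_apply_sum hψ (φ.smooth ⊤) hc
    (h := fun j y => φ y * ((starRingEnd ℂ) (latticeSymbol N κ j y) * (W y)⁻¹)) ?_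
    (fun j => hc.mul_right) ?_
  · intro j
    rw [contDiff_iff_contDiffAt]
    intro y
    by_cases hy : W y = 0
    · obtain ⟨k, rfl⟩ := hW0 y hy
      refine (contDiffAt_const (c := (0 : ℂ))).congr_of_eventuallyEq ?_
      filter_upwards [h0 k] with z hz
      simp [hz]
    · exact (φ.smooth ⊤).contDiffAt.mul ((hconj j).contDiffAt.mul (hW.contDiffAt.inv hy))
  · intro y
    by_cases hy : W y = 0
    · obtain ⟨k, rfl⟩ := hW0 y hy
      simp [(h0 k).self_of_nhds]
    · have : ∀ j, latticeSymbol N κ j y * (φ y * ((starRingEnd ℂ) (latticeSymbol N κ j y) * (W y)⁻¹))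
        = (φ y * (W y)⁻¹) * (latticeSymbol N κ j y * (starRingEnd ℂ) (latticeSymbol N κ j y)) :=
        fun j => by ring
      simp only [this]
      rw [← Finset.mul_sum]
      change φ y = φ y * (W y)⁻¹ * W y
      rw [inv_mul_cancel_right₀ hy]

lemma exists_finset_nodes (N : ℕ) (κ : Phase d) (hN : 1 ≤ N) {s : Set (Conf d)} (hs : IsCompact s) :
    ∃ T : Finset (Fin d → ℤ), ∀ k, node N κ k ∈ s → k ∈ T := by
  obtain ⟨R, hR⟩ := hs.isBounded.subset_closedBall 0
  have hN' : (0 : ℝ) < N := by positivity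
  have hb : ∃ M : ℤ, ∀ j : Fin d, N * R + |κ (Sum.inr j) / (2 * Real.pi)| ≤ M := by
    obtain ⟨B, hB⟩ := Finset.exists_le
      (Finset.univ.image fun j : Fin d => N * R + |κ (Sum.inr j) / (2 * Real.pi)|)
    exact ⟨⌈B⌉, fun j => (hB _ (Finset.mem_image_of_mem _ (Finset.mem_univ j))).trans (Int.le_ceil B)⟩
  obtain ⟨M, hM⟩ := hb
  refine ⟨Fintype.piFinset fun _ => Finset.Icc (-M) M, fun k hk => ?_⟩
  rw [Fintype.mem_piFinset]
  intro j
  have h1 : ‖node N κ k j‖ ≤ R := (norm_le_pi_norm _ j).trans (mem_closedBall_zero_iff.1 (hR hk))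
  have h2 : |(k j : ℝ) + κ (Sum.inr j) / (2 * Real.pi)| ≤ N * R := by
    simp only [node, Real.norm_eq_abs, abs_div, abs_of_pos hN'] at h1
    rwa [div_le_iff₀ hN', mul_comm R] at h1
  have h3 : |(k j : ℝ)| ≤ M := by
    have := abs_sub ((k j : ℝ) + κ (Sum.inr j) / (2 * Real.pi)) (κ (Sum.inr j) / (2 * Real.pi))
    rw [add_sub_cancel_right] at this
    linarith [hM j]
  rw [abs_le] at h3
  rw [Finset.mem_Icc]
  exact ⟨by exact_mod_cast h3.1, by exact_mod_cast h3.2⟩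

/-- A state is a combination of Dirac masses at the nodes. -/
lemma states_apply_eq_zero (hN : 1 ≤ N) {ψ : 𝓢'(Conf d, ℂ)} (hψ : ψ ∈ states N κ)
    {φ : 𝓢(Conf d, ℂ)} (hc : HasCompactSupport φ) (h0 : ∀ k, φ (node N κ k) = 0) : ψ φ = 0 := by
  classical
  obtain ⟨T, hT⟩ := exists_finset_nodes N κ hN (s := tsupport φ) hc
  have hbs : ∀ k, ContDiff ℝ ∞ fun y => ((bump N (node N κ k) y : ℝ) : ℂ) * φ y := fun k =>
    (Complex.ofRealCLM.contDiff.comp (bump N (node N κ k)).contDiff).mul (φ.smooth ⊤)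
  have hbc : ∀ k, HasCompactSupport fun y => ((bump N (node N κ k) y : ℝ) : ℂ) * φ y := fun k =>
    hc.mul_left
  let β : (Fin d → ℤ) → 𝓢(Conf d, ℂ) := fun k => (hbc k).toSchwartzMap (hbs k)
  have hβ : ∀ k y, β k y = ((bump N (node N κ k) y : ℝ) : ℂ) * φ y := fun k y => rfl
  -- Each bump is 1 near its own node and 0 near the others, so the remainder vanishes in a
  -- neighbourhood of every node, not merely at it.
  have hr : ψ (φ - ∑ k ∈ T, β k) = 0 := by
    have hap : ∀ y, (φ - ∑ k ∈ T, β k) y =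
        φ y - ∑ k ∈ T, ((bump N (node N κ k) y : ℝ) : ℂ) * φ y := by
      intro y; rw [sub_apply, sum_apply]; simp only [hβ]
    have hcs : HasCompactSupport (φ - ∑ k ∈ T, β k : 𝓢(Conf d, ℂ)) := by
      have : ((φ - ∑ k ∈ T, β k : 𝓢(Conf d, ℂ)) : Conf d → ℂ) =
          fun y => φ y * (1 - ∑ k ∈ T, ((bump N (node N κ k) y : ℝ) : ℂ)) := by
        funext y; rw [hap, ← Finset.sum_mul]; ring
      rw [this]
      exact hc.mul_right
    refine states_apply_of_eventually hN hψ hcs fun l => ?_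
    by_cases hl : l ∈ T
    · have h1 : ∀ᶠ y in nhds (node N κ l), ∀ k ∈ T, k ≠ l → bump N (node N κ k) y = 0 := by
        rw [Filter.eventually_all_finset]
        intro k _
        by_cases hkl : k = l
        · exact Filter.Eventually.of_forall fun y h => absurd hkl h
        · filter_upwards [bump_node_of_ne hN hkl] with y hy _ using hy
      filter_upwards [h1, bump_node_self (N := N) (κ := κ) l] with y hy hy'
      rw [hap, Finset.sum_eq_single_of_mem l hl fun k hk hkl => by rw [hy k hk hkl]; simp, hy']
      simp
    · have h1 : node N κ l ∉ tsupport φ := fun h => hl (hT l h)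
      filter_upwards [notMem_tsupport_iff_eventuallyEq.1 h1] with y hy
      rw [hap, hy]; simp
  have hsum : ψ (∑ k ∈ T, β k) = 0 := by
    rw [map_sum]
    exact Finset.sum_eq_zero fun k _ =>
      states_apply_bump_mul hN hψ k (φ.smooth ⊤) (h0 k) (hbc k) (hbs k)
  rw [map_sub, hsum, sub_zero] at hr
  exact hr

lemma hasCompactSupport_bumpS (N : ℕ) (x : Conf d) : HasCompactSupport (bumpS N x) :=
  (bump N x).hasCompactSupport.comp_left Complex.ofReal_zero

/-- A state is determined by its coefficients. -/
lemma states_eq_zero_of_coef (hN : 1 ≤ N) {ψ : 𝓢'(Conf d, ℂ)} (hψ : ψ ∈ states N κ)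
    (h : ∀ k, coef N κ ψ k = 0) : ψ = 0 := by
  refine tempered_ext_compactSupport fun φ hc => ?_
  obtain ⟨T, hT⟩ := exists_finset_nodes N κ hN (s := tsupport φ) hc
  have hcs : HasCompactSupport
      (φ - ∑ k ∈ T, φ (node N κ k) • bumpS N (node N κ k) : 𝓢(Conf d, ℂ)) := by
    refine HasCompactSupport.intro (K := tsupport φ ∪ ⋃ k ∈ T, tsupport (bumpS N (node N κ k)))
      (IsCompact.union hc (T.isCompact_biUnion fun k _ => hasCompactSupport_bumpS N _)) ?_
    intro y hy
    simp only [Set.mem_union, Set.mem_iUnion, not_or, not_exists] at hy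
    rw [sub_apply, sum_apply, image_eq_zero_of_notMem_tsupport hy.1, zero_sub, neg_eq_zero]
    refine Finset.sum_eq_zero fun k hk => ?_
    rw [smul_apply, image_eq_zero_of_notMem_tsupport (hy.2 k hk), smul_zero]
  have h1 := states_apply_eq_zero hN hψ hcs fun l => by
    rw [sub_apply, sum_apply]
    simp only [smul_apply, bumpS_node hN, smul_eq_mul, mul_ite, mul_one, mul_zero]
    rw [Finset.sum_ite_eq']
    split_ifs with hl
    · simp
    · rw [image_eq_zero_of_notMem_tsupport fun h => hl (hT l h), sub_zero]
  rw [map_sub, map_sum, sub_eq_zero] at h1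
  rw [h1]
  simp only [map_smul]
  change _ = (0 : ℂ)
  exact Finset.sum_eq_zero fun k _ => by
    have := h k
    rw [coef] at this
    rw [this, smul_zero]

end CatMap

end

noncomputable section
namespace CatMap

/-! ### Phases -/

/-- The phase `exp (i t)`. -/
def cis (t : ℝ) : ℂ := Complex.exp ((t : ℂ) * Complex.I)

lemma cis_add (s t : ℝ) : cis (s + t) = cis s * cis t := by
  rw [cis, cis, cis, ← Complex.exp_add]; push_cast; ring_nf

@[simp] lemma cis_zero : cis 0 = 1 := by simp [cis]

@[simp] lemma norm_cis (t : ℝ) : ‖cis t‖ = 1 := Complex.norm_exp_ofReal_mul_I t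

lemma conj_cis (t : ℝ) : (starRingEnd ℂ) (cis t) = cis (-t) := by
  rw [cis, cis, ← Complex.exp_conj]; simp

lemma cis_neg_mul (t : ℝ) : cis (-t) * cis t = 1 := by rw [← cis_add]; simp

lemma cis_int (n : ℤ) : cis (2 * Real.pi * n) = 1 := by
  rw [cis, Complex.exp_eq_one_iff]; exact ⟨n, by push_cast; ring⟩

lemma cis_add_int (t : ℝ) (n : ℤ) : cis (t + 2 * Real.pi * n) = cis t := by
  rw [cis_add, cis_int, mul_one]

lemma cis_eq_one {t : ℝ} (h : cis t = 1) : ∃ n : ℤ, t = n * (2 * Real.pi) := by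
  rw [cis, Complex.exp_eq_one_iff] at h
  obtain ⟨n, hn⟩ := h
  refine ⟨n, ?_⟩
  have h2 : (t : ℂ) * Complex.I = ((n * (2 * Real.pi) : ℝ) : ℂ) * Complex.I := by
    rw [hn]; push_cast; ring
  exact_mod_cast mul_right_cancel₀ Complex.I_ne_zero h2

lemma cis_nat_mul (n : ℕ) (t : ℝ) : cis (n * t) = cis t ^ n := by
  rw [cis, cis, ← Complex.exp_nat_mul]; push_cast; ring_nf

lemma cis_sum {ι : Type*} (s : Finset ι) (f : ι → ℝ) : cis (∑ i ∈ s, f i) = ∏ i ∈ s, cis (f i) := by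
  simp only [cis]
  rw [← Complex.exp_sum, Complex.ofReal_sum, Finset.sum_mul]

variable {d : ℕ} {N : ℕ} {κ : Phase d}

/-! ### The Heisenberg group -/

lemma symp_eq (ρ ρ' : Phase d) :
    symp ρ ρ' = (ρ ∘ Sum.inr) ⬝ᵥ (ρ' ∘ Sum.inl) - (ρ ∘ Sum.inl) ⬝ᵥ (ρ' ∘ Sum.inr) := by
  rw [symp, Matrix.J, Matrix.fromBlocks_mulVec]
  simp only [dotProduct, Fintype.sum_sum_type, Sum.elim_inl, Sum.elim_inr, Matrix.zero_mulVec,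
    Matrix.neg_mulVec, Matrix.one_mulVec, zero_add, add_zero, Pi.neg_apply, mul_neg,
    Finset.sum_neg_distrib, Function.comp]
  ring

lemma symp_add_left (a b c : Phase d) : symp (a + b) c = symp a c + symp b c := by
  simp only [symp, add_dotProduct]

lemma symp_add_right (a b c : Phase d) : symp a (b + c) = symp a b + symp a c := by
  simp only [symp, Matrix.mulVec_add, dotProduct_add]

lemma symp_smul_left (t : ℝ) (a b : Phase d) : symp (t • a) b = t * symp a b := by
  simp only [symp, smul_dotProduct, smul_eq_mul]

lemma symp_smul_right (t : ℝ) (a b : Phase d) : symp a (t • b) = t * symp a b := by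
  simp only [symp, Matrix.mulVec_smul, dotProduct_smul, smul_eq_mul]

lemma symp_swap (a b : Phase d) : symp b a = -symp a b := by
  rw [symp_eq, symp_eq, dotProduct_comm, dotProduct_comm (b ∘ Sum.inl)]; ring

lemma symp_self (a : Phase d) : symp a a = 0 := by
  have := symp_swap a a; linarith

lemma symp_neg_left (a b : Phase d) : symp (-a) b = -symp a b := by
  rw [← neg_one_smul ℝ, symp_smul_left]; ring

lemma symp_neg_right (a b : Phase d) : symp a (-b) = -symp a b := by
  rw [← neg_one_smul ℝ, symp_smul_right]; ring

lemma symp_sub_left (a b c : Phase d) : symp (a - b) c = symp a c - symp b c := by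
  rw [sub_eq_add_neg, symp_add_left, symp_neg_left]; ring

lemma symp_sub_right (a b c : Phase d) : symp a (b - c) = symp a b - symp a c := by
  rw [sub_eq_add_neg, symp_add_right, symp_neg_right]; ring

lemma exists_int_symp (r s : Fin d ⊕ Fin d → ℤ) : ∃ n : ℤ, symp (intPt r) (intPt s) = n := by
  refine ⟨(r ∘ Sum.inr) ⬝ᵥ (s ∘ Sum.inl) - (r ∘ Sum.inl) ⬝ᵥ (s ∘ Sum.inr), ?_⟩
  rw [symp_eq]; simp [intPt, dotProduct]

lemma intPt_add (r s : Fin d ⊕ Fin d → ℤ) : (intPt (r + s) : Phase d) = intPt r + intPt s := by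
  ext i; simp [intPt]

lemma intPt_neg (r : Fin d ⊕ Fin d → ℤ) : (intPt (-r) : Phase d) = -intPt r := by
  ext i; simp [intPt]

lemma intPt_sub (r s : Fin d ⊕ Fin d → ℤ) : (intPt (r - s) : Phase d) = intPt r - intPt s := by
  ext i; simp [intPt]

@[simp] lemma intPt_zero : (intPt (0 : Fin d ⊕ Fin d → ℤ) : Phase d) = 0 := by
  ext i; simp [intPt]

lemma intPt_natMul (n : ℕ) (r : Fin d ⊕ Fin d → ℤ) :
    (intPt (n • r) : Phase d) = (n : ℝ) • intPt r := by
  ext i; simp [intPt]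

lemma hbar_pos (hN : 1 ≤ N) : 0 < hbar N := by
  have : (0 : ℝ) < N := by positivity
  rw [hbar]; positivity

lemma heisPhase_eq (N : ℕ) (ρ : Phase d) (y : Conf d) :
    heisPhase N ρ y = cis (((ρ ∘ Sum.inr) ⬝ᵥ y - (ρ ∘ Sum.inr) ⬝ᵥ (ρ ∘ Sum.inl) / 2) / hbar N) :=
  rfl

lemma heis_heis (N : ℕ) (ρ ρ' : Phase d) (φ : 𝓢(Conf d, ℂ)) :
    heis N ρ (heis N ρ' φ) = cis (symp ρ ρ' / (2 * hbar N)) • heis N (ρ + ρ') φ := by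
  ext y
  have h1 : (ρ + ρ') ∘ Sum.inl = ρ ∘ Sum.inl + ρ' ∘ Sum.inl := rfl
  have h2 : (ρ + ρ') ∘ Sum.inr = ρ ∘ Sum.inr + ρ' ∘ Sum.inr := rfl
  rw [smul_apply, heis_apply, heis_apply, heis_apply, smul_eq_mul, ← mul_assoc, ← mul_assoc,
    heisPhase_eq, heisPhase_eq, heisPhase_eq, ← cis_add, ← cis_add, h1, h2, sub_sub, symp_eq]
  congr 2
  simp only [add_dotProduct, dotProduct_add, dotProduct_sub]
  rw [dotProduct_comm (ρ ∘ Sum.inl) (ρ' ∘ Sum.inr)]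
  ring

/-- The reflection `(x, ξ) ↦ (-x, ξ)`. -/
def flip (ρ : Phase d) : Phase d := Sum.elim (-(ρ ∘ Sum.inl)) (ρ ∘ Sum.inr)

lemma flip_inl (ρ : Phase d) : flip ρ ∘ Sum.inl = -(ρ ∘ Sum.inl) := rfl
lemma flip_inr (ρ : Phase d) : flip ρ ∘ Sum.inr = ρ ∘ Sum.inr := rfl

lemma flip_add (a b : Phase d) : flip (a + b) = flip a + flip b := by
  ext i; rcases i with i | i <;> simp [flip]; ring

lemma symp_flip (a b : Phase d) : symp (flip a) (flip b) = -symp a b := by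
  rw [symp_eq, symp_eq, flip_inl, flip_inr, flip_inl, flip_inr]
  simp only [neg_dotProduct, dotProduct_neg]; ring

lemma heisDist_apply (N : ℕ) (ρ : Phase d) (ψ : 𝓢'(Conf d, ℂ)) (φ : 𝓢(Conf d, ℂ)) :
    heisDist N ρ ψ φ = ψ (heis N (flip ρ) φ) := rfl

/-- Transposition reverses the order of the factors and the reflection reverses the sign of σ. The
two signs cancel, so distributions satisfy the same Weyl relation as functions. -/
lemma heisDist_heisDist (N : ℕ) (ρ ρ' : Phase d) (ψ : 𝓢'(Conf d, ℂ)) :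
    heisDist N ρ (heisDist N ρ' ψ) = cis (symp ρ ρ' / (2 * hbar N)) • heisDist N (ρ + ρ') ψ := by
  ext φ
  have : (cis (symp ρ ρ' / (2 * hbar N)) • heisDist N (ρ + ρ') ψ) φ =
    cis (symp ρ ρ' / (2 * hbar N)) • heisDist N (ρ + ρ') ψ φ := rfl
  rw [this]
  simp only [heisDist_apply]
  rw [heis_heis, map_smul, symp_flip, ← symp_swap, flip_add, add_comm (flip ρ)]

lemma heisDist_zero (N : ℕ) (ψ : 𝓢'(Conf d, ℂ)) : heisDist N 0 ψ = ψ := by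
  ext φ
  rw [heisDist_apply]
  congr 1
  ext y
  have h1 : flip (0 : Phase d) = 0 := by ext i; rcases i with i | i <;> simp [flip]
  have h2 : (0 : Phase d) ∘ Sum.inl = (0 : Conf d) := rfl
  have h3 : (0 : Phase d) ∘ Sum.inr = (0 : Conf d) := rfl
  rw [h1, heis_apply, heisPhase_eq, h2, h3]
  simp

/-- The translation `U_ħ(r / N)` by a point of the lattice `ℤ^{2d} / N`. -/
def weyl (N : ℕ) (r : Fin d ⊕ Fin d → ℤ) : 𝓢'(Conf d, ℂ) →L[ℂ] 𝓢'(Conf d, ℂ) :=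
  heisDist N ((N : ℝ)⁻¹ • intPt r)

lemma weyl_weyl (hN : 1 ≤ N) (r s : Fin d ⊕ Fin d → ℤ) (ψ : 𝓢'(Conf d, ℂ)) :
    weyl N r (weyl N s ψ) =
      cis (Real.pi / N * symp (intPt r) (intPt s)) • weyl N (r + s) ψ := by
  have hN' : (N : ℝ) ≠ 0 := by positivity
  rw [weyl, weyl, weyl, heisDist_heisDist, ← smul_add, ← intPt_add, symp_smul_left,
    symp_smul_right]
  congr 2
  rw [hbar]; field_simp

lemma weyl_zero (ψ : 𝓢'(Conf d, ℂ)) : weyl N 0 ψ = ψ := by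
  rw [weyl, intPt_zero, smul_zero, heisDist_zero]

lemma heisDist_intPt (hN : 1 ≤ N) (n : Fin d ⊕ Fin d → ℤ) (ψ : 𝓢'(Conf d, ℂ)) :
    heisDist N (intPt n) ψ = weyl N (N • n) ψ := by
  have hN' : (N : ℝ) ≠ 0 := by positivity
  rw [weyl, intPt_natMul, smul_smul, inv_mul_cancel₀ hN', one_smul]

/-- The eigenvalue of `U_ħ(n)` on the states. -/
def stateMultiplier (N : ℕ) (κ : Phase d) (n : Fin d ⊕ Fin d → ℤ) : ℂ :=
  cis ((intPt n ∘ Sum.inl) ⬝ᵥ (intPt n ∘ Sum.inr) / (2 * hbar N)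
      - (κ ∘ Sum.inl) ⬝ᵥ (intPt n ∘ Sum.inl) + (κ ∘ Sum.inr) ⬝ᵥ (intPt n ∘ Sum.inr))

lemma mem_states_iff (hN : 1 ≤ N) {ψ : 𝓢'(Conf d, ℂ)} :
    ψ ∈ states N κ ↔ ∀ n, weyl N (N • n) ψ = stateMultiplier N κ n • ψ := by
  refine forall_congr' fun n => ?_
  rw [← heisDist_intPt hN]; rfl

lemma symp_natMul_left (hN : 1 ≤ N) (n r : Fin d ⊕ Fin d → ℤ) :
    Real.pi / N * symp (intPt (N • n)) (intPt r) = Real.pi * symp (intPt n) (intPt r) := by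
  have hN' : (N : ℝ) ≠ 0 := by positivity
  rw [intPt_natMul, symp_smul_left]; field_simp

/-- Exchanging U(r/N) with an integral translation U(n) costs the phase e^{2πi σ(n, r)}, which is 1.
-/
lemma weyl_mem_states (hN : 1 ≤ N) {ψ : 𝓢'(Conf d, ℂ)} (hψ : ψ ∈ states N κ)
    (r : Fin d ⊕ Fin d → ℤ) : weyl N r ψ ∈ states N κ := by
  rw [mem_states_iff hN]
  intro n
  have h1 := weyl_weyl hN r (N • n) ψ
  rw [(mem_states_iff hN).1 hψ n, map_smul] at h1
  rw [weyl_weyl hN, add_comm, symp_natMul_left hN]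
  rw [symp_swap, mul_neg, symp_natMul_left hN] at h1
  obtain ⟨k, hk⟩ := exists_int_symp n r
  rw [h1]
  congr 1
  rw [hk, ← cis_add_int _ (-k)]
  congr 1; push_cast; ring

/-- On a state, `U_ħ((r + N n) / N)` is a phase times `U_ħ(r / N)`. -/
lemma exists_weyl_add (hN : 1 ≤ N) {ψ : 𝓢'(Conf d, ℂ)} (hψ : ψ ∈ states N κ)
    (r n : Fin d ⊕ Fin d → ℤ) : ∃ t : ℝ, weyl N (r + N • n) ψ = cis t • weyl N r ψ := by
  have h1 := weyl_weyl hN r (N • n) ψ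
  rw [(mem_states_iff hN).1 hψ n, map_smul] at h1
  refine ⟨-(Real.pi / N * symp (intPt r) (intPt (N • n))) +
    ((intPt n ∘ Sum.inl) ⬝ᵥ (intPt n ∘ Sum.inr) / (2 * hbar N)
      - (κ ∘ Sum.inl) ⬝ᵥ (intPt n ∘ Sum.inl) + (κ ∘ Sum.inr) ⬝ᵥ (intPt n ∘ Sum.inr)), ?_⟩
  rw [cis_add, mul_smul]
  change _ = _ • stateMultiplier N κ n • _
  rw [h1, smul_smul, cis_neg_mul, one_smul]

/-! ### Coefficients -/

lemma coef_smul (c : ℂ) (ψ : 𝓢'(Conf d, ℂ)) (k : Fin d → ℤ) :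
    coef N κ (c • ψ) k = c * coef N κ ψ k := rfl

/-- The coefficients as a linear map. -/
def coefL (N : ℕ) (κ : Phase d) (k : Fin d → ℤ) : 𝓢'(Conf d, ℂ) →L[ℂ] ℂ :=
  PointwiseConvergenceCLM.evalCLM (RingHom.id ℂ) ℂ (bumpS N (node N κ k))

lemma coefL_apply (ψ : 𝓢'(Conf d, ℂ)) (k : Fin d → ℤ) : coefL N κ k ψ = coef N κ ψ k := rfl

/-- A state sees a test function only through its values at the nodes, so any function supported on
one node in this sense can replace the bump. -/
lemma apply_eq_of_node (hN : 1 ≤ N) {ψ : 𝓢'(Conf d, ℂ)} (hψ : ψ ∈ states N κ)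
    {φ : 𝓢(Conf d, ℂ)} (hc : HasCompactSupport φ) (k : Fin d → ℤ) (c : ℂ)
    (h : ∀ l, φ (node N κ l) = if k = l then c else 0) : ψ φ = c * coef N κ ψ k := by
  have hcs : HasCompactSupport (φ - c • bumpS N (node N κ k) : 𝓢(Conf d, ℂ)) := by
    refine HasCompactSupport.intro (K := tsupport φ ∪ tsupport (bumpS N (node N κ k)))
      (IsCompact.union hc (hasCompactSupport_bumpS N _)) ?_
    intro y hy
    simp only [Set.mem_union, not_or] at hy
    rw [sub_apply, smul_apply, image_eq_zero_of_notMem_tsupport hy.1,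
      image_eq_zero_of_notMem_tsupport hy.2, smul_zero, sub_zero]
  have h1 := states_apply_eq_zero hN hψ hcs fun l => by
    rw [sub_apply, smul_apply, h, bumpS_node hN, smul_eq_mul]
    split_ifs <;> simp
  rw [map_sub, map_smul, sub_eq_zero] at h1
  exact h1

/-- The phase by which `U_ħ(r / N)` multiplies the coefficient of index `k`. -/
def weylPhase (N : ℕ) (κ : Phase d) (r : Fin d ⊕ Fin d → ℤ) (k : Fin d → ℤ) : ℝ :=
  2 * Real.pi * ((intPt r ∘ Sum.inr) ⬝ᵥ node N κ k -
    (intPt r ∘ Sum.inr) ⬝ᵥ (intPt r ∘ Sum.inl) / (2 * N))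

/-- The transposed translation carries the bump at node k to a function with a single nonzero node
value, at k minus the position part of r, and that value is the phase. -/
lemma coef_weyl (hN : 1 ≤ N) {ψ : 𝓢'(Conf d, ℂ)} (hψ : ψ ∈ states N κ)
    (r : Fin d ⊕ Fin d → ℤ) (k : Fin d → ℤ) :
    coef N κ (weyl N r ψ) k = cis (weylPhase N κ r k) * coef N κ ψ (k - r ∘ Sum.inl) := by
  have hN' : (N : ℝ) ≠ 0 := by positivity
  set ρ : Phase d := (N : ℝ)⁻¹ • intPt r with hρ
  have hnode : ∀ l, node N κ l + ρ ∘ Sum.inl = node N κ (l + r ∘ Sum.inl) := by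
    intro l; ext j
    simp only [node, hρ, intPt, Pi.add_apply, Function.comp, Pi.smul_apply, smul_eq_mul]
    push_cast; field_simp; ring
  have hap : ∀ y, heis N (flip ρ) (bumpS N (node N κ k)) y =
      heisPhase N (flip ρ) y * bumpS N (node N κ k) (y + ρ ∘ Sum.inl) := by
    intro y; rw [heis_apply, flip_inl, sub_neg_eq_add]
  refine apply_eq_of_node hN hψ (φ := heis N (flip ρ) (bumpS N (node N κ k))) ?_ _ _ fun l => ?_
  · have : (heis N (flip ρ) (bumpS N (node N κ k)) : Conf d → ℂ) =
        fun y => heisPhase N (flip ρ) y * bumpS N (node N κ k) (y + ρ ∘ Sum.inl) := funext hap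
    rw [this]
    refine HasCompactSupport.mul_left ?_
    exact (hasCompactSupport_bumpS N _).comp_homeomorph (Homeomorph.addRight (ρ ∘ Sum.inl))
  · rw [hap, hnode, bumpS_node hN]
    have hiff : k = l + r ∘ Sum.inl ↔ k - r ∘ Sum.inl = l := by rw [sub_eq_iff_eq_add]
    by_cases h : k - r ∘ Sum.inl = l
    · rw [if_pos (hiff.2 h), if_pos h, mul_one, heisPhase_eq, flip_inl, flip_inr]
      congr 1
      have hk : node N κ l = node N κ k - ρ ∘ Sum.inl := by
        rw [hiff.2 h, ← hnode]; simp
      have h1 : ρ ∘ Sum.inr = (N : ℝ)⁻¹ • (intPt r ∘ Sum.inr) := rfl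
      have h2 : ρ ∘ Sum.inl = (N : ℝ)⁻¹ • (intPt r ∘ Sum.inl) := rfl
      rw [hk, weylPhase, h1, h2, hbar]
      simp only [smul_dotProduct, dotProduct_smul, dotProduct_sub, dotProduct_neg, smul_eq_mul]
      field_simp
      ring
    · rw [if_neg (fun h' => h (hiff.1 h')), if_neg h, mul_zero]

/-- Compares the two descriptions of the integral translation by (-q, 0): a scalar on states, and a
shift of the coefficients by Nq. The phase is the same for all states, so products conj(c_k) c'_k
are N-periodic. -/
lemma exists_coef_add (hN : 1 ≤ N) (k q : Fin d → ℤ) :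
    ∃ t : ℝ, ∀ ψ ∈ states N κ, coef N κ ψ (k + N • q) = cis t * coef N κ ψ k := by
  refine ⟨(κ ∘ Sum.inl) ⬝ᵥ (fun j => (q j : ℝ)), fun ψ hψ => ?_⟩
  have h1 := (mem_states_iff hN).1 hψ (Sum.elim (-q) 0)
  have h2 := coef_weyl hN hψ (N • Sum.elim (-q) 0) k
  have e1 : (N • (Sum.elim (-q) 0 : Fin d ⊕ Fin d → ℤ)) ∘ Sum.inl = -(N • q) := by
    ext j; simp
  have e2 : (intPt (N • (Sum.elim (-q) 0 : Fin d ⊕ Fin d → ℤ)) ∘ Sum.inr : Conf d) = 0 := by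
    ext j; simp [intPt]
  have e3 : (intPt (Sum.elim (-q) 0 : Fin d ⊕ Fin d → ℤ) ∘ Sum.inr : Conf d) = 0 := by
    ext j; simp [intPt]
  have e4 : (intPt (Sum.elim (-q) 0 : Fin d ⊕ Fin d → ℤ) ∘ Sum.inl : Conf d) =
      -fun j => (q j : ℝ) := by
    ext j; simp [intPt]
  rw [h1, coef_smul, weylPhase, e1, e2, stateMultiplier, e3, e4] at h2
  simp only [zero_dotProduct, dotProduct_zero, zero_div, sub_zero, mul_zero, cis_zero, one_mul,
    add_zero, zero_add, dotProduct_neg, sub_neg_eq_add] at h2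
  exact h2.symm

end CatMap

end

/-! ### The scalar product of states: unitarity and irreducibility of the translations -/

noncomputable section
namespace CatMap

variable {d : ℕ} {N : ℕ} {κ : Phase d}

/-- An index in `{0, …, N-1}^n` as a point of `ℤ^n`. -/
def toInt {n : Type*} (k : n → Fin N) : n → ℤ := fun j => ((k j : ℕ) : ℤ)

lemma stateInner_eq (N : ℕ) (κ : Phase d) (ψ ψ' : 𝓢'(Conf d, ℂ)) :
    stateInner N κ ψ ψ' = (N : ℂ) ^ d * ∑ k : Fin d → Fin N,
      (starRingEnd ℂ) (coef N κ ψ (toInt k)) * coef N κ ψ' (toInt k) := rfl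

/-- The scalar product as a continuous linear map of its second argument. -/
def stateInnerL (N : ℕ) (κ : Phase d) (ψ : 𝓢'(Conf d, ℂ)) : 𝓢'(Conf d, ℂ) →L[ℂ] ℂ :=
  ((N : ℂ) ^ d) • ∑ k : Fin d → Fin N,
    (starRingEnd ℂ) (coef N κ ψ (toInt k)) • coefL N κ (toInt k)

lemma stateInnerL_apply (ψ ψ' : 𝓢'(Conf d, ℂ)) :
    stateInnerL N κ ψ ψ' = stateInner N κ ψ ψ' := by
  rw [stateInnerL, stateInner_eq]
  simp [coefL_apply]

lemma stateInner_smul_right (c : ℂ) (ψ ψ' : 𝓢'(Conf d, ℂ)) :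
    stateInner N κ ψ (c • ψ') = c * stateInner N κ ψ ψ' := by
  rw [← stateInnerL_apply, map_smul, stateInnerL_apply, smul_eq_mul]

lemma stateInner_conj (ψ ψ' : 𝓢'(Conf d, ℂ)) :
    (starRingEnd ℂ) (stateInner N κ ψ ψ') = stateInner N κ ψ' ψ := by
  rw [stateInner_eq, stateInner_eq, map_mul, map_pow, map_sum, Complex.conj_natCast]
  congr 1
  refine Finset.sum_congr rfl fun k _ => ?_
  rw [map_mul, Complex.conj_conj, mul_comm]

lemma stateInner_smul_left (c : ℂ) (ψ ψ' : 𝓢'(Conf d, ℂ)) :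
    stateInner N κ (c • ψ) ψ' = (starRingEnd ℂ) c * stateInner N κ ψ ψ' := by
  rw [← stateInner_conj, stateInner_smul_right, map_mul, stateInner_conj]

lemma stateInner_sum_right {ι : Type*} (s : Finset ι) (ψ : 𝓢'(Conf d, ℂ)) (f : ι → 𝓢'(Conf d, ℂ)) :
    stateInner N κ ψ (∑ i ∈ s, f i) = ∑ i ∈ s, stateInner N κ ψ (f i) := by
  simp only [← stateInnerL_apply, map_sum]

lemma stateInner_sum_left {ι : Type*} (s : Finset ι) (ψ : 𝓢'(Conf d, ℂ)) (f : ι → 𝓢'(Conf d, ℂ)) :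
    stateInner N κ (∑ i ∈ s, f i) ψ = ∑ i ∈ s, stateInner N κ (f i) ψ := by
  rw [← stateInner_conj, stateInner_sum_right, map_sum]
  simp only [stateInner_conj]

lemma exists_toInt {n : Type*} (hN : 1 ≤ N) (l : n → ℤ) :
    ∃ (k : n → Fin N) (q : n → ℤ), l = toInt k + N • q := by
  have hN' : (0 : ℤ) < N := by exact_mod_cast hN
  refine ⟨fun j => ⟨(l j % N).toNat, by
    have h1 := Int.emod_nonneg (l j) hN'.ne'
    have h2 := Int.emod_lt_of_pos (l j) hN'
    omega⟩, fun j => l j / N, ?_⟩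
  ext j
  have h1 := Int.emod_nonneg (l j) hN'.ne'
  simp only [toInt, Pi.add_apply, nsmul_eq_mul]
  rw [Int.toNat_of_nonneg h1]
  exact (Int.emod_add_mul_ediv (l j) N).symm

lemma toInt_inj {k k' : Fin d → Fin N} {q : Fin d → ℤ} (h : toInt k = toInt k' + N • q) :
    k = k' := by
  ext j
  have h1 := congrFun h j
  simp only [toInt, Pi.add_apply, nsmul_eq_mul] at h1
  have h2 := (k j).isLt
  have h3 := (k' j).isLt
  have h4 : (((k j : ℕ) : ℤ)) % N = ((k' j : ℕ) : ℤ) % N := by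
    rw [h1]; exact Int.add_mul_emod_self_left _ _ _
  rw [Int.emod_eq_of_lt (by omega) (by omega), Int.emod_eq_of_lt (by omega) (by omega)] at h4
  exact_mod_cast h4

lemma sum_toInt_sub {M : Type*} [AddCommMonoid M] (hN : 1 ≤ N) (F : (Fin d → ℤ) → M)
    (hF : ∀ k q, F (k + N • q) = F k) (s : Fin d → ℤ) :
    ∑ k : Fin d → Fin N, F (toInt k - s) = ∑ k : Fin d → Fin N, F (toInt k) := by
  have h : ∀ k : Fin d → Fin N, ∃ (k' : Fin d → Fin N) (q : Fin d → ℤ),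
      toInt k - s = toInt k' + N • q := fun k => exists_toInt hN _
  choose g q hg using h
  have hinj : Function.Injective g := by
    intro k k' hk
    have h1 := hg k
    have h2 := hg k'
    rw [hk] at h1
    refine toInt_inj (q := q k - q k') ?_
    rw [smul_sub]
    have : toInt k = toInt k - s - (toInt k' - s) + toInt k' := by abel
    rw [this, h1, h2]; abel
  refine Fintype.sum_bijective g (Finite.injective_iff_bijective.1 hinj) _ _ fun k => ?_
  rw [hg k, hF]

/-- The translations are unitary on the states. -/
lemma stateInner_weyl (hN : 1 ≤ N) {ψ ψ' : 𝓢'(Conf d, ℂ)} (hψ : ψ ∈ states N κ)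
    (hψ' : ψ' ∈ states N κ) (r : Fin d ⊕ Fin d → ℤ) :
    stateInner N κ (weyl N r ψ) (weyl N r ψ') = stateInner N κ ψ ψ' := by
  rw [stateInner_eq, stateInner_eq]
  congr 1
  rw [← sum_toInt_sub hN (fun k => (starRingEnd ℂ) (coef N κ ψ k) * coef N κ ψ' k) ?_
    (r ∘ Sum.inl)]
  · refine Finset.sum_congr rfl fun k _ => ?_
    rw [coef_weyl hN hψ, coef_weyl hN hψ', map_mul, conj_cis, mul_mul_mul_comm, cis_neg_mul,
      one_mul]
  · intro k q
    obtain ⟨t, ht⟩ := exists_coef_add (κ := κ) hN k q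
    rw [ht ψ hψ, ht ψ' hψ', map_mul, conj_cis, mul_mul_mul_comm, cis_neg_mul, one_mul]

lemma states_ext (hN : 1 ≤ N) {ψ ψ' : 𝓢'(Conf d, ℂ)} (hψ : ψ ∈ states N κ)
    (hψ' : ψ' ∈ states N κ) (h : ∀ k : Fin d → Fin N, coef N κ ψ (toInt k) = coef N κ ψ' (toInt k)) :
    ψ = ψ' := by
  rw [← sub_eq_zero]
  refine states_eq_zero_of_coef hN (Submodule.sub_mem _ hψ hψ') fun l => ?_
  obtain ⟨k, q, rfl⟩ := exists_toInt hN l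
  obtain ⟨t, ht⟩ := exists_coef_add (κ := κ) hN (toInt k) q
  rw [ht _ (Submodule.sub_mem _ hψ hψ'), ← coefL_apply, map_sub, coefL_apply, coefL_apply, h,
    sub_self, mul_zero]

lemma sum_cis_eq_zero (hN : 1 ≤ N) {n : ℤ} (hn : ¬ (N : ℤ) ∣ n) :
    ∑ p : Fin N, cis ((p : ℕ) * (2 * Real.pi * n / N)) = 0 := by
  have hN' : (N : ℝ) ≠ 0 := by positivity
  simp only [cis_nat_mul]
  rw [Fin.sum_univ_eq_sum_range (fun p => cis (2 * Real.pi * n / N) ^ p)]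
  have h1 : cis (2 * Real.pi * n / N) ≠ 1 := by
    intro h
    obtain ⟨m, hm⟩ := cis_eq_one h
    refine hn ⟨m, ?_⟩
    rw [div_eq_iff hN'] at hm
    have : (n : ℝ) = N * m := by
      have h2 : 2 * Real.pi * n = 2 * Real.pi * (N * m) := by rw [hm]; ring
      exact mul_left_cancel₀ Real.two_pi_pos.ne' h2
    exact_mod_cast this
  rw [geom_sum_eq h1, ← cis_nat_mul, mul_div_cancel₀ _ hN', cis_int, sub_self, zero_div]

lemma sum_cis_dotProduct (hN : 1 ≤ N) {k l : Fin d → Fin N} (h : k ≠ l) :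
    ∑ p : Fin d → Fin N, cis (2 * Real.pi * ((fun j => (toInt p j : ℝ)) ⬝ᵥ
      fun j => ((toInt l j - toInt k j : ℤ) : ℝ) / N)) = 0 := by
  classical
  obtain ⟨j, hj⟩ := Function.ne_iff.1 h
  have h1 : ∀ p : Fin d → Fin N, cis (2 * Real.pi * ((fun j => (toInt p j : ℝ)) ⬝ᵥ
      fun j => ((toInt l j - toInt k j : ℤ) : ℝ) / N)) =
      ∏ i, cis ((p i : ℕ) * (2 * Real.pi * (toInt l i - toInt k i : ℤ) / N)) := by
    intro p
    rw [dotProduct, Finset.mul_sum, cis_sum]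
    refine Finset.prod_congr rfl fun i _ => ?_
    congr 1
    simp only [toInt]; push_cast; ring
  simp only [h1]
  rw [← Fintype.prod_sum (f := fun i (p : Fin N) =>
    cis ((p : ℕ) * (2 * Real.pi * (toInt l i - toInt k i : ℤ) / N)))]
  refine Finset.prod_eq_zero (Finset.mem_univ j) (sum_cis_eq_zero hN ?_)
  intro hd
  apply hj
  have h2 := (k j).isLt
  have h3 := (l j).isLt
  have h4 : (((l j : ℕ) : ℤ) - ((k j : ℕ) : ℤ)) = 0 :=
    Int.eq_zero_of_abs_lt_dvd hd (by rw [abs_lt]; omega)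
  ext
  omega

/-- The existence of a state whose coefficients are a Dirac mass at a given index. -/
lemma exists_basis_state (hN : 1 ≤ N) {ψ : 𝓢'(Conf d, ℂ)} (hψ : ψ ∈ states N κ)
    (h0 : stateInner N κ ψ ψ ≠ 0) :
    ∃ k₀ : Fin d → Fin N, ∃ e ∈ states N κ, ∀ l : Fin d → Fin N,
      coef N κ e (toInt l) = if l = k₀ then 1 else 0 := by
  obtain ⟨k₀, hk₀⟩ : ∃ k : Fin d → Fin N, coef N κ ψ (toInt k) ≠ 0 := by
    by_contra! h
    apply h0
    rw [stateInner_eq]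
    simp [h]
  have hN' : (N : ℝ) ≠ 0 := by positivity
  -- Discrete Fourier inversion: momentum translations multiply coefficients by characters of the
  -- index. Averaging them, with phases normalised at k₀, kills every index in the box except k₀.
  let pr : (Fin d → Fin N) → Fin d ⊕ Fin d → ℤ := fun p => Sum.elim 0 (toInt p)
  have hpl : ∀ p, pr p ∘ Sum.inl = 0 := fun p => rfl
  have hpl' : ∀ p, (intPt (pr p) ∘ Sum.inl : Conf d) = 0 := fun p => by
    ext j; simp [intPt, pr]
  have hpr : ∀ p, (intPt (pr p) ∘ Sum.inr : Conf d) = fun j => (toInt p j : ℝ) := fun p => rfl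
  have hco : ∀ p l, cis (-weylPhase N κ (pr p) (toInt k₀)) * coef N κ (weyl N (pr p) ψ) l =
      cis (2 * Real.pi * ((fun j => (toInt p j : ℝ)) ⬝ᵥ
      fun j => ((l j - toInt k₀ j : ℤ) : ℝ) / N)) * coef N κ ψ l := by
    intro p l
    rw [coef_weyl hN hψ, ← mul_assoc, ← cis_add, hpl, sub_zero]
    congr 2
    simp only [weylPhase, hpl', hpr, dotProduct_zero, zero_div, sub_zero]
    have : (fun j => ((l j - toInt k₀ j : ℤ) : ℝ) / N) = node N κ l - node N κ (toInt k₀) := by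
      ext j; simp only [node, Pi.sub_apply]; push_cast; ring
    rw [this, dotProduct_sub]; ring
  refine ⟨k₀, ((N : ℂ) ^ d * coef N κ ψ (toInt k₀))⁻¹ • ∑ p : Fin d → Fin N,
    cis (-weylPhase N κ (pr p) (toInt k₀)) • weyl N (pr p) ψ, ?_, ?_⟩
  · exact Submodule.smul_mem _ _ (Submodule.sum_mem _ fun p _ =>
      Submodule.smul_mem _ _ (weyl_mem_states hN hψ _))
  · intro l
    rw [coef_smul, ← coefL_apply (∑ p, _), map_sum]
    simp only [map_smul, coefL_apply, smul_eq_mul, hco]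
    rw [← Finset.sum_mul]
    split_ifs with h
    · subst h
      simp only [sub_self, Int.cast_zero, zero_div]
      have : (fun _ : Fin d => (0 : ℝ)) = 0 := rfl
      simp only [this, dotProduct_zero, mul_zero, cis_zero, Finset.sum_const, Finset.card_univ,
        Fintype.card_fun, Fintype.card_fin, nsmul_eq_mul, mul_one]
      have hNc : (N : ℂ) ≠ 0 := by exact_mod_cast hN'
      push_cast
      field_simp
    · rw [sum_cis_dotProduct hN (Ne.symm h)]; simp

/-- The translations act irreducibly on the states. -/
lemma exists_stateInner_map (hN : 1 ≤ N) {ψ : 𝓢'(Conf d, ℂ)} (hψ : ψ ∈ states N κ)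
    (h0 : stateInner N κ ψ ψ ≠ 0) (T : 𝓢'(Conf d, ℂ) →L[ℂ] 𝓢'(Conf d, ℂ))
    (hT : ∀ φ ∈ states N κ, T φ ∈ states N κ) (a : (Fin d ⊕ Fin d → ℤ) → Fin d ⊕ Fin d → ℤ)
    (hTa : ∀ r φ, T (weyl N r φ) = weyl N (a r) (T φ)) :
    ∃ c : ℂ, ∀ φ ∈ states N κ, ∀ φ' ∈ states N κ,
      stateInner N κ (T φ) (T φ') = c * stateInner N κ φ φ' := by
  classical
  have hN' : (N : ℝ) ≠ 0 := by positivity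
  obtain ⟨k₀, e₀, he₀, hc₀⟩ := exists_basis_state hN hψ h0
  -- The pulled-back form is invariant under all lattice translations, since T carries them to other
  -- lattice translations, which are unitary. As in Schur's lemma, such a form is a multiple of the
  -- scalar product.
  let S : 𝓢'(Conf d, ℂ) → 𝓢'(Conf d, ℂ) → ℂ := fun φ φ' => stateInner N κ (T φ) (T φ')
  have hS : ∀ r, ∀ φ ∈ states N κ, ∀ φ' ∈ states N κ, S (weyl N r φ) (weyl N r φ') = S φ φ' := by
    intro r φ hφ φ' hφ'
    simp only [S, hTa]
    exact stateInner_weyl hN (hT _ hφ) (hT _ hφ') _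
  let e : (Fin d → Fin N) → 𝓢'(Conf d, ℂ) := fun k =>
    weyl N (Sum.elim (toInt k - toInt k₀) 0) e₀
  have he : ∀ k, e k ∈ states N κ := fun k => weyl_mem_states hN he₀ _
  have hco : ∀ k l, coef N κ (e k) (toInt l) = if l = k then 1 else 0 := by
    intro k l
    have h2 : (intPt (Sum.elim (toInt k - toInt k₀) 0 : Fin d ⊕ Fin d → ℤ) ∘ Sum.inr : Conf d)
      = 0 := by ext j; simp [intPt]
    simp only [e]
    rw [coef_weyl hN he₀, weylPhase, h2]
    simp only [zero_dotProduct, zero_div, sub_zero, mul_zero, cis_zero, one_mul]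
    have h3 : toInt l - (Sum.elim (toInt k - toInt k₀) 0 : Fin d ⊕ Fin d → ℤ) ∘ Sum.inl =
      toInt l - toInt k + toInt k₀ := by
      ext j; simp; ring
    rw [h3]
    obtain ⟨k', q, hk'⟩ := exists_toInt hN (toInt l - toInt k + toInt k₀)
    split_ifs with h
    · subst h
      rw [sub_self, zero_add, hc₀, if_pos rfl]
    · obtain ⟨t, ht⟩ := exists_coef_add (κ := κ) hN (toInt k') q
      rw [hk', ht _ he₀, hc₀, if_neg, mul_zero]
      rintro rfl
      refine h (toInt_inj (q := q) ?_)
      have : toInt l = toInt l - toInt k + toInt k' - toInt k' + toInt k := by abel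
      rw [this, hk']; abel
  -- Position translations permute the basis vectors and make the diagonal entries equal; momentum
  -- translations separate them and make the off-diagonal entries vanish.
  have hdiag : ∀ k, S (e k) (e k) = S e₀ e₀ := fun k => hS _ _ he₀ _ he₀
  have hoff : ∀ k l, k ≠ l → S (e k) (e l) = 0 := by
    intro k l hkl
    obtain ⟨j, hj⟩ := Function.ne_iff.1 hkl
    set r : Fin d ⊕ Fin d → ℤ := Sum.elim 0 (Pi.single j 1) with hr
    have hrr : (intPt r ∘ Sum.inr : Conf d) = Pi.single j 1 := by
      ext i; by_cases h : i = j
      · subst h; simp [intPt, hr]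
      · simp [intPt, hr, h]
    have hrl : (intPt r ∘ Sum.inl : Conf d) = 0 := by
      ext i; simp [intPt, hr]
    have hrl' : r ∘ Sum.inl = 0 := rfl
    have hph : ∀ m, weylPhase N κ r m = 2 * Real.pi * node N κ m j := by
      intro m
      simp only [weylPhase, hrr, hrl, single_dotProduct, dotProduct_zero, zero_div, sub_zero, one_mul]
    have heig : ∀ m, weyl N r (e m) = cis (weylPhase N κ r (toInt m)) • e m := by
      intro m
      refine states_ext hN (weyl_mem_states hN (he m) _) (Submodule.smul_mem _ _ (he m)) fun i => ?_
      rw [coef_weyl hN (he m), coef_smul, hrl', sub_zero, hco]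
      split_ifs with h
      · rw [h]
      · simp
    have h1 := hS r (e k) (he k) (e l) (he l)
    rw [heig, heig] at h1
    simp only [S, map_smul] at h1 ⊢
    rw [stateInner_smul_left, stateInner_smul_right, conj_cis, ← mul_assoc, ← cis_add] at h1
    by_contra hne
    -- A nonzero entry would force equal eigenvalues of translation by (0, e_j), so the j-th indices
    -- would agree modulo N and hence agree.
    have h2 := mul_right_cancel₀ hne (h1.trans (one_mul _).symm)
    obtain ⟨n, hn⟩ := cis_eq_one h2
    rw [hph, hph] at hn
    have h3 : ((toInt l j : ℝ) - toInt k j) = n * N := by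
      have h4 : node N κ (toInt l) j - node N κ (toInt k) j = ((toInt l j : ℝ) - toInt k j) / N := by
        simp only [node]; ring
      have h5 : (2 * Real.pi) * (node N κ (toInt l) j - node N κ (toInt k) j) = (2 * Real.pi) * n := by
        linarith
      have h6 := mul_left_cancel₀ Real.two_pi_pos.ne' h5
      rw [h4, div_eq_iff hN'] at h6
      exact h6
    have h7 : toInt l j - toInt k j = n * N := by exact_mod_cast h3
    apply hj
    have h8 := (k j).isLt
    have h9 := (l j).isLt
    have h10 : (((l j : ℕ) : ℤ) - ((k j : ℕ) : ℤ)) = 0 :=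
      Int.eq_zero_of_abs_lt_dvd (m := N) ⟨n, by rw [mul_comm]; exact h7⟩ (by rw [abs_lt]; omega)
    ext
    omega
  have hexp : ∀ φ ∈ states N κ, φ = ∑ k : Fin d → Fin N, coef N κ φ (toInt k) • e k := by
    intro φ hφ
    refine states_ext hN hφ
      (Submodule.sum_mem _ fun k _ => Submodule.smul_mem _ _ (he k)) fun l => ?_
    rw [← coefL_apply (∑ k, _), map_sum]
    simp only [map_smul, coefL_apply, hco, smul_eq_mul, mul_ite, mul_one, mul_zero]
    simp
  -- Each basis vector has squared norm N^d, hence the normalisation.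
  refine ⟨S e₀ e₀ / (N : ℂ) ^ d, fun φ hφ φ' hφ' => ?_⟩
  have hNc : (N : ℂ) ≠ 0 := by exact_mod_cast hN'
  conv_lhs => rw [hexp φ hφ, hexp φ' hφ']
  simp only [map_sum, map_smul, stateInner_sum_left, stateInner_sum_right, stateInner_smul_left,
    stateInner_smul_right]
  rw [stateInner_eq, ← mul_assoc, div_mul_cancel₀ _ (pow_ne_zero _ hNc), Finset.mul_sum]
  refine Finset.sum_congr rfl fun k _ => ?_
  rw [Finset.sum_eq_single k]
  · have := hdiag k
    simp only [S] at this ⊢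
    rw [this]; ring
  · intro l _ hlk
    have := hoff l k hlk
    simp only [S] at this
    rw [this]; ring
  · simp

/-! ### Invariance of the expectations of an eigenstate -/

variable {A : SpZ d}

lemma conjS_heis (N : ℕ) (ρ : Phase d) (φ : 𝓢(Conf d, ℂ)) :
    conjS (heis N (flip ρ) φ) = heis N (-ρ) (conjS φ) := by
  ext y
  have h1 : (-ρ) ∘ Sum.inl = -(ρ ∘ Sum.inl) := rfl
  have h2 : (-ρ) ∘ Sum.inr = -(ρ ∘ Sum.inr) := rfl
  rw [conjS_apply, heis_apply, heis_apply, conjS_apply, map_mul, heisPhase_eq, heisPhase_eq,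
    conj_cis, h1, h2, flip_inl, flip_inr]
  congr 2
  simp only [neg_dotProduct, dotProduct_neg]; ring

lemma conjS_conjS (φ : 𝓢(Conf d, ℂ)) : conjS (conjS φ) = φ := by
  ext y; simp [conjS_apply]

lemma act_neg (A : SpZ d) (ρ : Phase d) : act A (-ρ) = -act A ρ := Matrix.mulVec_neg _ _

lemma Propagator.onDist_heisDist (M : Propagator N A) (ρ : Phase d) (ψ : 𝓢'(Conf d, ℂ)) :
    M.onDist (heisDist N ρ ψ) = heisDist N (act A ρ) (M.onDist ψ) := by
  have hdef : ∀ (ψ : 𝓢'(Conf d, ℂ)) φ, M.onDist ψ φ = ψ (conjS (M.op.symm (conjS φ))) :=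
    fun _ _ => rfl
  ext φ
  rw [hdef, heisDist_apply, heisDist_apply, hdef]
  congr 1
  have h1 : heis N (flip ρ) (conjS (M.op.symm (conjS φ))) =
      conjS (heis N (-ρ) (M.op.symm (conjS φ))) := by
    have := conjS_heis N ρ (conjS (M.op.symm (conjS φ)))
    rw [conjS_conjS] at this
    rw [← this, conjS_conjS]
  rw [h1, conjS_heis]
  congr 1
  rw [ContinuousLinearEquiv.eq_symm_apply, M.intertwines, ContinuousLinearEquiv.apply_symm_apply,
    act_neg]

/-- The action of `A` on `ℤ^{2d}`. -/
def actZ (A : SpZ d) (r : Fin d ⊕ Fin d → ℤ) : Fin d ⊕ Fin d → ℤ := (A : PMat d ℤ) *ᵥ r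

lemma intPt_actZ (A : SpZ d) (r : Fin d ⊕ Fin d → ℤ) : (intPt (actZ A r) : Phase d) = act A (intPt r) := by
  ext i
  simp [intPt, actZ, act, realMat, Matrix.mulVec, dotProduct]

lemma actZ_mul (A B : SpZ d) (r : Fin d ⊕ Fin d → ℤ) : actZ (A * B) r = actZ A (actZ B r) := by
  simp [actZ]

lemma actZ_one (r : Fin d ⊕ Fin d → ℤ) : actZ 1 r = r := by simp [actZ]

lemma act_smul (A : SpZ d) (t : ℝ) (ρ : Phase d) : act A (t • ρ) = t • act A ρ :=
  Matrix.mulVec_smul _ _ _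

lemma Propagator.onDist_weyl (M : Propagator N A) (r : Fin d ⊕ Fin d → ℤ) (ψ : 𝓢'(Conf d, ℂ)) :
    M.onDist (weyl N r ψ) = weyl N (actZ A r) (M.onDist ψ) := by
  rw [weyl, weyl, M.onDist_heisDist, act_smul, intPt_actZ]

/-- The expectation of `U_ħ(r / N)`. -/
def expect (N : ℕ) (κ : Phase d) (ψ : 𝓢'(Conf d, ℂ)) (r : Fin d ⊕ Fin d → ℤ) : ℂ :=
  stateInner N κ ψ (weyl N r ψ)

/-- Conjugating U(r/N) by the propagator gives U(Ar/N), and the propagator preserves the scalar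
product up to a constant c by irreducibility. The eigenvalue contributes |z|², which equals c. -/
lemma IsUnitEigenstate.expect_actZ (hN : 1 ≤ N) {ψ : 𝓢'(Conf d, ℂ)} (h : IsUnitEigenstate N A κ ψ)
    (r : Fin d ⊕ Fin d → ℤ) : expect N κ ψ (actZ A r) = expect N κ ψ r := by
  obtain ⟨M, hM, z, hz⟩ := h.eigen
  have hMmem : ∀ φ ∈ states N κ, M.onDist φ ∈ states N κ := fun φ hφ => by
    rw [← hM]; exact ⟨φ, hφ, rfl⟩
  obtain ⟨c, hc⟩ := exists_stateInner_map hN h.mem (by rw [h.unit]; exact one_ne_zero) M.onDist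
    hMmem (actZ A) M.onDist_weyl
  have h1 : ∀ r, (starRingEnd ℂ) z * z * expect N κ ψ (actZ A r) = c * expect N κ ψ r := by
    intro r
    have h2 := hc ψ h.mem _ (weyl_mem_states hN h.mem r)
    rw [M.onDist_weyl, hz, map_smul, stateInner_smul_left, stateInner_smul_right, ← mul_assoc] at h2
    exact h2
  have hz0 : z ≠ 0 := by
    rintro rfl
    replace hz := hz.trans (zero_smul ℂ ψ)
    -- The propagator is injective on distributions, being the transpose of a bijection; a zero
    -- eigenvalue would kill ψ.
    have hψ : ψ = 0 := by
      ext φ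
      have := M.onDist_apply ψ (conjS φ)
      rw [hz, conjS_conjS] at this
      exact this.symm
    have hu := h.unit
    rw [hψ, ← stateInnerL_apply, map_zero] at hu
    exact zero_ne_one hu
  -- At r = 0 both expectations equal 1, which determines c.
  have hc1 : (starRingEnd ℂ) z * z = c := by
    have h2 := h1 0
    have h3 : actZ A 0 = 0 := by simp [actZ]
    have h4 : expect N κ ψ 0 = 1 := by rw [expect, weyl_zero, h.unit]
    rwa [h3, h4, mul_one, mul_one] at h2
  have hc0 : c ≠ 0 := by
    rw [← hc1]; exact mul_ne_zero ((map_ne_zero _).2 hz0) hz0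
  have h2 := h1 r
  rw [hc1] at h2
  exact mul_left_cancel₀ hc0 h2

lemma IsUnitEigenstate.expect_actZ_zpow (hN : 1 ≤ N) {ψ : 𝓢'(Conf d, ℂ)}
    (h : IsUnitEigenstate N A κ ψ) (j : ℤ) (r : Fin d ⊕ Fin d → ℤ) :
    expect N κ ψ (actZ (A ^ j) r) = expect N κ ψ r := by
  induction j generalizing r with
  | zero => rw [zpow_zero, actZ_one]
  | succ n ih => rw [zpow_add_one, actZ_mul, ih, h.expect_actZ hN]
  | pred n ih =>
    rw [zpow_sub_one, actZ_mul, ih, ← h.expect_actZ hN, ← actZ_mul, mul_inv_cancel, actZ_one]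

end CatMap

end

noncomputable section
namespace CatMap

variable {d : ℕ} {N : ℕ} {κ : Phase d} {A : SpZ d}

/-! ### Trigonometric series on the torus -/

/-- The character `ρ ↦ exp (-2iπ ⟨J r, ρ⟩)`. -/
def chr (r : Fin d ⊕ Fin d → ℤ) (ρ : Phase d) : ℂ := cis (-(2 * Real.pi * symp ρ (intPt r)))

@[simp] lemma norm_chr (r : Fin d ⊕ Fin d → ℤ) (ρ : Phase d) : ‖chr r ρ‖ = 1 := norm_cis _

lemma chr_add (r s : Fin d ⊕ Fin d → ℤ) (ρ : Phase d) : chr (r + s) ρ = chr r ρ * chr s ρ := by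
  rw [chr, chr, chr, ← cis_add, intPt_add, symp_add_right]; ring_nf

lemma chr_zero (ρ : Phase d) : chr 0 ρ = 1 := by
  rw [chr, intPt_zero, ← zero_smul ℝ (0 : Phase d), symp_smul_right]; simp

lemma conj_chr (r : Fin d ⊕ Fin d → ℤ) (ρ : Phase d) : (starRingEnd ℂ) (chr r ρ) = chr (-r) ρ := by
  rw [chr, chr, conj_cis, intPt_neg, symp_neg_right]; ring_nf

lemma continuous_symp_left (r : Phase d) : Continuous fun ρ : Phase d => symp ρ r := by
  simp only [symp]
  exact Continuous.dotProduct continuous_id continuous_const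

lemma continuous_cis : Continuous cis := by unfold cis; fun_prop

lemma continuous_chr (r : Fin d ⊕ Fin d → ℤ) : Continuous (chr r : Phase d → ℂ) :=
  continuous_cis.comp ((continuous_const.mul (continuous_symp_left _)).neg)

lemma act_mul (A B : SpZ d) (ρ : Phase d) : act (A * B) ρ = act A (act B ρ) := by
  have : realMat (A * B) = realMat A * realMat B := by
    simp only [realMat, Submonoid.coe_mul]
    exact Matrix.map_mul (f := Int.castRingHom ℝ)
  rw [act, act, act, this, Matrix.mulVec_mulVec]

lemma act_one (ρ : Phase d) : act 1 ρ = ρ := by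
  have : realMat (1 : SpZ d) = 1 := by
    simp only [realMat, OneMemClass.coe_one]
    exact Matrix.map_one _ Int.cast_zero Int.cast_one
  rw [act, this, Matrix.one_mulVec]

lemma symp_mulVec {M : PMat d ℝ} (hM : M ∈ Matrix.symplecticGroup (Fin d) ℝ) (ρ ρ' : Phase d) :
    symp (M *ᵥ ρ) (M *ᵥ ρ') = symp ρ ρ' := by
  rw [symp, symp, Matrix.mulVec_mulVec, Matrix.dotProduct_mulVec, ← Matrix.vecMul_transpose,
    Matrix.vecMul_vecMul, ← Matrix.dotProduct_mulVec, ← Matrix.mul_assoc,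
    SymplecticGroup.mem_iff'.1 hM]

lemma realMat_mem (A : SpZ d) : realMat A ∈ Matrix.symplecticGroup (Fin d) ℝ := by
  rw [SymplecticGroup.mem_iff']
  have h := SymplecticGroup.mem_iff'.1 A.2
  have h2 := congrArg (fun M : PMat d ℤ => M.map (Int.castRingHom ℝ)) h
  simp only [Matrix.map_mul] at h2
  have hJ : (Matrix.J (Fin d) ℤ).map (Int.castRingHom ℝ) = Matrix.J (Fin d) ℝ := by
    ext i j
    rcases i with i | i <;> rcases j with j | j <;>
      simp [Matrix.J, Matrix.one_apply, apply_ite]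
  rw [hJ] at h2
  exact h2

lemma symp_act (A : SpZ d) (ρ ρ' : Phase d) : symp (act A ρ) (act A ρ') = symp ρ ρ' :=
  symp_mulVec (realMat_mem A) ρ ρ'

/-- Invariance of σ moves A from the point to the frequency, as its inverse. Writing the characters
through σ avoids a transpose. -/
lemma chr_act (A : SpZ d) (r : Fin d ⊕ Fin d → ℤ) (ρ : Phase d) :
    chr r (act A ρ) = chr (actZ A⁻¹ r) ρ := by
  rw [chr, chr, intPt_actZ, ← symp_act A ρ, ← act_mul, mul_inv_cancel, act_one]

/-- The function `a` is the sum of the absolutely convergent trigonometric series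
`∑_i b_i exp (-2iπ ⟨J r_i, ρ⟩)`. -/
structure HasTrigSeries {ι : Type*} (b : ι → ℂ) (r : ι → Fin d ⊕ Fin d → ℤ) (a : Phase d → ℂ) :
    Prop where
  summable : Summable fun i => ‖b i‖
  hasSum : ∀ ρ, HasSum (fun i => b i * chr (r i) ρ) (a ρ)

/-- The functions with absolutely convergent Fourier series. -/
def Wiener (a : Phase d → ℂ) : Prop :=
  ∃ (ι : Type) (_ : Countable ι) (b : ι → ℂ) (r : ι → Fin d ⊕ Fin d → ℤ), HasTrigSeries b r a

namespace HasTrigSeries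

variable {ι ι' : Type*} {b : ι → ℂ} {r : ι → Fin d ⊕ Fin d → ℤ} {a : Phase d → ℂ}
  {b' : ι' → ℂ} {r' : ι' → Fin d ⊕ Fin d → ℤ} {a' : Phase d → ℂ}

/-- The product is indexed by pairs without collecting equal frequencies; this is what the arbitrary
index type is for. Collection is deferred to `HasTrigSeries.fcoef_eq`. -/
lemma mul (h : HasTrigSeries b r a) (h' : HasTrigSeries b' r' a') :
    HasTrigSeries (fun i : ι × ι' => b i.1 * b' i.2) (fun i => r i.1 + r' i.2)
      (fun ρ => a ρ * a' ρ) := by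
  refine ⟨?_, fun ρ => ?_⟩
  · exact h.summable.mul_norm h'.summable
  · have h1 := h.hasSum ρ
    have h2 := h'.hasSum ρ
    have h3 : Summable fun i => ‖b i * chr (r i) ρ‖ := by simpa using h.summable
    have h4 : Summable fun i => ‖b' i * chr (r' i) ρ‖ := by simpa using h'.summable
    have h5 : Summable fun i : ι × ι' => b i.1 * chr (r i.1) ρ * (b' i.2 * chr (r' i.2) ρ) :=
      Summable.of_norm (Summable.mul_norm (f := fun i => b i * chr (r i) ρ)
        (g := fun i => b' i * chr (r' i) ρ) h3 h4)
    have e : (fun i : ι × ι' => b i.1 * b' i.2 * chr (r i.1 + r' i.2) ρ) =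
        fun i : ι × ι' => b i.1 * chr (r i.1) ρ * (b' i.2 * chr (r' i.2) ρ) := by
      funext i
      rw [chr_add]; ring
    rw [e]
    exact HasSum.mul (f := fun i => b i * chr (r i) ρ) (g := fun i => b' i * chr (r' i) ρ) h1 h2 h5

lemma conj (h : HasTrigSeries b r a) :
    HasTrigSeries (fun i => (starRingEnd ℂ) (b i)) (fun i => -r i)
      (fun ρ => (starRingEnd ℂ) (a ρ)) := by
  refine ⟨by simpa using h.summable, fun ρ => ?_⟩
  have h1 := (Complex.conjCLE : ℂ →L[ℝ] ℂ).hasSum (h.hasSum ρ)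
  simpa [Function.comp_def, conj_chr] using h1

lemma comp_act (h : HasTrigSeries b r a) (A : SpZ d) :
    HasTrigSeries b (fun i => actZ A⁻¹ (r i)) (fun ρ => a (act A ρ)) := by
  refine ⟨h.summable, fun ρ => ?_⟩
  simpa [chr_act] using h.hasSum (act A ρ)

end HasTrigSeries

namespace Wiener

lemma mul {a a' : Phase d → ℂ} (h : Wiener a) (h' : Wiener a') : Wiener fun ρ => a ρ * a' ρ := by
  obtain ⟨ι, _, b, r, h⟩ := h
  obtain ⟨ι', _, b', r', h'⟩ := h'
  exact ⟨ι × ι', inferInstance, _, _, h.mul h'⟩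

lemma one : Wiener fun _ : Phase d => 1 :=
  ⟨Unit, inferInstance, fun _ => 1, fun _ => 0, (hasSum_fintype _).summable,
    fun ρ => by simp [chr_zero]⟩

lemma comp_act {a : Phase d → ℂ} (h : Wiener a) (A : SpZ d) : Wiener fun ρ => a (act A ρ) := by
  obtain ⟨ι, _, b, r, h⟩ := h
  exact ⟨ι, inferInstance, _, _, h.comp_act A⟩

lemma prod {ι : Type*} (s : Finset ι) {a : ι → Phase d → ℂ} (h : ∀ i, Wiener (a i)) :
    Wiener fun ρ => ∏ i ∈ s, a i ρ := by
  classical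
  induction s using Finset.induction_on with
  | empty => simpa using one
  | insert i s hi ih => simpa [Finset.prod_insert hi] using (h i).mul ih

end Wiener

open MeasureTheory

lemma integral_cis_Ico (n : ℤ) :
    ∫ t in Set.Ico (0 : ℝ) 1, cis (2 * Real.pi * (n * t)) = if n = 0 then 1 else 0 := by
  rw [integral_Ico_eq_integral_Ioc, ← intervalIntegral.integral_of_le zero_le_one]
  split_ifs with h
  · simp [h]
  · have hc : (2 * Real.pi * n * Complex.I : ℂ) ≠ 0 := by
      simp [h, Real.pi_ne_zero]
    have h1 : (fun t : ℝ => cis (2 * Real.pi * (n * t))) =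
        fun t : ℝ => Complex.exp ((2 * Real.pi * n * Complex.I : ℂ) * t) := by
      funext t; rw [cis]; push_cast; ring_nf
    rw [h1, integral_exp_mul_complex hc]
    have h2 : Complex.exp ((2 * Real.pi * n * Complex.I : ℂ) * (1 : ℝ)) = 1 := by
      rw [Complex.exp_eq_one_iff]; exact ⟨n, by push_cast; ring⟩
    rw [h2]; simp

lemma integral_cis_cube (s : Fin d ⊕ Fin d → ℤ) :
    ∫ ρ in Set.univ.pi fun _ : Fin d ⊕ Fin d => Set.Ico (0 : ℝ) 1, cis (2 * Real.pi * symp ρ (intPt s)) =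
      if s = 0 then 1 else 0 := by
  -- The frequency in standard coordinates, after undoing J; the integral over the cube then factors
  -- into one-dimensional ones.
  let n : Fin d ⊕ Fin d → ℤ := Sum.elim (-(s ∘ Sum.inr)) (s ∘ Sum.inl)
  have hn : ∀ ρ : Phase d, cis (2 * Real.pi * symp ρ (intPt s)) =
      ∏ i, cis (2 * Real.pi * (n i * ρ i)) := by
    intro ρ
    rw [← cis_sum, ← Finset.mul_sum, symp_eq]
    congr 2
    simp only [dotProduct, Fintype.sum_sum_type, n, Sum.elim_inl, Sum.elim_inr, Function.comp,
      Pi.neg_apply, intPt]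
    push_cast
    simp only [neg_mul, Finset.sum_neg_distrib]
    simp only [mul_comm (ρ _)]
    ring
  simp only [hn]
  rw [volume_pi, Measure.restrict_pi_pi,
    integral_fintype_prod_eq_prod (f := fun i t => cis (2 * Real.pi * (n i * t)))]
  simp only [integral_cis_Ico]
  split_ifs with h
  · subst h
    refine Finset.prod_eq_one fun i _ => ?_
    rcases i with i | i <;> simp [n]
  · obtain ⟨i, hi⟩ := Function.ne_iff.1 h
    rcases i with i | i
    · refine Finset.prod_eq_zero (Finset.mem_univ (Sum.inr i)) ?_
      rw [if_neg]; exact hi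
    · refine Finset.prod_eq_zero (Finset.mem_univ (Sum.inl i)) ?_
      rw [if_neg]; simpa [n] using hi

/-- Termwise integration over the unit cube, allowed by absolute convergence. Several indices may
carry the frequency t, hence the sum over a fibre. -/
lemma HasTrigSeries.fcoef_eq {ι : Type*} [Countable ι] {b : ι → ℂ} {r : ι → Fin d ⊕ Fin d → ℤ}
    {a : Phase d → ℂ} (h : HasTrigSeries b r a) (t : Fin d ⊕ Fin d → ℤ) :
    fcoef a t = ∑' i : r ⁻¹' {t}, b i := by
  set C := Set.univ.pi fun _ : Fin d ⊕ Fin d => Set.Ico (0 : ℝ) 1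
  have hC : volume C = 1 := by
    simp [C, volume_pi_pi]
  have hfin : IsFiniteMeasure (volume.restrict C) := ⟨by simp [hC]⟩
  have h1 : fcoef a t = ∫ ρ in C, ∑' i, b i * chr (r i) ρ * cis (2 * Real.pi * symp ρ (intPt t)) := by
    refine integral_congr_ae (Filter.Eventually.of_forall fun ρ => ?_)
    simp only
    rw [tsum_mul_right, (h.hasSum ρ).tsum_eq, cis, symp, dotProduct_comm]
  have hnorm : ∀ i (ρ : Phase d),
      ‖b i * chr (r i) ρ * cis (2 * Real.pi * symp ρ (intPt t))‖ = ‖b i‖ := by simp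
  have h2 := hasSum_integral_of_summable_integral_norm (μ := volume.restrict C)
    (F := fun i ρ => b i * chr (r i) ρ * cis (2 * Real.pi * symp ρ (intPt t))) ?_ ?_
  · rw [h1, ← h2.tsum_eq, tsum_subtype (r ⁻¹' {t}) b]
    refine tsum_congr fun i => ?_
    have h3 : ∀ ρ : Phase d, b i * chr (r i) ρ * cis (2 * Real.pi * symp ρ (intPt t)) =
        b i * cis (2 * Real.pi * symp ρ (intPt (t - r i))) := by
      intro ρ
      rw [mul_assoc, chr, ← cis_add, intPt_sub, symp_sub_right]; ring_nf
    simp only [h3]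
    rw [integral_const_mul, integral_cis_cube]
    by_cases hi : r i = t
    · simp [hi]
    · have : ¬ (t - r i = 0) := fun h => hi (sub_eq_zero.1 h).symm
      simp [hi, this]
  · intro i
    refine Integrable.of_bound ?_ ‖b i‖ (Filter.Eventually.of_forall fun ρ => (hnorm i ρ).le)
    refine Continuous.aestronglyMeasurable ?_
    exact (continuous_const.mul (continuous_chr _)).mul
      (continuous_cis.comp (continuous_const.mul (continuous_symp_left _)))
  · simp only [hnorm]
    simpa [hC, Measure.real] using h.summable

lemma HasTrigSeries.summable_fcoef {ι : Type*} [Countable ι] {b : ι → ℂ}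
    {r : ι → Fin d ⊕ Fin d → ℤ} {a : Phase d → ℂ} (h : HasTrigSeries b r a) :
    Summable fun t => ‖fcoef a t‖ := by
  refine Summable.of_nonneg_of_le (fun _ => norm_nonneg _) (fun t => ?_)
    (h.summable.hasSum.tsum_fiberwise r).summable
  rw [h.fcoef_eq]
  exact norm_tsum_le_tsum_norm (h.summable.subtype _)

/-- Grouping an absolutely convergent sum by fibres: any bounded functional of the Fourier
coefficients can be computed from whichever series represents a. -/
lemma HasTrigSeries.hasSum_fcoef_mul {ι : Type*} [Countable ι] {b : ι → ℂ}
    {r : ι → Fin d ⊕ Fin d → ℤ} {a : Phase d → ℂ} (h : HasTrigSeries b r a)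
    {g : (Fin d ⊕ Fin d → ℤ) → ℂ} {C : ℝ} (hg : ∀ t, ‖g t‖ ≤ C) :
    HasSum (fun t => fcoef a t * g t) (∑' i, b i * g (r i)) := by
  have h1 : Summable fun i => b i * g (r i) := by
    refine Summable.of_norm_bounded (g := fun i => ‖b i‖ * C) (h.summable.mul_right C) fun i => ?_
    rw [norm_mul]; exact mul_le_mul_of_nonneg_left (hg _) (norm_nonneg _)
  refine HasSum.congr_fun (h1.hasSum.tsum_fiberwise r) ?_
  intro t
  rw [h.fcoef_eq, ← tsum_mul_right]
  refine tsum_congr fun i => ?_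
  have : r i = t := i.2
  rw [this]

/-! ### Weyl quantization of trigonometric series -/

lemma continuous_smul_tempered (ψ : 𝓢'(Conf d, ℂ)) : Continuous fun c : ℂ => c • ψ :=
  PointwiseConvergenceCLM.continuous_of_continuous_eval fun φ =>
    (continuous_id.mul continuous_const : Continuous fun c : ℂ => c * ψ φ)

/-- On a state the translations depend only on the frequency modulo N, up to a phase. The series
therefore splits into finitely many scalar series times fixed distributions, and converges in 𝓢'.
Without this the `tsum` in `opWeyl` could not be exchanged with the scalar product. -/
lemma summable_weyl (hN : 1 ≤ N) {ψ : 𝓢'(Conf d, ℂ)} (hψ : ψ ∈ states N κ)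
    {c : (Fin d ⊕ Fin d → ℤ) → ℂ} (hc : Summable fun t => ‖c t‖) :
    Summable fun t => c t • weyl N t ψ := by
  classical
  have h : ∀ t : Fin d ⊕ Fin d → ℤ, ∃ (k : Fin d ⊕ Fin d → Fin N) (s : ℝ),
      weyl N t ψ = cis s • weyl N (toInt k) ψ := by
    intro t
    obtain ⟨k, q, hq⟩ := exists_toInt hN t
    obtain ⟨s, hs⟩ := exists_weyl_add hN hψ (toInt k) q
    exact ⟨k, s, by rw [hq, hs]⟩
  choose k s hks using h
  have e : (fun t => c t • weyl N t ψ) = fun t => ∑ l : Fin d ⊕ Fin d → Fin N,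
      (if k t = l then c t * cis (s t) else 0) • weyl N (toInt l) ψ := by
    funext t
    rw [Finset.sum_eq_single (k t)]
    · rw [if_pos rfl, mul_smul, ← hks]
    · intro l _ hl; rw [if_neg hl.symm]; exact zero_smul ℂ (weyl N (toInt l) ψ)
    · simp
  rw [e]
  refine summable_sum fun l _ => ?_
  have h1 : Summable fun t => if k t = l then c t * cis (s t) else 0 := by
    refine Summable.of_norm_bounded hc fun t => ?_
    split_ifs <;> simp
  exact (h1.hasSum.map ((smulAddHom ℂ 𝓢'(Conf d, ℂ)).flip (weyl N (toInt l) ψ))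
    (continuous_smul_tempered _)).summable

lemma norm_expect_le (hN : 1 ≤ N) {ψ : 𝓢'(Conf d, ℂ)} (hψ : ψ ∈ states N κ) :
    ∃ C, ∀ r, ‖expect N κ ψ r‖ ≤ C := by
  obtain ⟨C, hC⟩ := Finset.exists_le (Finset.univ.image fun k : Fin d ⊕ Fin d → Fin N =>
    ‖expect N κ ψ (toInt k)‖)
  refine ⟨C, fun r => ?_⟩
  obtain ⟨k, q, hq⟩ := exists_toInt hN r
  obtain ⟨s, hs⟩ := exists_weyl_add hN hψ (toInt k) q
  rw [hq, expect, hs, stateInner_smul_right, norm_mul, norm_cis, one_mul]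
  exact hC _ (Finset.mem_image_of_mem _ (Finset.mem_univ k))

lemma HasTrigSeries.stateInner_opWeyl (hN : 1 ≤ N) {ψ : 𝓢'(Conf d, ℂ)} (hψ : ψ ∈ states N κ)
    {ι : Type*} [Countable ι] {b : ι → ℂ}
    {r : ι → Fin d ⊕ Fin d → ℤ} {a : Phase d → ℂ} (h : HasTrigSeries b r a) :
    stateInner N κ ψ (opWeyl N a ψ) = ∑' i, b i * expect N κ ψ (r i) := by
  obtain ⟨C, hC⟩ := norm_expect_le hN hψ
  rw [← (h.hasSum_fcoef_mul hC).tsum_eq, opWeyl, ← stateInnerL_apply]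
  have := (stateInnerL N κ ψ).map_tsum (summable_weyl hN hψ h.summable_fcoef)
  refine this.trans (tsum_congr fun t => ?_)
  rw [map_smul, stateInnerL_apply]; rfl

end CatMap

end

noncomputable section
namespace CatMap

/-! ### Fourier series of smooth periodic functions -/

section Torus

open MeasureTheory UnitAddTorus

local instance : MeasureSpace UnitAddCircle := ⟨AddCircle.haarAddCircle⟩

local instance : Measure.IsAddHaarMeasure (volume : Measure UnitAddCircle) :=
  inferInstanceAs (Measure.IsAddHaarMeasure AddCircle.haarAddCircle)

local instance : IsProbabilityMeasure (volume : Measure UnitAddCircle) :=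
  inferInstanceAs (IsProbabilityMeasure AddCircle.haarAddCircle)

variable {n : Type*}

/-- The projection of `ℝ^n` onto the torus. -/
def torusProj (x : n → ℝ) : UnitAddTorus n := fun i => (x i : UnitAddCircle)

lemma isOpenQuotientMap_torusProj : IsOpenQuotientMap (torusProj : (n → ℝ) → UnitAddTorus n) :=
  IsOpenQuotientMap.piMap fun _ => QuotientAddGroup.isOpenQuotientMap_mk

lemma torusProj_add (x y : n → ℝ) : torusProj (x + y) = torusProj x + torusProj y := rfl

/-- Periodicity with respect to `ℤ^n`. -/
def ZPeriodic (a : (n → ℝ) → ℂ) : Prop := ∀ (x : n → ℝ) (m : n → ℤ), a (x + fun i => (m i : ℝ)) = a x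

lemma exists_torus_lift {a : (n → ℝ) → ℂ} (ha : Continuous a) (hp : ZPeriodic a) :
    ∃ F : C(UnitAddTorus n, ℂ), ∀ x, F (torusProj x) = a x := by
  have hf : ∀ x y : n → ℝ, torusProj x = torusProj y → a x = a y := by
    intro x y h
    have h1 : ∀ i, ∃ m : ℤ, x i = y i + m := by
      intro i
      have h2 : ((x i - y i : ℝ) : UnitAddCircle) = 0 := by
        rw [AddCircle.coe_sub, sub_eq_zero]; exact congrFun h i
      obtain ⟨m, hm⟩ := (AddCircle.coe_eq_zero_iff 1).1 h2
      refine ⟨m, ?_⟩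
      rw [zsmul_eq_mul, mul_one] at hm
      rw [hm]; ring
    choose m hm using h1
    have : x = y + fun i => (m i : ℝ) := funext hm
    rw [this, hp]
  let f : UnitAddTorus n → ℂ := fun t => a (Function.surjInv isOpenQuotientMap_torusProj.surjective t)
  have hfa : ∀ x, f (torusProj x) = a x := fun x =>
    hf _ _ (Function.surjInv_eq isOpenQuotientMap_torusProj.surjective _)
  refine ⟨⟨f, ?_⟩, hfa⟩
  rw [isOpenQuotientMap_torusProj.isQuotientMap.continuous_iff]
  have : f ∘ torusProj = a := funext hfa
  rwa [this]

variable [Fintype n]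

lemma mFourier_torusProj (m : n → ℤ) (x : n → ℝ) :
    mFourier m (torusProj x) = cis (2 * Real.pi * ∑ i, m i * x i) := by
  change ∏ i, fourier (m i) (torusProj x i) = _
  rw [Finset.mul_sum, cis_sum]
  refine Finset.prod_congr rfl fun i _ => ?_
  rw [torusProj, fourier_coe_apply, cis]
  congr 1; push_cast; ring

lemma mFourier_add_point (m : n → ℤ) (s t : UnitAddTorus n) :
    mFourier m (s + t) = mFourier m s * mFourier m t := by
  obtain ⟨x, rfl⟩ := isOpenQuotientMap_torusProj.surjective s
  obtain ⟨y, rfl⟩ := isOpenQuotientMap_torusProj.surjective t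
  rw [← torusProj_add, mFourier_torusProj, mFourier_torusProj, mFourier_torusProj, ← cis_add]
  congr 1
  simp only [Pi.add_apply, mul_add, Finset.sum_add_distrib]

lemma mFourierCoeff_translate (F : C(UnitAddTorus n, ℂ)) (m : n → ℤ) (p : UnitAddTorus n) :
    ∫ t, mFourier (-m) t • F (t + p) = mFourier m p * mFourierCoeff F m := by
  have h1 : ∀ t, mFourier (-m) t • F (t + p) =
      mFourier m p * (mFourier (-m) (t + p) • F (t + p)) := by
    intro t
    rw [mFourier_add_point, smul_eq_mul, smul_eq_mul]
    have : mFourier m p * mFourier (-m) p = 1 := by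
      rw [← mFourier_add, add_neg_cancel, mFourier_zero]; rfl
    calc mFourier (-m) t * F (t + p) = (mFourier m p * mFourier (-m) p) * mFourier (-m) t * F (t + p) := by
          rw [this, one_mul]
      _ = _ := by ring
  simp only [h1]
  rw [integral_const_mul, integral_add_right_eq_self (fun t => mFourier (-m) t • F t)]
  rfl

/-- Translating F by h e_j multiplies its m-th coefficient by e^{2πi m_j h}. Differentiating at h =
0 under the integral and using uniqueness of derivatives replaces integration by parts. -/
lemma mFourierCoeff_deriv [DecidableEq n] {a : (n → ℝ) → ℂ} (ha : ContDiff ℝ 1 a) (j : n)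
    {F F' : C(UnitAddTorus n, ℂ)} (hF : ∀ x, F (torusProj x) = a x)
    (hF' : ∀ x, F' (torusProj x) = fderiv ℝ a x (Pi.single j 1)) (m : n → ℤ) :
    mFourierCoeff F' m = 2 * Real.pi * Complex.I * m j * mFourierCoeff F m := by
  let p : ℝ → UnitAddTorus n := fun h => torusProj (h • Pi.single j 1)
  have hp : Continuous p := isOpenQuotientMap_torusProj.continuous.comp (by fun_prop)
  have hline : ∀ (t : UnitAddTorus n) (h : ℝ), HasDerivAt (fun h => F (t + p h)) (F' (t + p h)) h := by
    intro t h
    obtain ⟨x, rfl⟩ := isOpenQuotientMap_torusProj.surjective t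
    have e : (fun h => F (torusProj x + p h)) = fun h : ℝ => a (x + h • Pi.single j 1) := by
      funext h; rw [← hF]; rfl
    have e' : F' (torusProj x + p h) = fderiv ℝ a (x + h • Pi.single j 1) (Pi.single j 1) := by
      rw [← hF']; rfl
    rw [e, e']
    have h1 : HasDerivAt (fun h : ℝ => x + h • (Pi.single j 1 : n → ℝ)) (Pi.single j 1) h := by
      simpa using ((hasDerivAt_id h).smul_const (Pi.single j 1 : n → ℝ)).const_add x
    exact ((ha.differentiable (by simp)) _).hasFDerivAt.comp_hasDerivAt h h1
  have hint : ∀ G : C(UnitAddTorus n, ℂ), Integrable (fun t => G t) := fun G =>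
    G.continuous.integrable_of_hasCompactSupport (HasCompactSupport.of_compactSpace _)
  have hcont : ∀ (G : C(UnitAddTorus n, ℂ)) h, Continuous fun t => mFourier (-m) t • G (t + p h) :=
    fun G h => (mFourier (-m)).continuous.smul (G.continuous.comp (continuous_id.add continuous_const))
  have key := (hasDerivAt_integral_of_dominated_loc_of_deriv_le (𝕜 := ℝ)
    (μ := (volume : Measure (UnitAddTorus n))) (x₀ := (0 : ℝ)) (s := Set.univ)
    (F := fun h t => mFourier (-m) t • F (t + p h))
    (F' := fun h t => mFourier (-m) t • F' (t + p h)) (bound := fun _ => ‖F'‖) Filter.univ_mem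
    (Filter.Eventually.of_forall fun h => (hcont F h).aestronglyMeasurable)
    ((hcont F 0).integrable_of_hasCompactSupport (HasCompactSupport.of_compactSpace _))
    ((hcont F' 0).aestronglyMeasurable)
    (Filter.Eventually.of_forall fun t h _ => by
      rw [norm_smul]
      have h1 : ‖mFourier (-m) t‖ ≤ 1 := (mFourier (-m)).norm_coe_le_norm t |>.trans mFourier_norm.le
      exact (mul_le_of_le_one_left (norm_nonneg _) h1).trans (F'.norm_coe_le_norm _))
    (integrable_const _)
    (Filter.Eventually.of_forall fun t h _ => (hline t h).const_smul (mFourier (-m) t))).2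
  have h0 : p 0 = 0 := by ext i; simp [p, torusProj]
  simp only [mFourierCoeff_translate] at key
  rw [h0] at key
  have hm0 : mFourier m (0 : UnitAddTorus n) = 1 := by
    have h2 : (0 : UnitAddTorus n) = torusProj 0 := rfl
    rw [h2, mFourier_torusProj]; simp
  rw [hm0, one_mul] at key
  have hexp : ∀ h, mFourier m (p h) = cis (2 * Real.pi * m j * h) := by
    intro h
    simp only [p]
    rw [mFourier_torusProj]
    congr 1
    rw [Finset.sum_eq_single j]
    · simp; ring
    · intro i _ hi; simp [hi]
    · simp
  have key2 : HasDerivAt (fun h : ℝ => mFourier m (p h) * mFourierCoeff F m)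
      (2 * Real.pi * Complex.I * m j * mFourierCoeff F m) 0 := by
    simp only [hexp]
    have h3 : HasDerivAt (fun h : ℝ => cis (2 * Real.pi * m j * h))
        (cis (2 * Real.pi * m j * 0) * ((((2 * Real.pi * m j : ℝ) : ℂ) * 1) * Complex.I)) 0 := by
      unfold cis
      refine HasDerivAt.cexp (HasDerivAt.mul_const ?_ Complex.I)
      have h4 := (Complex.ofRealCLM.hasDerivAt (x := (0 : ℝ))).const_mul ((2 * Real.pi * m j : ℝ) : ℂ)
      simpa using h4
    have h5 := h3.mul_const (mFourierCoeff F m)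
    have e : cis (2 * Real.pi * m j * 0) * ((((2 * Real.pi * m j : ℝ) : ℂ) * 1) * Complex.I) *
        mFourierCoeff F m = 2 * Real.pi * Complex.I * m j * mFourierCoeff F m := by
      rw [mul_zero, cis_zero]; push_cast; ring
    rw [e] at h5
    exact h5
  exact key.unique key2

lemma ZPeriodic.fderiv {a : (n → ℝ) → ℂ} (hp : ZPeriodic a) (v : n → ℝ) :
    ZPeriodic fun x => fderiv ℝ a x v := by
  intro x m
  have : a = fun x => a (x + fun i => (m i : ℝ)) := funext fun x => (hp x m).symm
  have h := fderiv_comp_add_right (𝕜 := ℝ) (f := a) (x := x) fun i => (m i : ℝ)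
  rw [← this] at h
  exact congrArg (fun L : (n → ℝ) →L[ℝ] ℂ => L v) h.symm

/-- The witness lifts ∏ (1 - ∂_j²) a. The induction must also carry the smooth periodic function
below G, since the next coordinate differentiates it again. -/
lemma exists_coeff_mul_prod [DecidableEq n] (s : Finset n) {a : (n → ℝ) → ℂ} (ha : ContDiff ℝ ∞ a)
    (hp : ZPeriodic a) {F : C(UnitAddTorus n, ℂ)} (hF : ∀ x, F (torusProj x) = a x) :
    ∃ G : C(UnitAddTorus n, ℂ), ∀ m, mFourierCoeff G m =
      (∏ j ∈ s, (1 + (2 * Real.pi * m j : ℂ) ^ 2)) * mFourierCoeff F m := by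
  suffices h : ∃ (b : (n → ℝ) → ℂ) (G : C(UnitAddTorus n, ℂ)), ContDiff ℝ ∞ b ∧ ZPeriodic b ∧
      (∀ x, G (torusProj x) = b x) ∧ ∀ m, mFourierCoeff G m =
      (∏ j ∈ s, (1 + (2 * Real.pi * m j : ℂ) ^ 2)) * mFourierCoeff F m by
    obtain ⟨b, G, -, -, -, h⟩ := h
    exact ⟨G, h⟩
  induction s using Finset.induction_on with
  | empty => exact ⟨a, F, ha, hp, hF, fun m => by simp⟩
  | insert j s hj ih =>
    obtain ⟨b, G, hb, hbp, hG, hGm⟩ := ih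
    have hd : ∀ b : (n → ℝ) → ℂ, ContDiff ℝ ∞ b →
        ContDiff ℝ ∞ fun x => fderiv ℝ b x (Pi.single j 1) := fun b hb =>
      (hb.fderiv_right (m := ∞) (by simp)).clm_apply contDiff_const
    set b1 := fun x => fderiv ℝ b x (Pi.single j 1) with hb1
    set b2 := fun x => fderiv ℝ b1 x (Pi.single j 1) with hb2
    have s1 := hd b hb
    have s2 := hd b1 s1
    have p1 : ZPeriodic b1 := hbp.fderiv _
    have p2 : ZPeriodic b2 := p1.fderiv _
    obtain ⟨G1, hG1⟩ := exists_torus_lift s1.continuous p1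
    obtain ⟨G2, hG2⟩ := exists_torus_lift s2.continuous p2
    refine ⟨fun x => b x - b2 x, G - G2, hb.sub s2, fun x m => by
      change b _ - b2 _ = b x - b2 x
      rw [hbp, p2], fun x => ?_,
      fun m => ?_⟩
    · rw [ContinuousMap.sub_apply, hG, hG2]
    · have e1 := mFourierCoeff_deriv (hb.of_le (by simp)) j hG hG1 m
      have e2 := mFourierCoeff_deriv (s1.of_le (by simp)) j hG1 hG2 m
      have e3 : mFourierCoeff (G - G2 : C(UnitAddTorus n, ℂ)) m = mFourierCoeff G m - mFourierCoeff G2 m := by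
        have hint : ∀ H : C(UnitAddTorus n, ℂ), Integrable (fun t => mFourier (-m) t • H t) := fun H =>
          ((mFourier (-m)).continuous.smul H.continuous).integrable_of_hasCompactSupport
            (HasCompactSupport.of_compactSpace _)
        simp only [mFourierCoeff, ContinuousMap.sub_apply, smul_sub]
        exact integral_sub (hint G) (hint G2)
      rw [e3, e2, e1, hGm, Finset.prod_insert hj]
      ring_nf
      rw [Complex.I_sq]
      ring

/-- A finite set of multi-indices lies in a box, over which the sum of products is a product of
one-dimensional sums. -/
lemma summable_prod_inv (n : Type*) [Fintype n] [DecidableEq n] :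
    Summable fun m : n → ℤ => ∏ j, (1 + (2 * Real.pi * m j : ℝ) ^ 2)⁻¹ := by
  have h1 : Summable fun k : ℤ => (1 + (2 * Real.pi * k : ℝ) ^ 2)⁻¹ := by
    have h2 : Summable fun k : ℤ => 1 / (k : ℝ) ^ 2 := Real.summable_one_div_int_pow.2 (by norm_num)
    have h3 : Summable fun k : ℤ => if k = 0 then (1 : ℝ) else 0 := (hasSum_ite_eq 0 1).summable
    refine Summable.of_nonneg_of_le (fun k => by positivity) (fun k => ?_) (h2.add h3)
    split_ifs with hk
    · simp [hk]
    · rw [add_zero, ← one_div]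
      have h4 : (1 : ℝ) ≤ (2 * Real.pi) ^ 2 := by nlinarith [Real.pi_gt_three]
      have h5 : (0 : ℝ) < (k : ℝ) ^ 2 := by positivity
      apply one_div_le_one_div_of_le h5
      rw [mul_pow]; nlinarith
  refine summable_of_sum_le (c := ∏ _j : n, ∑' k : ℤ, (1 + (2 * Real.pi * k : ℝ) ^ 2)⁻¹)
    (fun m => Finset.prod_nonneg fun j _ => by positivity) fun s => ?_
  calc ∑ m ∈ s, ∏ j, (1 + (2 * Real.pi * m j : ℝ) ^ 2)⁻¹
      ≤ ∑ m ∈ Fintype.piFinset fun j => s.image fun m => m j,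
          ∏ j, (1 + (2 * Real.pi * m j : ℝ) ^ 2)⁻¹ := by
        refine Finset.sum_le_sum_of_subset_of_nonneg (fun m hm => ?_) fun m _ _ =>
          Finset.prod_nonneg fun j _ => by positivity
        rw [Fintype.mem_piFinset]
        exact fun j => Finset.mem_image_of_mem _ hm
    _ = ∏ j : n, ∑ k ∈ s.image fun m => m j, (1 + (2 * Real.pi * k : ℝ) ^ 2)⁻¹ := by
        rw [Finset.prod_univ_sum]
    _ ≤ _ := by
        refine Finset.prod_le_prod (fun j _ => Finset.sum_nonneg fun k _ => by positivity) fun j _ => ?_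
        exact h1.sum_le_tsum _ fun k _ => by positivity

/-- The coefficients of ∏ (1 - ∂_j²) a are bounded by its sup norm, so those of a are dominated by a
summable product. -/
lemma summable_mFourierCoeff [DecidableEq n] {a : (n → ℝ) → ℂ} (ha : ContDiff ℝ ∞ a)
    (hp : ZPeriodic a) {F : C(UnitAddTorus n, ℂ)} (hF : ∀ x, F (torusProj x) = a x) :
    Summable fun m => ‖mFourierCoeff F m‖ := by
  obtain ⟨G, hG⟩ := exists_coeff_mul_prod Finset.univ ha hp hF
  refine Summable.of_nonneg_of_le (fun _ => norm_nonneg _) (fun m => ?_)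
    ((summable_prod_inv n).mul_right ‖G‖)
  have h1 : ‖mFourierCoeff G m‖ ≤ ‖G‖ := by
    have h2 : ∀ t, ‖mFourier (-m) t • G t‖ ≤ ‖G‖ := by
      intro t
      rw [norm_smul]
      have h1 : ‖mFourier (-m) t‖ ≤ 1 := (mFourier (-m)).norm_coe_le_norm t |>.trans mFourier_norm.le
      exact (mul_le_of_le_one_left (norm_nonneg _) h1).trans (G.norm_coe_le_norm _)
    have := norm_integral_le_of_norm_le_const (μ := (volume : Measure (UnitAddTorus n)))
      (Filter.Eventually.of_forall h2)
    refine (le_of_eq_of_le rfl this).trans ?_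
    simp
  rw [hG, norm_mul] at h1
  have h3 : ‖∏ j, (1 + (2 * Real.pi * m j : ℂ) ^ 2)‖ = ∏ j, (1 + (2 * Real.pi * m j : ℝ) ^ 2) := by
    have : ∏ j, (1 + (2 * Real.pi * m j : ℂ) ^ 2) =
      ((∏ j, (1 + (2 * Real.pi * m j : ℝ) ^ 2) : ℝ) : ℂ) := by push_cast; rfl
    rw [this, Complex.norm_real, Real.norm_of_nonneg (Finset.prod_nonneg fun j _ => by positivity)]
  rw [h3] at h1
  have hpos : 0 < ∏ j, (1 + (2 * Real.pi * m j : ℝ) ^ 2) := Finset.prod_pos fun j _ => by positivity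
  rw [Finset.prod_inv_distrib, ← div_eq_inv_mul, le_div_iff₀ hpos, mul_comm]
  exact h1

lemma wiener_of_contDiff {d : ℕ} {a : Phase d → ℂ} (ha : ContDiff ℝ ∞ a)
    (hp : ∀ (r : Fin d ⊕ Fin d → ℤ) (ρ : Phase d), a (ρ + intPt r) = a ρ) : Wiener a := by
  have hp' : ZPeriodic a := fun x m => hp m x
  obtain ⟨F, hF⟩ := exists_torus_lift ha.continuous hp'
  have hs := summable_mFourierCoeff ha hp' hF
  refine ⟨Fin d ⊕ Fin d → ℤ, inferInstance, mFourierCoeff F,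
    -- Chosen so that -σ(ρ, r) = m · ρ.
    fun m => Sum.elim (-(m ∘ Sum.inr)) (m ∘ Sum.inl), hs, fun ρ => ?_⟩
  have h1 := hasSum_mFourier_series_apply_of_summable hs.of_norm (torusProj ρ)
  rw [hF] at h1
  refine HasSum.congr_fun h1 fun m => ?_
  rw [smul_eq_mul, mFourier_torusProj, chr, symp_eq]
  congr 2
  simp only [dotProduct, Fintype.sum_sum_type, Sum.elim_inl, Sum.elim_inr, Function.comp,
    Pi.neg_apply, intPt]
  push_cast
  simp only [mul_neg, Finset.sum_neg_distrib]
  simp only [mul_comm (ρ _)]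
  ring

end Torus

end CatMap

end

noncomputable section
namespace CatMap

open MeasureTheory

variable {d : ℕ} {N : ℕ}

/-! ### Gaussian integrals on phase space -/

lemma measurableEmbedding_mulVec {n : Type*} [Fintype n] [DecidableEq n] {M : Matrix n n ℝ}
    (hM : M.det ≠ 0) : MeasurableEmbedding fun x : n → ℝ => M *ᵥ x := by
  have hu : IsUnit M.det := hM.isUnit
  let e := (Matrix.toLin'OfInv (Matrix.nonsing_inv_mul M hu)
    (Matrix.mul_nonsing_inv M hu)).toContinuousLinearEquiv
  exact e.toHomeomorph.measurableEmbedding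

lemma integral_comp_mulVec {n : Type*} [Fintype n] [DecidableEq n] {M : Matrix n n ℝ}
    (hM : M.det ≠ 0) (f : (n → ℝ) → ℂ) :
    ∫ x, f (M *ᵥ x) = ((|M.det|⁻¹ : ℝ) : ℂ) * ∫ x, f x := by
  have h1 := Real.map_matrix_volume_pi_eq_smul_volume_pi hM
  have h2 : (⇑(Matrix.toLin' M) : (n → ℝ) → n → ℝ) = fun x => M *ᵥ x := by
    ext x; simp
  rw [h2] at h1
  rw [← (measurableEmbedding_mulVec hM).integral_map, h1, integral_smul_measure,
    ENNReal.toReal_ofReal (abs_nonneg _), abs_inv, Complex.real_smul]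

lemma integrable_comp_mulVec {n : Type*} [Fintype n] [DecidableEq n] {M : Matrix n n ℝ}
    (hM : M.det ≠ 0) {f : (n → ℝ) → ℂ} (hf : Integrable f) : Integrable fun x => f (M *ᵥ x) := by
  have h1 := Real.map_matrix_volume_pi_eq_smul_volume_pi hM
  have h2 : (⇑(Matrix.toLin' M) : (n → ℝ) → n → ℝ) = fun x => M *ᵥ x := by
    ext x; simp
  rw [h2] at h1
  exact ((measurableEmbedding_mulVec hM).integrable_map_iff (μ := volume) (g := f)).1
    (by rw [h1]; exact hf.smul_measure ENNReal.ofReal_ne_top)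

/-- The Gaussian `exp (-b π |x|²)` as a complex function. -/
def gaussC (b : ℝ) (x : Phase d) : ℂ := (Real.exp (-b * Real.pi * (x ⬝ᵥ x)) : ℝ)

lemma gaussC_eq (b : ℝ) (x : Phase d) :
    gaussC b x = Complex.exp (-((b * Real.pi : ℝ) : ℂ) * ∑ i, (x i : ℂ) ^ 2 + ∑ i, (0 : ℂ) * x i) := by
  rw [gaussC, dotProduct, Complex.ofReal_exp]
  congr 1
  simp [pow_two]

lemma integrable_gaussC {b : ℝ} (hb : 0 < b) : Integrable (gaussC b : Phase d → ℂ) := by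
  have := GaussianFourier.integrable_cexp_neg_mul_sum_add (ι := Fin d ⊕ Fin d)
    (b := ((b * Real.pi : ℝ) : ℂ)) (by rw [Complex.ofReal_re]; positivity) (fun _ => 0)
  exact this.congr (Filter.Eventually.of_forall fun x => (gaussC_eq b x).symm)

lemma continuous_gaussC (b : ℝ) : Continuous (gaussC b : Phase d → ℂ) := by
  unfold gaussC
  refine Complex.continuous_ofReal.comp (Real.continuous_exp.comp (continuous_const.mul ?_))
  exact Continuous.dotProduct continuous_id continuous_id

lemma norm_gaussC_le {b : ℝ} (hb : 0 < b) (x : Phase d) : ‖gaussC b x‖ ≤ 1 := by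
  rw [gaussC, Complex.norm_real, Real.norm_of_nonneg (Real.exp_nonneg _), Real.exp_le_one_iff]
  have : 0 ≤ x ⬝ᵥ x := Finset.sum_nonneg fun i _ => mul_self_nonneg _
  have := mul_nonneg (mul_pos hb Real.pi_pos).le this
  linarith

/-- The ordinary Fourier transform of a Gaussian at Jw. J is orthogonal, so it disappears from the
result, and the exponent d is half the dimension 2d. -/
lemma integral_cis_symp_gaussC {b : ℝ} (hb : 0 < b) (w : Phase d) :
    ∫ x : Phase d, cis (2 * Real.pi * symp x w) * gaussC b x =
      ((b⁻¹ ^ d : ℝ) : ℂ) * gaussC b⁻¹ w := by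
  have hbp : (0 : ℝ) < b * Real.pi := by positivity
  have h1 := GaussianFourier.integral_cexp_neg_mul_sum_add (ι := Fin d ⊕ Fin d)
    (b := ((b * Real.pi : ℝ) : ℂ)) (by rw [Complex.ofReal_re]; positivity)
    (fun i => 2 * Real.pi * Complex.I * ((Matrix.J (Fin d) ℝ *ᵥ w) i : ℂ))
  have h2 : ∀ x : Phase d, cis (2 * Real.pi * symp x w) * gaussC b x =
      Complex.exp (-((b * Real.pi : ℝ) : ℂ) * ∑ i, (x i : ℂ) ^ 2 +
        ∑ i, 2 * Real.pi * Complex.I * ((Matrix.J (Fin d) ℝ *ᵥ w) i : ℂ) * x i) := by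
    intro x
    rw [gaussC_eq, cis, ← Complex.exp_add, symp, dotProduct]
    congr 1
    push_cast
    simp only [zero_mul, Finset.sum_const_zero, add_zero, Finset.mul_sum, Finset.sum_mul]
    rw [add_comm]
    congr 1
    refine Finset.sum_congr rfl fun i _ => ?_
    ring
  simp only [h2]
  rw [h1]
  have h3 : (Real.pi / ((b * Real.pi : ℝ) : ℂ)) = ((b⁻¹ : ℝ) : ℂ) := by
    push_cast
    have := Complex.ofReal_ne_zero.2 Real.pi_ne_zero
    have := Complex.ofReal_ne_zero.2 hb.ne'
    field_simp
  have h4 : ((Fintype.card (Fin d ⊕ Fin d) : ℂ) / 2) = (d : ℂ) := by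
    simp
  rw [h3, h4, Complex.cpow_natCast]
  congr 1
  · push_cast; rfl
  · rw [gaussC, Complex.ofReal_exp]
    congr 1
    have h5 : (Matrix.J (Fin d) ℝ *ᵥ w) ⬝ᵥ (Matrix.J (Fin d) ℝ *ᵥ w) = w ⬝ᵥ w := by
      rw [Matrix.J, Matrix.fromBlocks_mulVec]
      simp only [dotProduct, Fintype.sum_sum_type, Sum.elim_inl, Sum.elim_inr, Matrix.zero_mulVec,
        Matrix.neg_mulVec, Matrix.one_mulVec, zero_add, add_zero, Pi.neg_apply, Function.comp]
      rw [add_comm]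
      congr 1
      refine Finset.sum_congr rfl fun i _ => by ring
    have h6 : ∑ i, (2 * Real.pi * Complex.I * ((Matrix.J (Fin d) ℝ *ᵥ w) i : ℂ)) ^ 2 =
        -(2 * Real.pi : ℂ) ^ 2 * ((w ⬝ᵥ w : ℝ) : ℂ) := by
      rw [← h5, dotProduct]
      push_cast
      rw [Finset.mul_sum]
      refine Finset.sum_congr rfl fun i _ => ?_
      rw [mul_pow, mul_pow, Complex.I_sq]; ring
    rw [h6]
    push_cast
    have := Complex.ofReal_ne_zero.2 Real.pi_ne_zero
    have := Complex.ofReal_ne_zero.2 hb.ne'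
    field_simp
    ring

/-- Matrices that are self-adjoint for the symplectic form. -/
def SympSelfAdjoint (B : PMat d ℝ) : Prop := ∀ u v, symp (B *ᵥ u) v = symp u (B *ᵥ v)

lemma SympSelfAdjoint.inv {B : PMat d ℝ} (hB : SympSelfAdjoint B) (hdet : B.det ≠ 0) :
    SympSelfAdjoint B⁻¹ := by
  intro u v
  have h := hB (B⁻¹ *ᵥ u) (B⁻¹ *ᵥ v)
  simp only [Matrix.mulVec_mulVec, Matrix.mul_nonsing_inv B hdet.isUnit, Matrix.one_mulVec] at h
  exact h.symm

lemma inv_mulVec_mulVec {B : PMat d ℝ} (hdet : B.det ≠ 0) (u : Phase d) : B⁻¹ *ᵥ (B *ᵥ u) = u := by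
  rw [Matrix.mulVec_mulVec, Matrix.nonsing_inv_mul B hdet.isUnit, Matrix.one_mulVec]

lemma det_inv_ne_zero {B : PMat d ℝ} (hdet : B.det ≠ 0) : B⁻¹.det ≠ 0 := by
  rw [Matrix.det_nonsing_inv]
  simpa using hdet

/-- Self-adjointness gives σ(x, w) = σ(Bx, B⁻¹w), so substituting Bx reduces to the isotropic
Gaussian. -/
lemma integral_cis_symp_gaussC_mulVec {B : PMat d ℝ} (hB : SympSelfAdjoint B) (hdet : B.det ≠ 0)
    {b : ℝ} (hb : 0 < b) (w : Phase d) :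
    ∫ x : Phase d, cis (2 * Real.pi * symp x w) * gaussC b (B *ᵥ x) =
      ((|B.det|⁻¹ * b⁻¹ ^ d : ℝ) : ℂ) * gaussC b⁻¹ (B⁻¹ *ᵥ w) := by
  have h1 := integral_comp_mulVec hdet fun x => cis (2 * Real.pi * symp x (B⁻¹ *ᵥ w)) * gaussC b x
  have h2 : ∀ x : Phase d, symp (B *ᵥ x) (B⁻¹ *ᵥ w) = symp x w := by
    intro x
    rw [← hB.inv hdet, inv_mulVec_mulVec hdet]
  simp only [h2] at h1
  rw [h1, integral_cis_symp_gaussC hb]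
  push_cast; ring

end CatMap

end

noncomputable section
namespace CatMap

open MeasureTheory

variable {d : ℕ} {N : ℕ}

/-! ### The smoothing kernel -/

lemma gaussC_neg (b : ℝ) (x : Phase d) : gaussC b (-x) = gaussC b x := by
  simp [gaussC]

lemma gaussC_smul (b t : ℝ) (x : Phase d) : gaussC b (t • x) = gaussC (b * t ^ 2) x := by
  simp only [gaussC, smul_dotProduct, dotProduct_smul, smul_eq_mul]
  congr 2; ring

lemma continuous_gaussC_mulVec (b : ℝ) (B : PMat d ℝ) : Continuous fun x => gaussC b (B *ᵥ x) :=
  (continuous_gaussC b).comp (Continuous.matrix_mulVec continuous_const continuous_id)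

lemma continuous_symp {X : Type*} [TopologicalSpace X] {f g : X → Phase d} (hf : Continuous f)
    (hg : Continuous g) : Continuous fun x => symp (f x) (g x) :=
  hf.dotProduct (Continuous.matrix_mulVec continuous_const hg)

lemma integrable_gaussC_mulVec {B : PMat d ℝ} (hdet : B.det ≠ 0) {b : ℝ} (hb : 0 < b) :
    Integrable fun x : Phase d => gaussC b (B *ᵥ x) :=
  integrable_comp_mulVec hdet (integrable_gaussC hb)

/-- The integrand of the smoothing kernel. -/
def kernelAux (B : PMat d ℝ) (N : ℕ) (u s : Phase d) : ℂ :=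
  cis (2 * Real.pi * symp u s) *
    (gaussC 1 (B⁻¹ *ᵥ s) * gaussC 1 (B *ᵥ (u + (2 * N : ℝ)⁻¹ • s)))

/-- The kernel `G_ħ ♯ G_ħ`. -/
def kernel (B : PMat d ℝ) (N : ℕ) (u : Phase d) : ℂ := 2 ^ d * ∫ s, kernelAux B N u s

lemma continuous_kernelAux (B : PMat d ℝ) (N : ℕ) :
    Continuous fun p : Phase d × Phase d => kernelAux B N p.1 p.2 := by
  unfold kernelAux
  refine (continuous_cis.comp (continuous_const.mul (continuous_symp continuous_fst
    continuous_snd))).mul (((continuous_gaussC_mulVec 1 B⁻¹).comp continuous_snd).mul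
    ((continuous_gaussC_mulVec 1 B).comp ?_))
  fun_prop

lemma integrable_kernelAux {B : PMat d ℝ} (hdet : B.det ≠ 0) (N : ℕ) :
    Integrable (fun p : Phase d × Phase d => kernelAux B N p.1 p.2) (volume.prod volume) := by
  rw [integrable_prod_iff' (continuous_kernelAux B N).aestronglyMeasurable]
  have hn : ∀ u s, ‖kernelAux B N u s‖ =
      ‖gaussC 1 (B⁻¹ *ᵥ s)‖ * ‖gaussC 1 (B *ᵥ (u + (2 * N : ℝ)⁻¹ • s))‖ := fun u s => by
    rw [kernelAux, norm_mul, norm_cis, one_mul, norm_mul]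
  have hg := integrable_gaussC_mulVec hdet one_pos
  refine ⟨Filter.Eventually.of_forall fun s => ?_, ?_⟩
  · have h1 : Integrable fun u => gaussC 1 (B *ᵥ (u + (2 * N : ℝ)⁻¹ • s)) :=
      hg.comp_add_right ((2 * N : ℝ)⁻¹ • s)
    refine (h1.norm.const_mul ‖gaussC 1 (B⁻¹ *ᵥ s)‖).mono' ?_
      (Filter.Eventually.of_forall fun u => (hn u s).le)
    exact ((continuous_kernelAux B N).comp
      (continuous_id.prodMk continuous_const)).aestronglyMeasurable
  · simp only [hn, integral_const_mul]
    have h2 : ∀ s : Phase d, ∫ u, ‖gaussC 1 (B *ᵥ (u + (2 * N : ℝ)⁻¹ • s))‖ =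
        ∫ u, ‖gaussC 1 (B *ᵥ u)‖ := fun s =>
      integral_add_right_eq_self (fun u => ‖gaussC 1 (B *ᵥ u)‖) ((2 * N : ℝ)⁻¹ • s)
    simp only [h2]
    exact (integrable_gaussC_mulVec (det_inv_ne_zero hdet) one_pos).norm.mul_const _

lemma integrable_kernel {B : PMat d ℝ} (hdet : B.det ≠ 0) (N : ℕ) : Integrable (kernel B N) :=
  (integrable_kernelAux hdet N).integral_prod_left.const_mul _

/-- The symbol of the smoothing as a Fourier multiplier. -/
def kernelHat (B : PMat d ℝ) (N : ℕ) (r : Phase d) : ℂ :=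
  ∫ u, cis (2 * Real.pi * symp u r) * kernel B N u

/-- By Fubini the u-integral is done first; recentring at u + s/2N makes it a Gaussian transform at
frequency r + s. This form, before the last Gaussian integral, is the one that exhibits positivity.
-/
lemma kernelHat_eq_integral {B : PMat d ℝ} (hB : SympSelfAdjoint B) (hdet : B.det ≠ 0)
    (hN : 1 ≤ N) (r : Phase d) :
    kernelHat B N r = ((2 ^ d * |B.det|⁻¹ : ℝ) : ℂ) * ∫ s : Phase d,
      cis (-(Real.pi / N * symp s r)) * (gaussC 1 (B⁻¹ *ᵥ s) * gaussC 1 (B⁻¹ *ᵥ (r + s))) := by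
  have h1 : kernelHat B N r =
      2 ^ d * ∫ u : Phase d, ∫ s : Phase d, cis (2 * Real.pi * symp u r) * kernelAux B N u s := by
    simp only [kernelHat, kernel, integral_const_mul]
    rw [← integral_const_mul]
    congr 1; ext u; ring
  have hint : Integrable (fun p : Phase d × Phase d =>
      cis (2 * Real.pi * symp p.1 r) * kernelAux B N p.1 p.2) (volume.prod volume) := by
    refine (integrable_kernelAux hdet N).norm.mono' ?_ (Filter.Eventually.of_forall fun p => by
      rw [norm_mul, norm_cis, one_mul])
    exact ((continuous_cis.comp (continuous_const.mul (continuous_symp continuous_fst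
      continuous_const))).mul (continuous_kernelAux B N)).aestronglyMeasurable
  rw [h1, integral_integral_swap hint]
  have hN' : (N : ℝ) ≠ 0 := by positivity
  have h2 : ∀ s : Phase d, ∫ u, cis (2 * Real.pi * symp u r) * kernelAux B N u s =
      ((|B.det|⁻¹ : ℝ) : ℂ) * (cis (-(Real.pi / N * symp s r)) *
        (gaussC 1 (B⁻¹ *ᵥ s) * gaussC 1 (B⁻¹ *ᵥ (r + s)))) := by
    intro s
    have h3 := integral_add_right_eq_self (μ := volume) (fun x : Phase d =>
      cis (2 * Real.pi * symp x (r + s)) * gaussC 1 (B *ᵥ x)) ((2 * N : ℝ)⁻¹ • s)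
    rw [integral_cis_symp_gaussC_mulVec hB hdet one_pos] at h3
    have h4 : ∀ u : Phase d, cis (2 * Real.pi * symp u r) * kernelAux B N u s =
        (cis (-(Real.pi / N * symp s r)) * gaussC 1 (B⁻¹ *ᵥ s)) *
        (cis (2 * Real.pi * symp (u + (2 * N : ℝ)⁻¹ • s) (r + s)) *
          gaussC 1 (B *ᵥ (u + (2 * N : ℝ)⁻¹ • s))) := by
      intro u
      have h5 : cis (2 * Real.pi * symp u r) * cis (2 * Real.pi * symp u s) =
          cis (-(Real.pi / N * symp s r)) *
            cis (2 * Real.pi * symp (u + (2 * N : ℝ)⁻¹ • s) (r + s)) := by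
        rw [← cis_add, ← cis_add]
        congr 1
        simp only [symp_add_left, symp_add_right, symp_smul_left, symp_self]
        field_simp
        ring
      rw [kernelAux, ← mul_assoc, h5]; ring
    simp only [h4, integral_const_mul, h3]
    simp
    ring
  simp only [h2, integral_const_mul]
  push_cast; ring

lemma kernelHat_eq {B : PMat d ℝ} (hB : SympSelfAdjoint B) (hdet : B.det ≠ 0)
    (hN : 1 ≤ N) (r : Phase d) :
    kernelHat B N r = gaussC (1 / 2) (B⁻¹ *ᵥ r) * gaussC (1 / 2) ((2 * N : ℝ)⁻¹ • (B *ᵥ r)) := by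
  have hN' : (N : ℝ) ≠ 0 := by positivity
  rw [kernelHat_eq_integral hB hdet hN]
  -- Centring at the midpoint s = t - r/2 completes the square: for v = B⁻¹r and τ = B⁻¹t, |τ -
  -- v/2|² + |τ + v/2|² = 2|τ|² + |v|²/2. The factor in r alone comes out, and the rest is the
  -- transform of a Gaussian of parameter 2.
  have h1 := integral_sub_right_eq_self (μ := volume) (fun s : Phase d =>
      cis (-(Real.pi / N * symp s r)) * (gaussC 1 (B⁻¹ *ᵥ s) * gaussC 1 (B⁻¹ *ᵥ (r + s))))
      ((1 / 2 : ℝ) • r)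
  rw [← h1]
  have h2 : ∀ t : Phase d, cis (-(Real.pi / N * symp (t - (1 / 2 : ℝ) • r) r)) *
      (gaussC 1 (B⁻¹ *ᵥ (t - (1 / 2 : ℝ) • r)) *
        gaussC 1 (B⁻¹ *ᵥ (r + (t - (1 / 2 : ℝ) • r)))) =
      gaussC (1 / 2) (B⁻¹ *ᵥ r) * (cis (2 * Real.pi * symp t (-(2 * N : ℝ)⁻¹ • r)) *
        gaussC 2 (B⁻¹ *ᵥ t)) := by
    intro t
    have h3 : gaussC 1 (B⁻¹ *ᵥ (t - (1 / 2 : ℝ) • r)) *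
        gaussC 1 (B⁻¹ *ᵥ (r + (t - (1 / 2 : ℝ) • r))) =
        gaussC (1 / 2) (B⁻¹ *ᵥ r) * gaussC 2 (B⁻¹ *ᵥ t) := by
      simp only [gaussC, ← Complex.ofReal_mul, ← Real.exp_add]
      congr 2
      have h4 : r + (t - (1 / 2 : ℝ) • r) = t + (1 / 2 : ℝ) • r := by
        ext i; simp; ring
      rw [h4]
      simp only [Matrix.mulVec_sub, Matrix.mulVec_add, Matrix.mulVec_smul, dotProduct_sub,
        sub_dotProduct, add_dotProduct, dotProduct_add, smul_dotProduct, dotProduct_smul,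
        smul_eq_mul]
      rw [dotProduct_comm (B⁻¹ *ᵥ r) (B⁻¹ *ᵥ t)]
      ring
    rw [h3]
    have h5 : -(Real.pi / N * symp (t - (1 / 2 : ℝ) • r) r) =
        2 * Real.pi * symp t (-(2 * N : ℝ)⁻¹ • r) := by
      simp only [symp_sub_left, symp_smul_left, symp_self, symp_smul_right]
      field_simp
      ring
    rw [h5]; ring
  simp only [h2, integral_const_mul]
  rw [integral_cis_symp_gaussC_mulVec (hB.inv hdet) (det_inv_ne_zero hdet) two_pos]
  have h6 : (B⁻¹)⁻¹ = B := Matrix.nonsing_inv_nonsing_inv B hdet.isUnit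
  have h7 : gaussC (2 : ℝ)⁻¹ (B *ᵥ (-(2 * N : ℝ)⁻¹ • r)) =
      gaussC (1 / 2) ((2 * N : ℝ)⁻¹ • (B *ᵥ r)) := by
    rw [neg_smul, Matrix.mulVec_neg, gaussC_neg, Matrix.mulVec_smul, one_div]
  rw [h6, h7, Matrix.det_nonsing_inv, Ring.inverse_eq_inv', abs_inv, inv_inv]
  have h8 : ((|B.det| : ℝ) : ℂ) ≠ 0 := by exact_mod_cast abs_ne_zero.2 hdet
  push_cast
  rw [inv_pow]
  field_simp

/-- Integrating first in w₁ is a Gaussian transform at frequency -2N w₂, because 2/ħ = 4πN. The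
substitution s = 2N w₂ then absorbs the prefactor (πħ)^{-2d} = (2N)^{2d}. -/
lemma moyal_gauss {B : PMat d ℝ} (hB : SympSelfAdjoint B) (hdet : B.det ≠ 0)
    (hN : 1 ≤ N) {c : ℝ} (hc : c ^ 2 = 2 ^ d * |B.det|) {G : Phase d → ℂ}
    (hG : ∀ w, G w = c * gaussC 1 (B *ᵥ w)) (ρ : Phase d) :
    moyal N G G ρ = kernel B N ρ := by
  have hN' : (0 : ℝ) < N := by positivity
  have e1 : 2 / hbar N = 4 * Real.pi * N := by
    unfold hbar; field_simp; ring
  have e2 : ((Real.pi * hbar N) ^ (2 * d))⁻¹ = (2 * N : ℝ) ^ (2 * d) := by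
    rw [← inv_pow]; congr 1; unfold hbar; field_simp
  have hGi : Integrable G := by
    have := (integrable_gaussC_mulVec hdet one_pos).const_mul (c : ℂ)
    exact this.congr (Filter.Eventually.of_forall fun w => (hG w).symm)
  have hGc : Continuous G := by
    have : G = fun w => c * gaussC 1 (B *ᵥ w) := funext hG
    rw [this]; exact continuous_const.mul (continuous_gaussC_mulVec 1 B)
  have hi : Integrable (fun w : Phase d × Phase d =>
      cis (-(2 / hbar N) * symp w.1 w.2) * G (ρ + w.1) * G (ρ + w.2)) (volume.prod volume) := by
    have h1 := (hGi.comp_add_left ρ).mul_prod (hGi.comp_add_left ρ)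
    refine h1.norm.mono' ?_ (Filter.Eventually.of_forall fun p => by
      rw [norm_mul, norm_mul, norm_cis, one_mul, norm_mul])
    have h2 : Continuous fun w : Phase d × Phase d => G (ρ + w.1) :=
      hGc.comp (continuous_const.add continuous_fst)
    have h3 : Continuous fun w : Phase d × Phase d => G (ρ + w.2) :=
      hGc.comp (continuous_const.add continuous_snd)
    exact (((continuous_cis.comp (continuous_const.mul
      (continuous_symp continuous_fst continuous_snd))).mul h2).mul h3).aestronglyMeasurable
  have h0 : moyal N G G ρ = ((((Real.pi * hbar N) ^ (2 * d))⁻¹ : ℝ) : ℂ) *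
      ∫ w : Phase d × Phase d, cis (-(2 / hbar N) * symp w.1 w.2) * G (ρ + w.1) * G (ρ + w.2)
        ∂(volume.prod volume) := by
    rw [moyal, Complex.ofReal_inv]; rfl
  have hinner : ∀ w₂ : Phase d, ∫ w₁ : Phase d,
      cis (-(2 / hbar N) * symp w₁ w₂) * G (ρ + w₁) * G (ρ + w₂) =
      ((c ^ 2 * |B.det|⁻¹ : ℝ) : ℂ) * kernelAux B N ρ ((2 * N : ℝ) • w₂) := by
    intro w₂
    have h3 := integral_add_left_eq_self (μ := volume) (fun x : Phase d =>
      cis (2 * Real.pi * symp x (-((2 * N : ℝ) • w₂))) * gaussC 1 (B *ᵥ x)) ρ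
    rw [integral_cis_symp_gaussC_mulVec hB hdet one_pos] at h3
    have h4 : ∀ w₁ : Phase d, cis (-(2 / hbar N) * symp w₁ w₂) * G (ρ + w₁) * G (ρ + w₂) =
        (c * G (ρ + w₂) * cis (2 * Real.pi * symp ρ ((2 * N : ℝ) • w₂))) *
        (cis (2 * Real.pi * symp (ρ + w₁) (-((2 * N : ℝ) • w₂))) * gaussC 1 (B *ᵥ (ρ + w₁))) := by
      intro w₁
      have h5 : cis (-(2 / hbar N) * symp w₁ w₂) = cis (2 * Real.pi * symp ρ ((2 * N : ℝ) • w₂)) *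
          cis (2 * Real.pi * symp (ρ + w₁) (-((2 * N : ℝ) • w₂))) := by
        rw [← cis_add, e1]
        congr 1
        simp only [symp_add_left, symp_neg_right, symp_smul_right]
        ring
      rw [h5, hG (ρ + w₁)]; ring
    simp only [h4, integral_const_mul, h3]
    have h6 : (2 * N : ℝ)⁻¹ • ((2 * N : ℝ) • w₂) = w₂ := by
      rw [smul_smul, inv_mul_cancel₀ (by positivity), one_smul]
    rw [kernelAux, h6, Matrix.mulVec_neg, gaussC_neg, hG]
    simp
    ring
  rw [h0, integral_prod_symm _ hi]
  simp only [hinner, integral_const_mul]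
  rw [Measure.integral_comp_smul volume (fun s => kernelAux B N ρ s) (2 * N : ℝ), e2, kernel]
  have h7 : Module.finrank ℝ (Phase d) = 2 * d := by simp; ring
  rw [h7, abs_of_pos (a := ((2 * N : ℝ) ^ (2 * d))⁻¹) (by positivity), Complex.real_smul, hc,
    mul_assoc (2 ^ d : ℝ), mul_inv_cancel₀ (abs_ne_zero.2 hdet), mul_one]
  have h8 : ((2 : ℂ) * N) ^ (2 * d) ≠ 0 := by
    exact_mod_cast (by positivity : (2 * N : ℝ) ^ (2 * d) ≠ 0)
  push_cast
  field_simp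

end CatMap

end

noncomputable section
namespace CatMap

open MeasureTheory

variable {d : ℕ} {N : ℕ} {κ : Phase d} {A : SpZ d}

/-! ### The dilation `B(ħ)` -/

/-- The diagonal entries of `D₁(ħ)`. -/
def Reduction.scale (S : Reduction A) (ε₀ : ℝ) (N : ℕ) : Fin d → ℝ :=
  Sum.elim (fun _ => hbar N ^ (-(ε₀ / (2 * lamMax A))))
    (fun s => hbar N ^ (-(S.lam s.1 / (2 * lamMax A)))) ∘ S.idx.symm

lemma Reduction.scale_pos (S : Reduction A) (ε₀ : ℝ) (hN : 1 ≤ N) (i : Fin d) :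
    0 < S.scale ε₀ N i := by
  unfold Reduction.scale
  have := hbar_pos hN
  simp only [Function.comp]
  rcases S.idx.symm i with x | x <;> simp only [Sum.elim_inl, Sum.elim_inr] <;>
    exact Real.rpow_pos_of_pos this _

lemma Reduction.B_eq (S : Reduction A) (ε₀ : ℝ) (N : ℕ) :
    S.B ε₀ N = (S.Q : PMat d ℝ) * Matrix.diagonal (Sum.elim (S.scale ε₀ N) (S.scale ε₀ N)) *
      ((S.Q⁻¹ : Matrix.symplecticGroup (Fin d) ℝ) : PMat d ℝ) := by
  rw [Reduction.B, Reduction.D₁, Matrix.reindex_apply, Matrix.submatrix_diagonal_equiv,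
    Matrix.fromBlocks_diagonal]
  rfl

lemma Reduction.Q_mul_inv (S : Reduction A) :
    (S.Q : PMat d ℝ) * ((S.Q⁻¹ : Matrix.symplecticGroup (Fin d) ℝ) : PMat d ℝ) = 1 :=
  congrArg Subtype.val (mul_inv_cancel S.Q)

lemma Reduction.inv_mul_Q (S : Reduction A) :
    ((S.Q⁻¹ : Matrix.symplecticGroup (Fin d) ℝ) : PMat d ℝ) * (S.Q : PMat d ℝ) = 1 :=
  congrArg Subtype.val (inv_mul_cancel S.Q)

/-- Conjugates by `Q` of diagonal matrices. -/
def Reduction.conjDiag (S : Reduction A) (v : Fin d → ℝ) : PMat d ℝ :=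
  (S.Q : PMat d ℝ) * Matrix.diagonal (Sum.elim v v) *
    ((S.Q⁻¹ : Matrix.symplecticGroup (Fin d) ℝ) : PMat d ℝ)

lemma Reduction.conjDiag_mul (S : Reduction A) (v w : Fin d → ℝ) :
    S.conjDiag v * S.conjDiag w = S.conjDiag (v * w) := by
  have h : (Sum.elim (v * w) (v * w) : Fin d ⊕ Fin d → ℝ) =
      fun i => Sum.elim v v i * Sum.elim w w i := by
    ext i; rcases i with i | i <;> rfl
  rw [Reduction.conjDiag, Reduction.conjDiag, Reduction.conjDiag, h, ← Matrix.diagonal_mul_diagonal]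
  calc _ = (S.Q : PMat d ℝ) * Matrix.diagonal (Sum.elim v v) *
        (((S.Q⁻¹ : Matrix.symplecticGroup (Fin d) ℝ) : PMat d ℝ) * (S.Q : PMat d ℝ)) *
        Matrix.diagonal (Sum.elim w w) *
        ((S.Q⁻¹ : Matrix.symplecticGroup (Fin d) ℝ) : PMat d ℝ) := by
        simp only [Matrix.mul_assoc]
    _ = _ := by rw [S.inv_mul_Q]; simp only [Matrix.mul_assoc, Matrix.one_mul]

lemma Reduction.conjDiag_one (S : Reduction A) : S.conjDiag 1 = 1 := by
  have h : (Sum.elim 1 1 : Fin d ⊕ Fin d → ℝ) = 1 := by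
    ext i; rcases i with i | i <;> rfl
  rw [Reduction.conjDiag, h,
    show Matrix.diagonal (1 : Fin d ⊕ Fin d → ℝ) = 1 from Matrix.diagonal_one, Matrix.mul_one, S.Q_mul_inv]

lemma Reduction.conjDiag_inv_mul (S : Reduction A) (ε₀ : ℝ) (hN : 1 ≤ N) :
    S.conjDiag (S.scale ε₀ N)⁻¹ * S.B ε₀ N = 1 := by
  rw [S.B_eq]
  change S.conjDiag _ * S.conjDiag _ = 1
  rw [S.conjDiag_mul, ← S.conjDiag_one]
  congr 1
  ext i
  exact inv_mul_cancel₀ (S.scale_pos ε₀ hN i).ne'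

lemma Reduction.B_inv (S : Reduction A) (ε₀ : ℝ) (hN : 1 ≤ N) :
    (S.B ε₀ N)⁻¹ = S.conjDiag (S.scale ε₀ N)⁻¹ :=
  Matrix.inv_eq_left_inv (S.conjDiag_inv_mul ε₀ hN)

lemma Reduction.det_B_ne_zero (S : Reduction A) (ε₀ : ℝ) (hN : 1 ≤ N) : (S.B ε₀ N).det ≠ 0 :=
  (Matrix.isUnit_det_of_left_inverse (S.conjDiag_inv_mul ε₀ hN)).ne_zero

lemma symp_diagonal (v : Fin d → ℝ) : SympSelfAdjoint (Matrix.diagonal (Sum.elim v v)) := by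
  intro a b
  simp only [symp_eq, dotProduct, Function.comp, Matrix.mulVec_diagonal, Sum.elim_inl, Sum.elim_inr]
  congr 1 <;> exact Finset.sum_congr rfl fun i _ => by ring

/-- The diagonal matrix scales x_i and ξ_i by the same factor, hence is self-adjoint for σ;
conjugation by the symplectic Q preserves this. -/
lemma Reduction.sympSelfAdjoint_B (S : Reduction A) (ε₀ : ℝ) (N : ℕ) :
    SympSelfAdjoint (S.B ε₀ N) := by
  intro u v
  have hQ := symp_mulVec (S.Q⁻¹).2
  rw [← hQ, ← hQ u, S.B_eq]
  simp only [Matrix.mulVec_mulVec, ← Matrix.mul_assoc, S.inv_mul_Q, Matrix.one_mul]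
  simp only [← Matrix.mulVec_mulVec]
  exact symp_diagonal _ _ _

lemma Reduction.moyal_gaussB (S : Reduction A) (ε₀ : ℝ) (hN : 1 ≤ N) (ρ : Phase d) :
    moyal N (fun w => (S.gaussB ε₀ N w : ℂ)) (fun w => (S.gaussB ε₀ N w : ℂ)) ρ =
      kernel (S.B ε₀ N) N ρ := by
  refine moyal_gauss (S.sympSelfAdjoint_B ε₀ N) (S.det_B_ne_zero ε₀ hN) hN
    (c := 2 ^ ((d : ℝ) / 2) * |(S.B ε₀ N).det| ^ (1 / 2 : ℝ)) ?_ (fun w => ?_) ρ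
  · rw [mul_pow, ← Real.rpow_natCast, ← Real.rpow_natCast, ← Real.rpow_mul two_pos.le,
      ← Real.rpow_mul (abs_nonneg _)]
    norm_num
  · rw [Reduction.gaussB, gaussC, gauss, neg_one_mul]
    push_cast; rfl

lemma norm_kernelHat_le {B : PMat d ℝ} (hB : SympSelfAdjoint B) (hdet : B.det ≠ 0)
    (hN : 1 ≤ N) (r : Phase d) : ‖kernelHat B N r‖ ≤ 1 := by
  rw [kernelHat_eq hB hdet hN, norm_mul]
  exact mul_le_one₀ (norm_gaussC_le (by norm_num) _) (norm_nonneg _)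
    (norm_gaussC_le (by norm_num) _)

lemma kernelHat_zero {B : PMat d ℝ} (hB : SympSelfAdjoint B) (hdet : B.det ≠ 0)
    (hN : 1 ≤ N) : kernelHat B N 0 = 1 := by
  rw [kernelHat_eq hB hdet hN]
  simp [gaussC]

/-- Convolution with an integrable kernel multiplies each character by the kernel's symplectic
Fourier transform. -/
lemma HasTrigSeries.smoothed {ι : Type*} [Countable ι] {b : ι → ℂ} {r : ι → Fin d ⊕ Fin d → ℤ}
    {a : Phase d → ℂ} (h : HasTrigSeries b r a) (S : Reduction A) (ε₀ : ℝ) (hN : 1 ≤ N) :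
    HasTrigSeries (fun i => b i * kernelHat (S.B ε₀ N) N (intPt (r i))) r (S.smoothed ε₀ N a) := by
  have hB := S.sympSelfAdjoint_B ε₀ N
  have hdet := S.det_B_ne_zero ε₀ hN
  refine ⟨Summable.of_nonneg_of_le (fun _ => norm_nonneg _) (fun i => ?_) h.summable, fun ρ => ?_⟩
  · rw [norm_mul]
    exact mul_le_of_le_one_right (norm_nonneg _) (norm_kernelHat_le hB hdet hN _)
  have hK := integrable_kernel hdet N
  have h1 : S.smoothed ε₀ N a ρ = ∫ u : Phase d, a (ρ - u) * kernel (S.B ε₀ N) N u := by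
    rw [Reduction.smoothed, ← integral_sub_left_eq_self _ volume ρ]
    refine integral_congr_ae (Filter.Eventually.of_forall fun u => ?_)
    simp only [sub_sub_cancel, S.moyal_gaussB ε₀ hN]
  have h2 : ∀ u : Phase d, a (ρ - u) * kernel (S.B ε₀ N) N u =
      ∑' i, b i * chr (r i) ρ * (cis (2 * Real.pi * symp u (intPt (r i))) *
        kernel (S.B ε₀ N) N u) := by
    intro u
    rw [← (h.hasSum (ρ - u)).tsum_eq, ← tsum_mul_right]
    refine tsum_congr fun i => ?_
    have h3 : (chr (r i) (ρ - u) : ℂ) = chr (r i) ρ * cis (2 * Real.pi * symp u (intPt (r i))) := by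
      rw [chr, chr, ← cis_add, symp_sub_left]; ring_nf
    rw [h3]; ring
  have h4 := hasSum_integral_of_summable_integral_norm (μ := (volume : Measure (Phase d)))
    (F := fun i u => b i * chr (r i) ρ * (cis (2 * Real.pi * symp u (intPt (r i))) *
        kernel (S.B ε₀ N) N u)) ?_ ?_
  · rw [h1]
    simp only [h2]
    refine h4.congr_fun fun i => ?_
    rw [integral_const_mul, kernelHat]; ring
  · intro i
    refine Integrable.const_mul ?_ _
    refine hK.norm.mono' ?_ (Filter.Eventually.of_forall fun u => by
      rw [norm_mul, norm_cis, one_mul])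
    exact (continuous_cis.comp (continuous_const.mul
      (continuous_symp_left _))).aestronglyMeasurable.mul hK.1
  · have h5 : ∀ i, ∫ u : Phase d, ‖b i * chr (r i) ρ * (cis (2 * Real.pi * symp u (intPt (r i))) *
        kernel (S.B ε₀ N) N u)‖ = ‖b i‖ * ∫ u, ‖kernel (S.B ε₀ N) N u‖ := by
      intro i
      simp only [norm_mul, norm_chr, norm_cis, mul_one, one_mul]
      rw [integral_const_mul]
    simp only [h5]
    exact h.summable.mul_right _

/-- The positive quantization of a trigonometric series. -/
lemma HasTrigSeries.mu_eq {ι : Type*} [Countable ι] {b : ι → ℂ} {r : ι → Fin d ⊕ Fin d → ℤ}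
    {a : Phase d → ℝ} (h : HasTrigSeries b r fun ρ => (a ρ : ℂ)) (S : Reduction A) (ε₀ : ℝ)
    (hN : 1 ≤ N) {ψ : 𝓢'(Conf d, ℂ)} (hψ : ψ ∈ states N κ) :
    S.mu ε₀ N κ ψ a =
      (∑' i, b i * (kernelHat (S.B ε₀ N) N (intPt (r i)) * expect N κ ψ (r i))).re := by
  rw [Reduction.mu, Reduction.opPos, (h.smoothed S ε₀ hN).stateInner_opWeyl hN hψ]
  simp only [mul_assoc]

lemma norm_stateInner_le {ψ ψ' : 𝓢'(Conf d, ℂ)} (h : stateInner N κ ψ ψ = 1)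
    (h' : stateInner N κ ψ' ψ' = 1) : ‖stateInner N κ ψ ψ'‖ ≤ 1 := by
  have e : ∀ φ : 𝓢'(Conf d, ℂ), stateInner N κ φ φ = 1 →
      (N : ℝ) ^ d * ∑ k : Fin d → Fin N, ‖coef N κ φ (toInt k)‖ ^ 2 = 1 := by
    intro φ hφ
    rw [stateInner_eq] at hφ
    simp only [← Complex.normSq_eq_conj_mul_self] at hφ
    simp only [← Complex.normSq_eq_norm_sq]
    exact_mod_cast hφ
  rw [stateInner_eq, norm_mul, norm_pow, Complex.norm_natCast]
  calc (N : ℝ) ^ d * ‖∑ k : Fin d → Fin N,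
        (starRingEnd ℂ) (coef N κ ψ (toInt k)) * coef N κ ψ' (toInt k)‖
      ≤ (N : ℝ) ^ d * ∑ k : Fin d → Fin N,
        (‖coef N κ ψ (toInt k)‖ ^ 2 + ‖coef N κ ψ' (toInt k)‖ ^ 2) / 2 := by
        gcongr
        refine norm_sum_le_of_le _ fun k _ => ?_
        rw [norm_mul, RCLike.norm_conj]
        nlinarith [sq_nonneg (‖coef N κ ψ (toInt k)‖ - ‖coef N κ ψ' (toInt k)‖)]
    _ = 1 := by
        rw [← Finset.sum_div, Finset.sum_add_distrib, mul_div_assoc', mul_add, e ψ h, e ψ' h']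
        norm_num

lemma norm_expect_le_one (hN : 1 ≤ N) {ψ : 𝓢'(Conf d, ℂ)} (hψ : ψ ∈ states N κ)
    (h1 : stateInner N κ ψ ψ = 1) (r : Fin d ⊕ Fin d → ℤ) : ‖expect N κ ψ r‖ ≤ 1 :=
  norm_stateInner_le h1 (by rw [stateInner_weyl hN hψ hψ, h1])

/-! ### Linearity of the positive quantization -/

/-- A representation over the common index set ℤ^{2d}, so that series of different functions can be
added. -/
lemma HasTrigSeries.fcoef {ι : Type*} [Countable ι] {b : ι → ℂ} {r : ι → Fin d ⊕ Fin d → ℤ}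
    {a : Phase d → ℂ} (h : HasTrigSeries b r a) : HasTrigSeries (fcoef a) id a := by
  refine ⟨h.summable_fcoef, fun ρ => ?_⟩
  rw [← (h.hasSum ρ).tsum_eq]
  exact h.hasSum_fcoef_mul (g := fun t => chr t ρ) (C := 1) fun t => (norm_chr t ρ).le

lemma HasTrigSeries.sum {ι J : Type*} {r : ι → Fin d ⊕ Fin d → ℤ} (s : Finset J) {b : J → ι → ℂ}
    {a : J → Phase d → ℂ} (h : ∀ j ∈ s, HasTrigSeries (b j) r (a j)) :
    HasTrigSeries (fun i => ∑ j ∈ s, b j i) r (fun ρ => ∑ j ∈ s, a j ρ) := by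
  refine ⟨?_, fun ρ => ?_⟩
  · exact Summable.of_nonneg_of_le (fun _ => norm_nonneg _) (fun i => norm_sum_le _ _)
      (summable_sum fun j hj => (h j hj).summable)
  · simp only [Finset.sum_mul]
    exact hasSum_sum fun j hj => (h j hj).hasSum ρ

lemma Wiener.mu_sum {J : Type*} (s : Finset J) {a : J → Phase d → ℝ}
    (h : ∀ j ∈ s, Wiener fun ρ => (a j ρ : ℂ)) (S : Reduction A) (ε₀ : ℝ)
    (hN : 1 ≤ N) {ψ : 𝓢'(Conf d, ℂ)} (hψ : ψ ∈ states N κ) :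
    S.mu ε₀ N κ ψ (fun ρ => ∑ j ∈ s, a j ρ) = ∑ j ∈ s, S.mu ε₀ N κ ψ (a j) := by
  have h1 : ∀ j ∈ s, HasTrigSeries (CatMap.fcoef fun ρ => (a j ρ : ℂ)) id fun ρ => (a j ρ : ℂ) := by
    intro j hj
    obtain ⟨ι, _, b, r, h⟩ := h j hj
    exact h.fcoef
  have h2 := HasTrigSeries.sum s h1
  simp only [← Complex.ofReal_sum] at h2
  obtain ⟨C, hC⟩ := norm_expect_le hN hψ
  rw [h2.mu_eq S ε₀ hN hψ, Finset.sum_congr rfl fun j hj => (h1 j hj).mu_eq S ε₀ hN hψ,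
    ← Complex.re_sum, ← Summable.tsum_finsetSum]
  · simp only [Finset.sum_mul]
  · intro j hj
    refine Summable.of_norm_bounded ((h1 j hj).summable.mul_right C) fun i => ?_
    rw [norm_mul, norm_mul]
    gcongr
    have := norm_kernelHat_le (S.sympSelfAdjoint_B ε₀ N) (S.det_B_ne_zero ε₀ hN) hN (intPt (id i))
    calc _ ≤ 1 * C := by gcongr; exact hC _
      _ = C := one_mul C

lemma Reduction.mu_one (S : Reduction A) (ε₀ : ℝ) (hN : 1 ≤ N) {ψ : 𝓢'(Conf d, ℂ)}
    (hψ : ψ ∈ states N κ) (h1 : stateInner N κ ψ ψ = 1) : S.mu ε₀ N κ ψ (fun _ => 1) = 1 := by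
  have h : HasTrigSeries (fun _ : Unit => (1 : ℂ)) (fun _ => (0 : Fin d ⊕ Fin d → ℤ))
      fun _ : Phase d => ((1 : ℝ) : ℂ) :=
    ⟨(hasSum_fintype _).summable, fun ρ => by simp [chr_zero]⟩
  rw [h.mu_eq S ε₀ hN hψ]
  simp [kernelHat_zero (S.sympSelfAdjoint_B ε₀ N) (S.det_B_ne_zero ε₀ hN) hN, expect, weyl_zero, h1]

end CatMap

end

noncomputable section
namespace CatMap

open MeasureTheory

variable {d : ℕ} {N : ℕ} {κ : Phase d} {A : SpZ d}

/-! ### Positivity of the quantization -/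

/-- The profile of the coherent decomposition of the smoothed translation by `r`. -/
def coherent (B : PMat d ℝ) (N : ℕ) (r t : Phase d) : ℂ :=
  cis (-(Real.pi / N * symp t r)) * gaussC 1 (B⁻¹ *ᵥ (r + t))

lemma conj_gaussC (b : ℝ) (x : Phase d) : (starRingEnd ℂ) (gaussC b x) = gaussC b x := by
  rw [gaussC, Complex.conj_ofReal]

/-- Shifting the integration variable by s separates r from s, up to a phase in σ(s, r) which makes
the multiplier a twisted positive-definite kernel. -/
lemma kernelHat_sub {B : PMat d ℝ} (hB : SympSelfAdjoint B) (hdet : B.det ≠ 0)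
    (hN : 1 ≤ N) (r s : Phase d) :
    kernelHat B N (r - s) = ((2 ^ d * |B.det|⁻¹ : ℝ) : ℂ) * (cis (-(Real.pi / N * symp s r)) *
      ∫ t : Phase d, coherent B N r t * (starRingEnd ℂ) (coherent B N s t)) := by
  rw [kernelHat_eq_integral hB hdet hN, ← integral_const_mul (cis _),
    ← integral_add_right_eq_self (μ := (volume : Measure (Phase d))) _ s]
  congr 1
  refine integral_congr_ae (Filter.Eventually.of_forall fun t => ?_)
  simp only
  have h1 : r - s + (t + s) = r + t := by abel
  have h2 : cis (-(Real.pi / N * symp (t + s) (r - s))) = cis (-(Real.pi / N * symp s r)) *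
      (cis (-(Real.pi / N * symp t r)) * cis (Real.pi / N * symp t s)) := by
    rw [← cis_add, ← cis_add]
    congr 1
    simp only [symp_add_left, symp_sub_right, symp_self]
    ring
  rw [h1, h2, coherent, coherent, map_mul, conj_cis, conj_gaussC, neg_neg, add_comm s t]
  ring

lemma integrable_coherent_mul {B : PMat d ℝ} (hdet : B.det ≠ 0) (N : ℕ) (r s : Phase d) :
    Integrable fun t : Phase d => coherent B N r t * (starRingEnd ℂ) (coherent B N s t) := by
  have hc : ∀ r, Continuous fun t : Phase d => coherent B N r t := fun r =>
    (continuous_cis.comp (continuous_const.mul (continuous_symp_left r)).neg).mul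
      ((continuous_gaussC_mulVec 1 B⁻¹).comp (continuous_const.add continuous_id))
  have h1 : Integrable fun t : Phase d => gaussC 1 (B⁻¹ *ᵥ (r + t)) :=
    (integrable_gaussC_mulVec (det_inv_ne_zero hdet) one_pos).comp_add_left r
  refine h1.norm.mono' ((hc r).mul (Complex.continuous_conj.comp (hc s))).aestronglyMeasurable
    (Filter.Eventually.of_forall fun t => ?_)
  rw [norm_mul, RCLike.norm_conj, coherent, coherent, norm_mul, norm_mul, norm_cis, norm_cis,
    one_mul, one_mul]
  exact mul_le_of_le_one_right (norm_nonneg _) (norm_gaussC_le one_pos _)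

lemma expect_sub (hN : 1 ≤ N) {ψ : 𝓢'(Conf d, ℂ)} (hψ : ψ ∈ states N κ)
    (r s : Fin d ⊕ Fin d → ℤ) :
    expect N κ ψ (r - s) = cis (Real.pi / N * symp (intPt s) (intPt r)) *
      stateInner N κ (weyl N s ψ) (weyl N r ψ) := by
  have h1 := weyl_weyl hN s (r - s) ψ
  rw [add_sub_cancel, intPt_sub, symp_sub_right, symp_self, sub_zero] at h1
  have h2 := stateInner_weyl hN hψ (weyl_mem_states hN hψ (r - s)) s
  rw [h1, stateInner_smul_right] at h2
  rw [expect, ← h2]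

/-- The expectation of a difference of translations carries the opposite twist, so the phases
cancel. What remains is a sum of integrals of f_r · conj f_s, a Gram kernel. -/
lemma kernelHat_mul_expect (S : Reduction A) (ε₀ : ℝ) (hN : 1 ≤ N) {ψ : 𝓢'(Conf d, ℂ)}
    (hψ : ψ ∈ states N κ) (r s : Fin d ⊕ Fin d → ℤ) :
    kernelHat (S.B ε₀ N) N (intPt (r - s)) * expect N κ ψ (r - s) =
      ((2 ^ d * |(S.B ε₀ N).det|⁻¹ * N ^ d : ℝ) : ℂ) * ∑ k : Fin d → Fin N, ∫ t : Phase d,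
        (coherent (S.B ε₀ N) N (intPt r) t * coef N κ (weyl N r ψ) (toInt k)) *
        (starRingEnd ℂ) (coherent (S.B ε₀ N) N (intPt s) t * coef N κ (weyl N s ψ) (toInt k)) := by
  rw [intPt_sub, kernelHat_sub (S.sympSelfAdjoint_B ε₀ N) (S.det_B_ne_zero ε₀ hN) hN,
    expect_sub hN hψ, stateInner_eq]
  have h1 := cis_neg_mul (Real.pi / N * symp (intPt s : Phase d) (intPt r))
  have h2 : ∀ k : Fin d → Fin N, ∫ t : Phase d,
        (coherent (S.B ε₀ N) N (intPt r) t * coef N κ (weyl N r ψ) (toInt k)) *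
        (starRingEnd ℂ) (coherent (S.B ε₀ N) N (intPt s) t * coef N κ (weyl N s ψ) (toInt k)) =
      (∫ t : Phase d, coherent (S.B ε₀ N) N (intPt r) t *
        (starRingEnd ℂ) (coherent (S.B ε₀ N) N (intPt s) t)) *
      ((starRingEnd ℂ) (coef N κ (weyl N s ψ) (toInt k)) * coef N κ (weyl N r ψ) (toInt k)) := by
    intro k
    rw [← integral_mul_const]
    congr 1; ext t
    rw [map_mul]; ring
  simp only [h2, ← Finset.mul_sum]
  push_cast
  linear_combination (2 ^ d * ((|(S.B ε₀ N).det| : ℝ) : ℂ)⁻¹ * (∫ t : Phase d, coherent (S.B ε₀ N) N (intPt r) t *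
        (starRingEnd ℂ) (coherent (S.B ε₀ N) N (intPt s) t)) * (N : ℂ) ^ d * ∑ k : Fin d → Fin N,
        (starRingEnd ℂ) (coef N κ (weyl N s ψ) (toInt k)) * coef N κ (weyl N r ψ) (toInt k)) * h1

lemma re_sum_kernelHat_mul_expect_nonneg (S : Reduction A) (ε₀ : ℝ) (hN : 1 ≤ N)
    {ψ : 𝓢'(Conf d, ℂ)} (hψ : ψ ∈ states N κ) {ι : Type*} (F : Finset ι) (b : ι → ℂ)
    (r : ι → Fin d ⊕ Fin d → ℤ) :
    0 ≤ (∑ i ∈ F, ∑ j ∈ F, b i * (starRingEnd ℂ) (b j) *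
      (kernelHat (S.B ε₀ N) N (intPt (r i - r j)) * expect N κ ψ (r i - r j))).re := by
  set f : ι → (Fin d → Fin N) → Phase d → ℂ := fun i k t =>
    coherent (S.B ε₀ N) N (intPt (r i)) t * coef N κ (weyl N (r i) ψ) (toInt k) with hf
  have hint : ∀ i j k, Integrable fun t => f i k t * (starRingEnd ℂ) (f j k t) := by
    intro i j k
    refine ((integrable_coherent_mul (S.det_B_ne_zero ε₀ hN) N (intPt (r i))
      (intPt (r j))).mul_const (coef N κ (weyl N (r i) ψ) (toInt k) *
        (starRingEnd ℂ) (coef N κ (weyl N (r j) ψ) (toInt k)))).congr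
      (Filter.Eventually.of_forall fun t => ?_)
    simp only [hf, map_mul]; ring
  have key : ∑ i ∈ F, ∑ j ∈ F, b i * (starRingEnd ℂ) (b j) *
      (kernelHat (S.B ε₀ N) N (intPt (r i - r j)) * expect N κ ψ (r i - r j)) =
      ((2 ^ d * |(S.B ε₀ N).det|⁻¹ * N ^ d : ℝ) : ℂ) * ∑ k : Fin d → Fin N, ∫ t : Phase d,
        ((Complex.normSq (∑ i ∈ F, b i * f i k t) : ℝ) : ℂ) := by
    have h1 : ∀ k, ∫ t : Phase d, ((Complex.normSq (∑ i ∈ F, b i * f i k t) : ℝ) : ℂ) =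
        ∑ i ∈ F, ∑ j ∈ F, b i * (starRingEnd ℂ) (b j) *
          ∫ t, f i k t * (starRingEnd ℂ) (f j k t) := by
      intro k
      have e : ∀ t, ((Complex.normSq (∑ i ∈ F, b i * f i k t) : ℝ) : ℂ) = ∑ i ∈ F, ∑ j ∈ F,
          b i * (starRingEnd ℂ) (b j) * (f i k t * (starRingEnd ℂ) (f j k t)) := by
        intro t
        rw [Complex.normSq_eq_conj_mul_self, mul_comm, map_sum, Finset.sum_mul_sum]
        refine Finset.sum_congr rfl fun i _ => Finset.sum_congr rfl fun j _ => ?_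
        rw [map_mul]; ring
      simp only [e]
      rw [integral_finsetSum _ fun i _ => integrable_finsetSum _ fun j _ =>
        (hint i j k).const_mul _]
      refine Finset.sum_congr rfl fun i _ => ?_
      rw [integral_finsetSum _ fun j _ => (hint i j k).const_mul _]
      exact Finset.sum_congr rfl fun j _ => integral_const_mul _ _
    simp only [h1]
    conv_rhs => rw [Finset.sum_comm, Finset.mul_sum]
    refine Finset.sum_congr rfl fun i _ => ?_
    conv_rhs => rw [Finset.sum_comm, Finset.mul_sum]
    refine Finset.sum_congr rfl fun j _ => ?_
    rw [kernelHat_mul_expect S ε₀ hN hψ, ← Finset.mul_sum]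
    ring
  rw [key, Complex.re_ofReal_mul, Complex.re_sum]
  refine mul_nonneg (by positivity) (Finset.sum_nonneg fun k _ => ?_)
  rw [integral_complex_ofReal, Complex.ofReal_re]
  exact integral_nonneg fun t => Complex.normSq_nonneg _

lemma HasTrigSeries.mu_sq_nonneg {ι : Type*} [Countable ι] {b : ι → ℂ} {r : ι → Fin d ⊕ Fin d → ℤ}
    {a : Phase d → ℝ} (h : HasTrigSeries b r fun ρ => (a ρ : ℂ)) (S : Reduction A) (ε₀ : ℝ)
    (hN : 1 ≤ N) {ψ : 𝓢'(Conf d, ℂ)} (hψ : ψ ∈ states N κ) :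
    0 ≤ S.mu ε₀ N κ ψ fun ρ => a ρ ^ 2 := by
  have h2 : HasTrigSeries (fun i : ι × ι => b i.1 * (starRingEnd ℂ) (b i.2))
      (fun i => r i.1 + -r i.2) fun ρ => ((a ρ ^ 2 : ℝ) : ℂ) := by
    have := h.mul h.conj
    simpa only [Complex.conj_ofReal, Complex.ofReal_pow, ← pow_two] using this
  obtain ⟨C, hC⟩ := norm_expect_le hN hψ
  rw [h2.mu_eq S ε₀ hN hψ]
  have hs : Summable fun i : ι × ι => b i.1 * (starRingEnd ℂ) (b i.2) *
      (kernelHat (S.B ε₀ N) N (intPt (r i.1 + -r i.2)) * expect N κ ψ (r i.1 + -r i.2)) := by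
    refine Summable.of_norm_bounded (h2.summable.mul_right C) fun i => ?_
    rw [norm_mul, norm_mul (kernelHat _ _ _)]
    gcongr
    have := norm_kernelHat_le (S.sympSelfAdjoint_B ε₀ N) (S.det_B_ne_zero ε₀ hN) hN
      (intPt (r i.1 + -r i.2))
    calc _ ≤ 1 * C := by gcongr; exact hC _
      _ = C := one_mul C
  -- Positivity is known on square index sets F × F only, and these are cofinal among finite sets of
  -- pairs.
  have h3 := (Complex.continuous_re.tendsto _).comp (hs.hasSum.comp
    (Filter.tendsto_finsetProd_atTop.comp Filter.tendsto_atTop_diagonal))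
  refine ge_of_tendsto' h3 fun F => ?_
  have := re_sum_kernelHat_mul_expect_nonneg S ε₀ hN hψ F b r
  simpa only [Function.comp, Finset.sum_product, sub_eq_add_neg] using this

end CatMap

end

noncomputable section
namespace CatMap

/-! ### Growth of matrix powers -/

section Growth

variable {n : Type*} [Fintype n] [DecidableEq n]

lemma mem_spectrum_iff_exists_mulVec {X : Matrix n n ℂ} {z : ℂ} :
    z ∈ spectrum ℂ X ↔ ∃ v : n → ℂ, v ≠ 0 ∧ X *ᵥ v = z • v := by
  rw [← Matrix.spectrum_toLin', ← Module.End.hasEigenvalue_iff_mem_spectrum]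
  constructor
  · intro h
    obtain ⟨v, hv⟩ := h.exists_hasEigenvector
    exact ⟨v, hv.2, by simpa using hv.apply_eq_smul⟩
  · rintro ⟨v, hv, h⟩
    exact Module.End.hasEigenvalue_of_hasEigenvector
      (Module.End.hasEigenvector_iff.2 ⟨Module.End.mem_eigenspace_iff.2 (by simpa using h), hv⟩)

-- Gelfand's formula bounds all large powers; the finitely many others are absorbed in the constant.
-- The loss η covers Jordan blocks.
open scoped Matrix.Norms.Operator in
lemma exists_norm_pow_apply_le {X : Matrix n n ℂ} {g η : ℝ} (hη : 0 < η)
    (h : ∀ z ∈ spectrum ℂ X, ‖z‖ ≤ Real.exp g) :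
    ∃ C, 0 ≤ C ∧ ∀ (k : ℕ) (i j : n), ‖(X ^ k) i j‖ ≤ C * Real.exp ((g + η) * k) := by
  have hs : spectralRadius ℂ X < ENNReal.ofReal (Real.exp (g + η)) := by
    refine lt_of_le_of_lt (b := ENNReal.ofReal (Real.exp g)) ?_ ?_
    · refine iSup₂_le fun z hz => ?_
      rw [← enorm_eq_nnnorm, ← ofReal_norm]
      exact ENNReal.ofReal_le_ofReal (h z hz)
    · rw [ENNReal.ofReal_lt_ofReal_iff (Real.exp_pos _)]
      exact Real.exp_lt_exp.2 (by linarith)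
  have h1 := (spectrum.pow_norm_pow_one_div_tendsto_nhds_spectralRadius X).eventually
    (gt_mem_nhds hs)
  obtain ⟨k₀, hk₀⟩ := Filter.eventually_atTop.1 h1
  have hentry : ∀ (Y : Matrix n n ℂ) (i j : n), ‖Y i j‖ ≤ ‖Y‖ := by
    intro Y i j
    have h2 : ‖Y i j‖₊ ≤ ‖Y‖₊ := by
      rw [Matrix.linfty_opNNNorm_def]
      exact (Finset.single_le_sum (f := fun j => ‖Y i j‖₊) (fun _ _ => zero_le)
        (Finset.mem_univ j)).trans
        (Finset.le_sup (f := fun i => ∑ j, ‖Y i j‖₊) (Finset.mem_univ i))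
    exact_mod_cast h2
  have hC : ∀ k : ℕ, ‖X ^ k‖ ≤ (1 + ∑ l ∈ Finset.range (k₀ + 1), ‖X ^ l‖ * Real.exp (-((g + η) * l))) *
      Real.exp ((g + η) * k) := by
    intro k
    have hnn : ∀ l ∈ Finset.range (k₀ + 1), 0 ≤ ‖X ^ l‖ * Real.exp (-((g + η) * l)) :=
      fun l _ => by positivity
    by_cases hk : k ≤ k₀
    · have h3 := Finset.single_le_sum hnn (Finset.mem_range.2 (Nat.lt_succ_of_le hk))
      calc ‖X ^ k‖ = ‖X ^ k‖ * Real.exp (-((g + η) * k)) * Real.exp ((g + η) * k) := by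
            rw [mul_assoc, ← Real.exp_add]; simp
        _ ≤ _ := by gcongr; linarith
    · have hk' : k₀ ≤ k := by omega
      have h3 := hk₀ k hk'
      have hkpos : (0 : ℝ) < k := by
        have : 0 < k := by omega
        exact_mod_cast this
      rw [ENNReal.ofReal_lt_ofReal_iff (Real.exp_pos _)] at h3
      have h4 : ‖X ^ k‖ ≤ Real.exp ((g + η) * k) := by
        calc ‖X ^ k‖ = (‖X ^ k‖ ^ (1 / k : ℝ)) ^ (k : ℝ) := by
              rw [← Real.rpow_mul (norm_nonneg _), one_div, inv_mul_cancel₀ hkpos.ne', Real.rpow_one]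
          _ ≤ Real.exp (g + η) ^ (k : ℝ) := by
              gcongr
          _ = _ := by rw [← Real.exp_mul]
      calc ‖X ^ k‖ ≤ 1 * Real.exp ((g + η) * k) := by rw [one_mul]; exact h4
        _ ≤ _ := by
          gcongr
          have := Finset.sum_nonneg hnn
          linarith
  exact ⟨_, by positivity, fun k i j => (hentry _ i j).trans (hC k)⟩

/-- The projection on a block of coordinates. -/
def blockProj {β : Type*} [DecidableEq β] (R : Type*) [Zero R] [One R] (blk : n → β) (b : β) :
    Matrix n n R :=
  Matrix.diagonal fun i => if blk i = b then 1 else 0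

/-- The projection on block b commutes with X, so row i of X^k is a row of (P_b X)^k with b the
block of i. Each row thus grows at the rate of its own block. -/
lemma exists_norm_pow_apply_le_block {β : Type*} [Fintype β] [DecidableEq β] {blk : n → β}
    {X : Matrix n n ℂ} {g : β → ℝ} {η : ℝ} (hη : 0 < η)
    (hX : ∀ b, Commute (blockProj ℂ blk b) X)
    (h : ∀ b (z : ℂ) (v : n → ℂ), v ≠ 0 → (∀ i, blk i ≠ b → v i = 0) → X *ᵥ v = z • v →
      ‖z‖ ≤ Real.exp (g b)) :
    ∃ C, 0 ≤ C ∧ ∀ (k : ℕ) (i j : n), ‖(X ^ k) i j‖ ≤ C * Real.exp ((g (blk i) + η) * k) := by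
  have h1 : ∀ b, ∃ C, 0 ≤ C ∧ ∀ (k : ℕ) (i j : n), ‖((blockProj ℂ blk b * X) ^ k) i j‖ ≤
      C * Real.exp ((g b + η) * k) := by
    intro b
    refine exists_norm_pow_apply_le hη fun z hz => ?_
    obtain ⟨v, hv, hzv⟩ := mem_spectrum_iff_exists_mulVec.1 hz
    -- Compressing to a block introduces the spurious eigenvalue 0; every other eigenvector is
    -- supported in the block.
    by_cases hz0 : z = 0
    · rw [hz0, norm_zero]; exact (Real.exp_pos _).le
    have hsupp : ∀ i, blk i ≠ b → v i = 0 := by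
      intro i hi
      have h2 := congrFun hzv i
      rw [← Matrix.mulVec_mulVec, blockProj, Matrix.mulVec_diagonal, if_neg hi, zero_mul,
        Pi.smul_apply, smul_eq_mul] at h2
      exact (mul_eq_zero.1 h2.symm).resolve_left hz0
    refine h b z v hv hsupp ?_
    rw [(hX b).eq, ← Matrix.mulVec_mulVec] at hzv
    have h3 : blockProj ℂ blk b *ᵥ v = v := by
      ext i
      rw [blockProj, Matrix.mulVec_diagonal]
      split_ifs with hi
      · rw [one_mul]
      · rw [hsupp i hi, mul_zero]
    rwa [h3] at hzv
  choose C hC0 hC using h1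
  have hb : ∀ i, C (blk i) ≤ 1 + ∑ b, C b := fun i => by
    have := Finset.single_le_sum (fun b _ => hC0 b) (Finset.mem_univ (blk i))
    linarith
  refine ⟨1 + ∑ b, C b, by have := Finset.sum_nonneg fun b (_ : b ∈ Finset.univ) => hC0 b; linarith,
    fun k i j => ?_⟩
  -- The power k = 0 is separate because P^0 = 1 is not P; the summand 1 in the constant covers it.
  rcases Nat.eq_zero_or_pos k with rfl | hk
  · have := Finset.sum_nonneg fun b (_ : b ∈ Finset.univ) => hC0 b
    rw [pow_zero, Nat.cast_zero, mul_zero, Real.exp_zero, mul_one, Matrix.one_apply]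
    split_ifs
    · simpa using this
    · simp; linarith
  · have hidem : blockProj ℂ blk (blk i) * blockProj ℂ blk (blk i) = blockProj ℂ blk (blk i) := by
      rw [blockProj, Matrix.diagonal_mul_diagonal]
      congr 1; ext j; split_ifs <;> simp
    have hp : ∀ k : ℕ, 0 < k → blockProj ℂ blk (blk i) ^ k = blockProj ℂ blk (blk i) := by
      intro k hk
      exact IsIdempotentElem.pow_eq (show IsIdempotentElem _ from hidem) hk.ne'
    have h2 := hC (blk i) k i j
    rw [(hX (blk i)).mul_pow, hp k hk, blockProj, Matrix.diagonal_mul, if_pos rfl, one_mul] at h2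
    exact h2.trans (mul_le_mul_of_nonneg_right (hb i) (Real.exp_pos _).le)

end Growth

end CatMap

end

noncomputable section
namespace CatMap

variable {d : ℕ} {A : SpZ d}

/-! ### Block structure of a reduction -/

lemma realMat_mul (A B : SpZ d) : realMat (A * B) = realMat A * realMat B := by
  rw [realMat, realMat, realMat]
  exact Matrix.map_mul (f := Int.castRingHom ℝ)

lemma realMat_one : realMat (1 : SpZ d) = 1 :=
  Matrix.map_one _ Int.cast_zero Int.cast_one

namespace Reduction

variable (S : Reduction A)

/-- The coordinates in which the reduction is a block matrix. -/
abbrev Idx : Type :=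
  (Fin S.d₀ ⊕ (Σ i, Fin (S.dim i))) ⊕ (Fin S.d₀ ⊕ (Σ i, Fin (S.dim i)))

/-- The identification of the coordinates of phase space. -/
def idx₂ : S.Idx ≃ Fin d ⊕ Fin d := Equiv.sumCongr S.idx S.idx

/-- The block of a coordinate of `ℝ^d`, with `none` for the neutral block. -/
def blk₁ : Fin S.d₀ ⊕ (Σ i, Fin (S.dim i)) → Option (Fin S.r) :=
  Sum.elim (fun _ => none) fun s => some s.1

/-- The block of a coordinate of phase space. -/
def blk : S.Idx → Option (Fin S.r) := Sum.elim S.blk₁ S.blk₁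

/-- The matrix of a symplectic map in the coordinates of the reduction. -/
def inCoords : SpZ d →* Matrix S.Idx S.Idx ℝ where
  toFun g := (Matrix.reindex S.idx₂ S.idx₂).symm
    (((S.Q⁻¹ : Matrix.symplecticGroup (Fin d) ℝ) : PMat d ℝ) * realMat g * (S.Q : PMat d ℝ))
  map_one' := by
    rw [realMat_one, Matrix.mul_one, S.inv_mul_Q]
    simp
  map_mul' g h := by
    have e : ((S.Q⁻¹ : Matrix.symplecticGroup (Fin d) ℝ) : PMat d ℝ) * realMat (g * h) *
        (S.Q : PMat d ℝ) = (((S.Q⁻¹ : Matrix.symplecticGroup (Fin d) ℝ) : PMat d ℝ) * realMat g *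
          (S.Q : PMat d ℝ)) * (((S.Q⁻¹ : Matrix.symplecticGroup (Fin d) ℝ) : PMat d ℝ) * realMat h *
          (S.Q : PMat d ℝ)) := by
      calc _ = ((S.Q⁻¹ : Matrix.symplecticGroup (Fin d) ℝ) : PMat d ℝ) * realMat g *
            ((S.Q : PMat d ℝ) * ((S.Q⁻¹ : Matrix.symplecticGroup (Fin d) ℝ) : PMat d ℝ)) *
            realMat h * (S.Q : PMat d ℝ) := by
            rw [S.Q_mul_inv, realMat_mul]; simp only [Matrix.mul_assoc, Matrix.one_mul]
        _ = _ := by simp only [Matrix.mul_assoc]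
    rw [e, Matrix.reindex_symm, Matrix.reindex_apply, Matrix.reindex_apply, Matrix.reindex_apply,
      Matrix.submatrix_mul_equiv]

/-- The block matrix of the reduction. -/
def blockMat : Matrix S.Idx S.Idx ℝ :=
  diamond (S.A₀ : Matrix (Fin S.d₀ ⊕ Fin S.d₀) (Fin S.d₀ ⊕ Fin S.d₀) ℝ)
    (Matrix.fromBlocks
      (Matrix.blockDiagonal' fun i => (S.D i : Matrix (Fin (S.dim i)) (Fin (S.dim i)) ℝ)) 0 0
      (Matrix.blockDiagonal' fun i =>
        (((S.D i)⁻¹ : GL (Fin (S.dim i)) ℝ) : Matrix (Fin (S.dim i)) (Fin (S.dim i)) ℝ)ᵀ))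

lemma inCoords_self : S.inCoords A = S.blockMat := by
  change (Matrix.reindex S.idx₂ S.idx₂).symm _ = _
  rw [Equiv.symm_apply_eq, S.conj_eq]
  calc _ = (((S.Q⁻¹ : Matrix.symplecticGroup (Fin d) ℝ) : PMat d ℝ) * (S.Q : PMat d ℝ)) *
        Matrix.reindex S.idx₂ S.idx₂ S.blockMat *
        (((S.Q⁻¹ : Matrix.symplecticGroup (Fin d) ℝ) : PMat d ℝ) * (S.Q : PMat d ℝ)) := by
        simp only [Matrix.mul_assoc]; rfl
    _ = _ := by rw [S.inv_mul_Q, Matrix.one_mul, Matrix.mul_one]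

lemma blockMat_eq_zero {p q : S.Idx} (h : S.blk p ≠ S.blk q) : S.blockMat p q = 0 := by
  rcases p with (p | ⟨p, a⟩) | (p | ⟨p, a⟩) <;> rcases q with (q | ⟨q, b⟩) | (q | ⟨q, b⟩) <;>
    simp [blk, blk₁, blockMat, diamond] at h ⊢ <;>
    exact Matrix.blockDiagonal'_apply_ne _ _ _ h

/-- The complexified block matrix. -/
def blockMatC : Matrix S.Idx S.Idx ℂ := Complex.ofRealHom.mapMatrix S.blockMat

lemma blockMatC_mulVec_inl (v : S.Idx → ℂ) (p : Fin S.d₀ ⊕ Fin S.d₀) :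
    (S.blockMatC *ᵥ v) (Sum.map Sum.inl Sum.inl p) =
      ((S.A₀ : Matrix (Fin S.d₀ ⊕ Fin S.d₀) (Fin S.d₀ ⊕ Fin S.d₀) ℝ).map (Complex.ofReal : ℝ → ℂ)
        *ᵥ fun q => v (Sum.map Sum.inl Sum.inl q)) p := by
  rcases p with p | p <;>
    simp [Matrix.mulVec, dotProduct, blockMatC, blockMat, diamond, Fintype.sum_sum_type,
      Matrix.toBlocks₁₁, Matrix.toBlocks₁₂, Matrix.toBlocks₂₁, Matrix.toBlocks₂₂]

lemma blockMatC_mulVec_unstable (v : S.Idx → ℂ) (i : Fin S.r) (a : Fin (S.dim i)) :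
    (S.blockMatC *ᵥ v) (Sum.inl (Sum.inr ⟨i, a⟩)) =
      ((S.D i : Matrix (Fin (S.dim i)) (Fin (S.dim i)) ℝ).map (Complex.ofReal : ℝ → ℂ)
        *ᵥ fun b => v (Sum.inl (Sum.inr ⟨i, b⟩))) a := by
  simp only [Matrix.mulVec, dotProduct, blockMatC, blockMat, diamond, Fintype.sum_sum_type,
    Fintype.sum_sigma]
  simp
  rw [Finset.sum_eq_single i]
  · simp [Matrix.blockDiagonal'_apply_eq]
  · intro j _ hj
    refine Finset.sum_eq_zero fun b _ => ?_
    rw [Matrix.blockDiagonal'_apply_ne _ _ _ hj.symm]; simp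
  · simp

lemma blockMatC_mulVec_stable (v : S.Idx → ℂ) (i : Fin S.r) (a : Fin (S.dim i)) :
    (S.blockMatC *ᵥ v) (Sum.inr (Sum.inr ⟨i, a⟩)) =
      (((((S.D i)⁻¹ : GL (Fin (S.dim i)) ℝ) : Matrix (Fin (S.dim i)) (Fin (S.dim i)) ℝ)ᵀ).map
        (Complex.ofReal : ℝ → ℂ) *ᵥ fun b => v (Sum.inr (Sum.inr ⟨i, b⟩))) a := by
  simp only [Matrix.mulVec, dotProduct, blockMatC, blockMat, diamond, Fintype.sum_sum_type,
    Fintype.sum_sigma]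
  simp
  rw [Finset.sum_eq_single i]
  · simp [Matrix.blockDiagonal'_apply_eq]
  · intro j _ hj
    refine Finset.sum_eq_zero fun b _ => ?_
    rw [Matrix.blockDiagonal'_apply_ne _ _ _ hj.symm]; simp
  · simp

/-- The exponent of a block. -/
def rate : Option (Fin S.r) → ℝ := fun b => b.elim 0 S.lam

/-- In a hyperbolic block either the position part is an eigenvector of D_i, or it vanishes and the
momentum part is an eigenvector of (D_iᵀ)⁻¹, so that 1/z lies in the spectrum of D_i. -/
lemma norm_eigenvalue {b : Option (Fin S.r)} {z : ℂ} {v : S.Idx → ℂ} (hv : v ≠ 0)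
    (hb : ∀ p, S.blk p ≠ b → v p = 0) (h : S.blockMatC *ᵥ v = z • v) :
    ‖z‖ = Real.exp (S.rate b) ∨ ‖z‖ = Real.exp (-S.rate b) := by
  rcases b with _ | i
  · left
    have h1 : (fun q => v (Sum.map Sum.inl Sum.inl q) : Fin S.d₀ ⊕ Fin S.d₀ → ℂ) ≠ 0 := by
      intro h0
      apply hv
      ext p
      rcases p with (p | p) | (p | p)
      · exact congrFun h0 (Sum.inl p)
      · exact hb _ (by simp [blk, blk₁])
      · exact congrFun h0 (Sum.inr p)
      · exact hb _ (by simp [blk, blk₁])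
    have h2 := S.A₀_spec z (mem_spectrum_iff_exists_mulVec.2 ⟨_, h1, by
      ext p
      rw [← S.blockMatC_mulVec_inl, h]; rfl⟩)
    simpa [rate] using h2
  · by_cases hx : (fun b => v (Sum.inl (Sum.inr ⟨i, b⟩)) : Fin (S.dim i) → ℂ) = 0
    · right
      have hξ : (fun b => v (Sum.inr (Sum.inr ⟨i, b⟩)) : Fin (S.dim i) → ℂ) ≠ 0 := by
        intro h0
        apply hv
        ext p
        rcases p with (p | ⟨p, a⟩) | (p | ⟨p, a⟩)
        · exact hb _ (by simp [blk, blk₁])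
        · by_cases hp : p = i
          · subst hp; exact congrFun hx a
          · exact hb _ (by simpa [blk, blk₁] using hp)
        · exact hb _ (by simp [blk, blk₁])
        · by_cases hp : p = i
          · subst hp; exact congrFun h0 a
          · exact hb _ (by simpa [blk, blk₁] using hp)
      set ξ : Fin (S.dim i) → ℂ := fun b => v (Sum.inr (Sum.inr ⟨i, b⟩))
      set Dc : Matrix (Fin (S.dim i)) (Fin (S.dim i)) ℂ :=
        (S.D i : Matrix (Fin (S.dim i)) (Fin (S.dim i)) ℝ).map (Complex.ofReal : ℝ → ℂ) with hDc
      have h2 : ((((S.D i)⁻¹ : GL (Fin (S.dim i)) ℝ) :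
          Matrix (Fin (S.dim i)) (Fin (S.dim i)) ℝ)ᵀ).map (Complex.ofReal : ℝ → ℂ) *ᵥ ξ = z • ξ := by
        ext a
        rw [← S.blockMatC_mulVec_stable, h]; rfl
      have h3 : Dcᵀ * ((((S.D i)⁻¹ : GL (Fin (S.dim i)) ℝ) :
          Matrix (Fin (S.dim i)) (Fin (S.dim i)) ℝ)ᵀ).map (Complex.ofReal : ℝ → ℂ) = 1 := by
        have e := congrArg (fun X => (Complex.ofRealHom.mapMatrix X)ᵀ)
          (congrArg Units.val (inv_mul_cancel (S.D i)))
        simp only [Units.val_mul, map_mul, Matrix.transpose_mul, Units.val_one, map_one,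
          Matrix.transpose_one] at e
        exact e
      have h4 : ξ = z • (Dcᵀ *ᵥ ξ) := by
        have := congrArg (fun w => Dcᵀ *ᵥ w) h2
        simpa only [Matrix.mulVec_mulVec, h3, Matrix.one_mulVec, Matrix.mulVec_smul] using this
      have hz : z ≠ 0 := by
        rintro rfl
        rw [zero_smul] at h4
        exact hξ h4
      have h5 : z⁻¹ ∈ spectrum ℂ Dcᵀ := mem_spectrum_iff_exists_mulVec.2 ⟨ξ, hξ, by
        conv_rhs => rw [h4, smul_smul, inv_mul_cancel₀ hz, one_smul]⟩
      rw [Matrix.mem_spectrum_iff_isRoot_charpoly, Matrix.charpoly_transpose,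
        ← Matrix.mem_spectrum_iff_isRoot_charpoly] at h5
      have h6 := S.D_spec i _ h5
      rw [norm_inv, inv_eq_iff_eq_inv, ← Real.exp_neg] at h6
      exact h6
    · left
      exact S.D_spec i z (mem_spectrum_iff_exists_mulVec.2 ⟨_, hx, by
        ext a
        rw [← S.blockMatC_mulVec_unstable, h]; rfl⟩)

lemma rate_nonneg (b : Option (Fin S.r)) : 0 ≤ S.rate b := by
  rcases b with _ | i
  · exact le_rfl
  · exact (S.lam_pos i).le

lemma commute_blockProj (b : Option (Fin S.r)) : Commute (blockProj ℂ S.blk b) S.blockMatC := by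
  ext p q
  rw [blockProj, Matrix.diagonal_mul, Matrix.mul_diagonal, mul_comm]
  by_cases h : S.blk p = S.blk q
  · rw [h]
  · have : S.blockMatC p q = 0 := by simp [blockMatC, S.blockMat_eq_zero h]
    rw [this, zero_mul, zero_mul]

/-- The moduli e^{λ} and e^{-λ} are exchanged by inversion and both at most e^{λ}, so the block
growth lemma applies to A and to A⁻¹ with the same rates. -/
lemma exists_inCoords_le {η : ℝ} (hη : 0 < η) : ∃ C, 0 ≤ C ∧ ∀ (j : ℤ) (p q : S.Idx),
    |S.inCoords (A ^ j) p q| ≤ C * Real.exp ((S.rate (S.blk p) + η) * j.natAbs) := by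
  have hmul : Complex.ofRealHom.mapMatrix (S.inCoords A⁻¹) * S.blockMatC = 1 := by
    rw [blockMatC, ← S.inCoords_self, ← map_mul, ← map_mul, inv_mul_cancel, map_one, map_one]
  have hmul' : S.blockMatC * Complex.ofRealHom.mapMatrix (S.inCoords A⁻¹) = 1 := by
    rw [blockMatC, ← S.inCoords_self, ← map_mul, ← map_mul, mul_inv_cancel, map_one, map_one]
  obtain ⟨C, hC0, hC⟩ := exists_norm_pow_apply_le_block (g := S.rate) hη S.commute_blockProj
    fun b z v hv hb h => by
      rcases S.norm_eigenvalue hv hb h with h1 | h1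
      · exact h1.le
      · rw [h1]; exact Real.exp_le_exp.2 (by linarith [S.rate_nonneg b])
  obtain ⟨C', hC0', hC'⟩ := exists_norm_pow_apply_le_block (g := S.rate)
    (X := Complex.ofRealHom.mapMatrix (S.inCoords A⁻¹)) (blk := S.blk) hη
    (fun b => by
      have h1 := (S.commute_blockProj b).eq
      have h2 := congrArg (fun X => Complex.ofRealHom.mapMatrix (S.inCoords A⁻¹) * X *
        Complex.ofRealHom.mapMatrix (S.inCoords A⁻¹)) h1
      simp only [← mul_assoc, hmul, one_mul] at h2
      rw [mul_assoc, mul_assoc, hmul', mul_one] at h2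
      exact h2.symm)
    fun b z v hv hb h => by
      have h1 : v = z • (S.blockMatC *ᵥ v) := by
        have := congrArg (fun w => S.blockMatC *ᵥ w) h
        simpa only [Matrix.mulVec_mulVec, hmul', Matrix.one_mulVec, Matrix.mulVec_smul] using this
      have hz : z ≠ 0 := by
        rintro rfl
        rw [zero_smul] at h1
        exact hv h1
      have h2 : S.blockMatC *ᵥ v = z⁻¹ • v := by
        conv_rhs => rw [h1, smul_smul, inv_mul_cancel₀ hz, one_smul]
      rcases S.norm_eigenvalue hv hb h2 with h3 | h3 <;>
        rw [norm_inv, inv_eq_iff_eq_inv, ← Real.exp_neg] at h3 <;> rw [h3] <;>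
        exact Real.exp_le_exp.2 (by linarith [S.rate_nonneg b])
  refine ⟨max C C', le_max_of_le_left hC0, fun j p q => ?_⟩
  have key : ∀ (g : SpZ d) (n : ℕ), ‖(Complex.ofRealHom.mapMatrix (S.inCoords g) ^ n) p q‖ =
      |S.inCoords (g ^ n) p q| := by
    intro g n
    rw [map_pow, ← map_pow]
    simp
  rcases Int.natAbs_eq j with hj | hj
  · have h1 := hC j.natAbs p q
    rw [blockMatC, ← S.inCoords_self, key, ← zpow_natCast, ← hj] at h1
    exact h1.trans (mul_le_mul_of_nonneg_right (le_max_left _ _) (Real.exp_pos _).le)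
  · have h1 := hC' j.natAbs p q
    rw [key, inv_pow, ← zpow_natCast, ← zpow_neg, ← hj] at h1
    exact h1.trans (mul_le_mul_of_nonneg_right (le_max_right _ _) (Real.exp_pos _).le)

end Reduction

end CatMap

end

noncomputable section
namespace CatMap

variable {d : ℕ} {N : ℕ} {A : SpZ d}

/-! ### The smoothing up to the Ehrenfest time -/

lemma mem_spec_iff (A : SpZ d) (z : ℂ) :
    z ∈ spec A ↔ ((realMat A).charpoly.map Complex.ofRealHom).IsRoot z := by
  have h : (A : PMat d ℤ).map (Int.cast : ℤ → ℂ) = Complex.ofRealHom.mapMatrix (realMat A) := by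
    ext i j; simp [realMat]
  rw [spec, Matrix.mem_spectrum_iff_isRoot_charpoly, h, RingHom.mapMatrix_apply, Matrix.charpoly_map]

lemma bddAbove_log_spec (A : SpZ d) :
    BddAbove ((fun β : ℂ => Real.log ‖β‖) '' spec A) := by
  refine Set.Finite.bddAbove (Set.Finite.image _ ?_)
  exact Matrix.finite_spectrum _

lemma lamMax_pos (hexp : ∃ β ∈ spec A, 1 < ‖β‖) : 0 < lamMax A := by
  obtain ⟨β, hβ, h1⟩ := hexp
  exact (Real.log_pos h1).trans_le (le_csSup (bddAbove_log_spec A) ⟨β, hβ, rfl⟩)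

namespace Reduction

lemma mem_spec_of_mulVec (S : Reduction A) {z : ℂ} {v : S.Idx → ℂ} (hv : v ≠ 0)
    (h : S.blockMatC *ᵥ v = z • v) : z ∈ spec A := by
  have h1 : z ∈ spectrum ℂ S.blockMatC := mem_spectrum_iff_exists_mulVec.2 ⟨v, hv, h⟩
  rw [Matrix.mem_spectrum_iff_isRoot_charpoly, blockMatC, RingHom.mapMatrix_apply,
    Matrix.charpoly_map] at h1
  have h2 : (realMat A).charpoly = S.blockMat.charpoly := by
    rw [S.conj_eq]
    rw [Matrix.charpoly_mul_comm, ← Matrix.mul_assoc, S.inv_mul_Q, Matrix.one_mul,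
      Matrix.charpoly_reindex]
    rfl
  rwa [mem_spec_iff, h2]

/-- An eigenvector of D_i extended by zero is an eigenvector of the whole matrix. This bound is what
keeps B(ħ)/2N under control. -/
lemma lam_le_lamMax (S : Reduction A) (i : Fin S.r) : S.lam i ≤ lamMax A := by
  have : Nonempty (Fin (S.dim i)) := ⟨⟨0, S.dim_pos i⟩⟩
  obtain ⟨z, hz⟩ := spectrum.nonempty_of_isAlgClosed_of_finiteDimensional ℂ
    ((S.D i : Matrix (Fin (S.dim i)) (Fin (S.dim i)) ℝ).map (Complex.ofReal : ℝ → ℂ))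
  obtain ⟨x, hx, hxz⟩ := mem_spectrum_iff_exists_mulVec.1 hz
  let v : S.Idx → ℂ := Sum.elim (Sum.elim (fun _ => 0)
    fun s => if h : s.1 = i then x (Fin.cast (congrArg S.dim h) s.2) else 0) fun _ => 0
  have hvi : (fun b => v (Sum.inl (Sum.inr ⟨i, b⟩))) = x := by
    ext b; simp [v]
  have h1 : S.blockMatC *ᵥ v = z • v := by
    ext p
    rcases p with (p | ⟨k, a⟩) | (p | ⟨k, a⟩)
    · have := S.blockMatC_mulVec_inl v (Sum.inl p)
      rw [Sum.map_inl] at this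
      rw [this]
      have h0 : (fun q => v (Sum.map Sum.inl Sum.inl q) : Fin S.d₀ ⊕ Fin S.d₀ → ℂ) = 0 := by
        ext q; rcases q with q | q <;> rfl
      rw [h0, Matrix.mulVec_zero]; simp [v]
    · rw [S.blockMatC_mulVec_unstable]
      by_cases hk : k = i
      · subst hk
        rw [hvi, hxz]; simp [v]
      · have h0 : (fun b => v (Sum.inl (Sum.inr ⟨k, b⟩))) = 0 := by
          ext b; simp [v, hk]
        rw [h0, Matrix.mulVec_zero]; simp [v, hk]
    · have := S.blockMatC_mulVec_inl v (Sum.inr p)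
      rw [Sum.map_inr] at this
      rw [this]
      have h0 : (fun q => v (Sum.map Sum.inl Sum.inl q) : Fin S.d₀ ⊕ Fin S.d₀ → ℂ) = 0 := by
        ext q; rcases q with q | q <;> rfl
      rw [h0, Matrix.mulVec_zero]; simp [v]
    · rw [S.blockMatC_mulVec_stable]
      have h0 : (fun b => v (Sum.inr (Sum.inr ⟨k, b⟩))) = 0 := by
        ext b; simp [v]
      rw [h0, Matrix.mulVec_zero]; simp [v]
  have hv : v ≠ 0 := by
    intro h0
    apply hx
    rw [← hvi, h0]; rfl
  refine le_csSup (bddAbove_log_spec A) ⟨z, S.mem_spec_of_mulVec hv h1, ?_⟩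
  simp only
  rw [S.D_spec i z hz, Real.log_exp]

/-- The exponent of the dilation on a block. -/
def dilRate (S : Reduction A) (ε₀ : ℝ) : Option (Fin S.r) → ℝ := fun b => b.elim ε₀ S.lam

lemma scale_eq (S : Reduction A) (ε₀ : ℝ) (N : ℕ) (i : Fin d) :
    S.scale ε₀ N i = hbar N ^ (-(S.dilRate ε₀ (S.blk₁ (S.idx.symm i)) / (2 * lamMax A))) := by
  rw [scale, Function.comp]
  rcases S.idx.symm i with p | p <;> rfl

end Reduction

lemma natAbs_le_ehrenfest (hL : 0 < lamMax A) {ε : ℝ} (hε' : ε < 1) (hN : 1 ≤ N) {n : ℕ}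
    (hn : n ≤ ehrenfest A ε N) : n * (2 * lamMax A) ≤ (1 - ε) * Real.log N := by
  have h1 : 0 ≤ (1 - ε) * Real.log N / (2 * lamMax A) := by
    have := Real.log_nonneg (show (1 : ℝ) ≤ N by exact_mod_cast hN)
    have : 0 ≤ 1 - ε := by linarith
    positivity
  have h2 := (Nat.le_floor_iff h1).1 hn
  rwa [le_div_iff₀ (by positivity)] at h2

lemma hbar_rpow (hN : 1 ≤ N) (t : ℝ) :
    hbar N ^ (-t) = Real.exp (t * (Real.log (2 * Real.pi) + Real.log N)) := by
  have h0 : (0 : ℝ) < N := by positivity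
  rw [Real.rpow_def_of_pos (hbar_pos hN), hbar, one_div, Real.log_inv,
    Real.log_mul (by positivity) h0.ne']
  congr 1; ring

/-- Contraction by B⁻¹ at rate ν beats growth at rate g up to the Ehrenfest time, with a margin
N^{-γ}; the factor (2π)^{-ν/2L} is at most 1. -/
lemma inv_scale_mul_exp_le {L ν g γ ε : ℝ} {n : ℕ} (hL : 0 < L) (hν : 0 < ν) (hg : 0 ≤ g)
    (hN : 1 ≤ N) (hn : n * (2 * L) ≤ (1 - ε) * Real.log N)
    (h : (1 - ε) * g ≤ ν - 2 * L * γ) :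
    (hbar N ^ (-(ν / (2 * L))))⁻¹ * Real.exp (g * n) ≤ (N : ℝ) ^ (-γ) := by
  have h0 : (0 : ℝ) < N := by positivity
  have hl : 0 ≤ Real.log N := Real.log_nonneg (by exact_mod_cast hN)
  have hc : 0 ≤ Real.log (2 * Real.pi) := Real.log_nonneg (by linarith [Real.pi_gt_three])
  rw [hbar_rpow hN, ← Real.exp_neg, ← Real.exp_add, Real.rpow_def_of_pos h0]
  apply Real.exp_le_exp.2
  have h1 : g * n * (2 * L) ≤ (ν - 2 * L * γ) * Real.log N := by
    calc g * n * (2 * L) = g * (n * (2 * L)) := by ring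
      _ ≤ g * ((1 - ε) * Real.log N) := by gcongr
      _ = (1 - ε) * g * Real.log N := by ring
      _ ≤ _ := by gcongr
  have h2 : g * n ≤ (ν - 2 * L * γ) * Real.log N / (2 * L) := by
    rwa [le_div_iff₀ (by positivity)]
  have h3 : (ν - 2 * L * γ) * Real.log N / (2 * L) = ν / (2 * L) * Real.log N - γ * Real.log N := by
    field_simp
  have h4 : 0 ≤ ν / (2 * L) * Real.log (2 * Real.pi) := by positivity
  linarith

/-- The same comparison for B/2N. The factor (2π)^{ν/2L} is bounded by 2π, and 2πN/2N leaves the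
constant π. -/
lemma scale_mul_exp_le {L ν g γ ε : ℝ} {n : ℕ} (hL : 0 < L) (hν : ν ≤ L) (hg : 0 ≤ g)
    (hN : 1 ≤ N) (hn : n * (2 * L) ≤ (1 - ε) * Real.log N)
    (h : (1 - ε) * g ≤ 2 * L - ν - 2 * L * γ) :
    (2 * N : ℝ)⁻¹ * (hbar N ^ (-(ν / (2 * L))) * Real.exp (g * n)) ≤ Real.pi * (N : ℝ) ^ (-γ) := by
  have h0 : (0 : ℝ) < N := by positivity
  have hl : 0 ≤ Real.log N := Real.log_nonneg (by exact_mod_cast hN)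
  have hc : 0 ≤ Real.log (2 * Real.pi) := Real.log_nonneg (by linarith [Real.pi_gt_three])
  have h1 : g * n * (2 * L) ≤ (2 * L - ν - 2 * L * γ) * Real.log N := by
    calc g * n * (2 * L) = g * (n * (2 * L)) := by ring
      _ ≤ g * ((1 - ε) * Real.log N) := by gcongr
      _ = (1 - ε) * g * Real.log N := by ring
      _ ≤ _ := by gcongr
  have h2 : g * n ≤ (2 * L - ν - 2 * L * γ) * Real.log N / (2 * L) := by
    rwa [le_div_iff₀ (by positivity)]
  have h3 : (2 * L - ν - 2 * L * γ) * Real.log N / (2 * L) =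
      Real.log N - ν / (2 * L) * Real.log N - γ * Real.log N := by
    field_simp
  have h4 : ν / (2 * L) ≤ 1 := by
    rw [div_le_one (by positivity)]; linarith
  have h5 : ν / (2 * L) * Real.log (2 * Real.pi) ≤ Real.log (2 * Real.pi) :=
    mul_le_of_le_one_left hc h4
  have h6 : hbar N ^ (-(ν / (2 * L))) * Real.exp (g * n) ≤ 2 * Real.pi * N * (N : ℝ) ^ (-γ) := by
    rw [hbar_rpow hN, ← Real.exp_add]
    calc _ ≤ Real.exp (Real.log (2 * Real.pi) + Real.log N + Real.log N * -γ) :=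
          Real.exp_le_exp.2 (by linarith)
      _ = _ := by
        rw [Real.exp_add, Real.exp_add, Real.exp_log (by positivity), Real.exp_log h0,
          Real.rpow_def_of_pos h0]
  calc _ ≤ (2 * N : ℝ)⁻¹ * (2 * Real.pi * N * (N : ℝ) ^ (-γ)) := by gcongr
    _ = _ := by field_simp

lemma norm_mulVec_le_of_entry {n : Type*} [Fintype n] {M : Matrix n n ℝ} {c : ℝ} (hc : 0 ≤ c)
    (h : ∀ i j, |M i j| ≤ c) (x : n → ℝ) : ‖M *ᵥ x‖ ≤ Fintype.card n * c * ‖x‖ := by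
  refine (pi_norm_le_iff_of_nonneg (by positivity)).2 fun i => ?_
  calc ‖∑ j, M i j * x j‖ ≤ ∑ _j : n, c * ‖x‖ := norm_sum_le_of_le _ fun j _ => by
        rw [norm_mul]
        exact mul_le_mul (h i j) (norm_le_pi_norm x j) (norm_nonneg _) hc
    _ = _ := by rw [Finset.sum_const, nsmul_eq_mul, Finset.card_univ]; ring

lemma dotProduct_self_le {n : Type*} [Fintype n] (y : n → ℝ) :
    y ⬝ᵥ y ≤ Fintype.card n * ‖y‖ ^ 2 := by
  calc y ⬝ᵥ y ≤ ∑ _j : n, ‖y‖ ^ 2 := Finset.sum_le_sum fun j _ => by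
        have := norm_le_pi_norm y j
        rw [Real.norm_eq_abs] at this
        nlinarith [abs_mul_abs_self (y j), abs_nonneg (y j)]
    _ = _ := by rw [Finset.sum_const, nsmul_eq_mul, Finset.card_univ]

lemma exists_entry_bound {n : Type*} [Fintype n] (M : Matrix n n ℝ) :
    ∃ c, 0 ≤ c ∧ ∀ i j, |M i j| ≤ c := by
  refine ⟨∑ i, ∑ j, |M i j|, Finset.sum_nonneg fun i _ => Finset.sum_nonneg fun j _ =>
    abs_nonneg _, fun i j => ?_⟩
  exact (Finset.single_le_sum (f := fun j => |M i j|) (fun _ _ => abs_nonneg _)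
    (Finset.mem_univ j)).trans (Finset.single_le_sum (f := fun i => ∑ j, |M i j|)
      (fun _ _ => Finset.sum_nonneg fun _ _ => abs_nonneg _) (Finset.mem_univ i))

namespace Reduction

lemma conjDiag_mulVec_act (S : Reduction A) (w : Fin d → ℝ) (g : SpZ d) (x : Phase d) :
    S.conjDiag w *ᵥ act g x = (S.Q : PMat d ℝ) *ᵥ ((Matrix.diagonal (Sum.elim w w) *
      Matrix.reindex S.idx₂ S.idx₂ (S.inCoords g)) *ᵥ
        (((S.Q⁻¹ : Matrix.symplecticGroup (Fin d) ℝ) : PMat d ℝ) *ᵥ x)) := by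
  have h1 : Matrix.reindex S.idx₂ S.idx₂ (S.inCoords g) =
      ((S.Q⁻¹ : Matrix.symplecticGroup (Fin d) ℝ) : PMat d ℝ) * realMat g * (S.Q : PMat d ℝ) :=
    Equiv.apply_symm_apply _ _
  rw [h1, conjDiag, act]
  simp only [Matrix.mulVec_mulVec]
  congr 1
  calc _ = (S.Q : PMat d ℝ) * Matrix.diagonal (Sum.elim w w) *
        ((S.Q⁻¹ : Matrix.symplecticGroup (Fin d) ℝ) : PMat d ℝ) * realMat g *
        ((S.Q : PMat d ℝ) * ((S.Q⁻¹ : Matrix.symplecticGroup (Fin d) ℝ) : PMat d ℝ)) := by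
        rw [S.Q_mul_inv, Matrix.mul_one]
    _ = _ := by simp only [Matrix.mul_assoc]

lemma exists_conjDiag_mulVec_le (S : Reduction A) : ∃ C, 0 ≤ C ∧ ∀ (w : Fin d → ℝ) (g : SpZ d)
    (c : ℝ), 0 ≤ c → (∀ i p q, S.idx.symm i = p → ∀ s : S.Idx, (s = Sum.inl p ∨ s = Sum.inr p) →
      |w i * S.inCoords g s q| ≤ c) →
    ∀ x : Phase d, (S.conjDiag w *ᵥ act g x) ⬝ᵥ (S.conjDiag w *ᵥ act g x) ≤
      C * (c * ‖x‖) ^ 2 := by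
  obtain ⟨c₁, hc₁, h1⟩ := exists_entry_bound (S.Q : PMat d ℝ)
  obtain ⟨c₂, hc₂, h2⟩ := exists_entry_bound
    ((S.Q⁻¹ : Matrix.symplecticGroup (Fin d) ℝ) : PMat d ℝ)
  set m : ℝ := (Fintype.card (Fin d ⊕ Fin d) : ℝ) with hm
  have hm0 : 0 ≤ m := by positivity
  refine ⟨m * (m * c₁ * m * (m * c₂)) ^ 2, by positivity, fun w g c hc h x => ?_⟩
  rw [S.conjDiag_mulVec_act]
  set y := ((S.Q⁻¹ : Matrix.symplecticGroup (Fin d) ℝ) : PMat d ℝ) *ᵥ x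
  have h3 : ∀ i j, |(Matrix.diagonal (Sum.elim w w) *
      Matrix.reindex S.idx₂ S.idx₂ (S.inCoords g)) i j| ≤ c := by
    intro i j
    rw [Matrix.diagonal_mul, Matrix.reindex_apply, Matrix.submatrix_apply]
    rcases i with i | i
    · exact h i _ _ rfl _ (Or.inl rfl)
    · exact h i _ _ rfl _ (Or.inr rfl)
  have h4 := norm_mulVec_le_of_entry hc h3 y
  have h5 := norm_mulVec_le_of_entry hc₂ h2 x
  refine (dotProduct_self_le _).trans ?_
  rw [mul_assoc, ← mul_pow]
  gcongr
  calc _ ≤ m * c₁ * (m * c * (m * c₂ * ‖x‖)) := by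
        refine (norm_mulVec_le_of_entry hc₁ h1 _).trans ?_
        gcongr
        exact h4.trans (by gcongr)
    _ = _ := by ring

/-- Both Gaussian factors have arguments O(N^{-γ} ‖x‖) when evaluated at A^j x, and 1 - e^{-q} ≤ q.
-/
lemma exists_kernelHat_act_le (S : Reduction A) (hL : 0 < lamMax A) {ε₀ ε : ℝ} (hε₀ : 0 < ε₀)
    (hε₀' : ε₀ ≤ lamMax A) (hε : 0 < ε) (hε' : ε < 1) : ∃ C γ : ℝ, 0 < γ ∧
      ∀ N : ℕ, 1 ≤ N → ∀ j : ℤ, j.natAbs ≤ ehrenfest A ε N → ∀ x : Phase d,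
        ‖kernelHat (S.B ε₀ N) N (act (A ^ j) x) - 1‖ ≤ C * ((N : ℝ) ^ (-γ) * ‖x‖) ^ 2 := by
  -- The spare exponent on each block is ε₀ on the neutral one and ελ_i on the others. Half of the
  -- minimum δ pays for the loss η in the growth of A^j, the other half becomes the decay: 2λ_max γ
  -- = δ/2.
  obtain ⟨b₀, hb₀⟩ := Finite.exists_min fun b : Option (Fin S.r) => b.elim ε₀ fun i => ε * S.lam i
  set δ : ℝ := b₀.elim ε₀ fun i => ε * S.lam i with hδ
  have hδ0 : 0 < δ := by
    rw [hδ]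
    rcases b₀ with _ | i
    · exact hε₀
    · exact mul_pos hε (S.lam_pos i)
  have hν : ∀ b, 0 < S.dilRate ε₀ b ∧ S.dilRate ε₀ b ≤ lamMax A ∧
      (1 - ε) * (S.rate b + δ / 2) ≤ S.dilRate ε₀ b - δ / 2 := by
    intro b
    have h1 := hb₀ b
    rcases b with _ | i
    · refine ⟨hε₀, hε₀', ?_⟩
      simp only [Option.elim, rate, dilRate] at h1 ⊢
      nlinarith
    · refine ⟨S.lam_pos i, S.lam_le_lamMax i, ?_⟩
      simp only [Option.elim, rate, dilRate] at h1 ⊢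
      nlinarith
  obtain ⟨C, hC0, hC⟩ := S.exists_inCoords_le (half_pos hδ0)
  obtain ⟨C', hC0', hC'⟩ := S.exists_conjDiag_mulVec_le
  set γ : ℝ := δ / (4 * lamMax A) with hγ
  have hγL : 2 * lamMax A * γ = δ / 2 := by
    rw [hγ]; field_simp; ring
  refine ⟨Real.pi / 2 * C' * (C ^ 2 + (Real.pi * C) ^ 2), γ, by positivity,
    fun N hN j hj x => ?_⟩
  have hN0 : (0 : ℝ) < N := by positivity
  have hn := natAbs_le_ehrenfest hL hε' hN hj
  have hu : (0 : ℝ) ≤ (N : ℝ) ^ (-γ) := by positivity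
  have hblk : ∀ (p : Fin S.d₀ ⊕ (Σ i, Fin (S.dim i))) (s : S.Idx), s = Sum.inl p ∨ s = Sum.inr p →
      S.blk s = S.blk₁ p := by
    rintro p s (rfl | rfl) <;> rfl
  have h1 := hC' (S.scale ε₀ N)⁻¹ (A ^ j) (C * (N : ℝ) ^ (-γ)) (by positivity)
    (fun i p q hi s hs => by
      have h2 := hC j s q
      obtain ⟨hb1, -, hb3⟩ := hν (S.blk₁ p)
      have h3 := inv_scale_mul_exp_le (γ := γ) hL hb1
        (add_nonneg (S.rate_nonneg (S.blk₁ p)) (half_pos hδ0).le) hN hn (by rw [hγL]; exact hb3)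
      rw [hblk p s hs] at h2
      rw [abs_mul, Pi.inv_apply, abs_of_pos (inv_pos.2 (S.scale_pos ε₀ hN i)), S.scale_eq, hi]
      have hpos := hi ▸ S.scale_eq ε₀ N i ▸ S.scale_pos ε₀ hN i
      calc _ ≤ _ * (C * Real.exp ((S.rate (S.blk₁ p) + δ / 2) * j.natAbs)) :=
            mul_le_mul_of_nonneg_left h2 (inv_pos.2 hpos).le
        _ = C * (_ * Real.exp ((S.rate (S.blk₁ p) + δ / 2) * j.natAbs)) := mul_left_comm _ _ _
        _ ≤ _ := mul_le_mul_of_nonneg_left h3 hC0) x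
  have h2 := hC' (S.scale ε₀ N) (A ^ j) (2 * N * (C * (Real.pi * (N : ℝ) ^ (-γ)))) (by positivity)
    (fun i p q hi s hs => by
      have h2 := hC j s q
      obtain ⟨hb1, hb2, hb3⟩ := hν (S.blk₁ p)
      have h3 := scale_mul_exp_le (γ := γ) hL hb2
        (add_nonneg (S.rate_nonneg (S.blk₁ p)) (half_pos hδ0).le) hN hn
        -- With ν ≤ λ_max one has ν ≤ 2λ_max - ν, so the condition for B/2N follows from that for
        -- B⁻¹.
        (by rw [hγL]; linarith)
      rw [hblk p s hs] at h2
      rw [abs_mul, abs_of_pos (S.scale_pos ε₀ hN i), S.scale_eq, hi]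
      have hpos := hi ▸ S.scale_eq ε₀ N i ▸ S.scale_pos ε₀ hN i
      rw [inv_mul_le_iff₀ (by positivity)] at h3
      calc _ ≤ _ * (C * Real.exp ((S.rate (S.blk₁ p) + δ / 2) * j.natAbs)) :=
            mul_le_mul_of_nonneg_left h2 hpos.le
        _ = C * (_ * Real.exp ((S.rate (S.blk₁ p) + δ / 2) * j.natAbs)) := mul_left_comm _ _ _
        _ ≤ C * (2 * N * (Real.pi * (N : ℝ) ^ (-γ))) := mul_le_mul_of_nonneg_left h3 hC0
        _ = _ := by ring) x
  rw [kernelHat_eq (S.sympSelfAdjoint_B ε₀ N) (S.det_B_ne_zero ε₀ hN) hN, S.B_inv ε₀ hN,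
    gaussC_smul, S.B_eq]
  change ‖gaussC _ (S.conjDiag _ *ᵥ _) * gaussC _ (S.conjDiag _ *ᵥ _) - 1‖ ≤ _
  set y := S.conjDiag (S.scale ε₀ N)⁻¹ *ᵥ act (A ^ j) x
  set y' := S.conjDiag (S.scale ε₀ N) *ᵥ act (A ^ j) x
  have hy : 0 ≤ y ⬝ᵥ y := Finset.sum_nonneg fun i _ => mul_self_nonneg _
  have hy' : 0 ≤ y' ⬝ᵥ y' := Finset.sum_nonneg fun i _ => mul_self_nonneg _
  set q : ℝ := 1 / 2 * Real.pi * (y ⬝ᵥ y) + 1 / 2 * (2 * N : ℝ)⁻¹ ^ 2 * Real.pi * (y' ⬝ᵥ y') with hq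
  have hq0 : 0 ≤ q := by positivity
  have h3 : gaussC (1 / 2) y * gaussC (1 / 2 * (2 * N : ℝ)⁻¹ ^ 2) y' - 1 =
      ((Real.exp (-q) - 1 : ℝ) : ℂ) := by
    rw [gaussC, gaussC, ← Complex.ofReal_mul, ← Real.exp_add, Complex.ofReal_sub,
      Complex.ofReal_one]
    congr 3
    rw [hq]; ring
  rw [h3, Complex.norm_real, Real.norm_eq_abs, abs_sub_comm,
    abs_of_nonneg (by linarith [Real.exp_le_one_iff.2 (neg_nonpos.2 hq0)])]
  have h4 := Real.add_one_le_exp (-q)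
  calc 1 - Real.exp (-q) ≤ q := by linarith
    _ ≤ 1 / 2 * Real.pi * (C' * (C * (N : ℝ) ^ (-γ) * ‖x‖) ^ 2) +
        1 / 2 * (2 * N : ℝ)⁻¹ ^ 2 * Real.pi *
          (C' * (2 * N * (C * (Real.pi * (N : ℝ) ^ (-γ))) * ‖x‖) ^ 2) := by
        rw [hq]; gcongr
    _ = _ := by field_simp

end Reduction

end CatMap

end

noncomputable section
namespace CatMap

variable {d : ℕ} {N : ℕ} {κ : Phase d} {A : SpZ d}

/-! ### Approximate invariance of the measures of eigenstates -/

/-- The defect of invariance of a trigonometric series with coefficients `b`. -/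
def invarianceDefect (C γ : ℝ) (b : (Fin d ⊕ Fin d → ℤ) → ℂ) (N : ℕ) : ℝ :=
  ∑' r, ‖b r‖ * (2 * min 2 (|C| * ((N : ℝ) ^ (-γ) * ‖(intPt r : Phase d)‖) ^ 2))

lemma summable_invarianceDefect (C γ : ℝ) {b : (Fin d ⊕ Fin d → ℤ) → ℂ}
    (hb : Summable fun r => ‖b r‖) (N : ℕ) : Summable fun r => ‖b r‖ *
      (2 * min 2 (|C| * ((N : ℝ) ^ (-γ) * ‖(intPt r : Phase d)‖) ^ 2)) := by
  refine Summable.of_nonneg_of_le (fun r => by positivity) (fun r => ?_) (hb.mul_right (2 * 2))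
  gcongr
  exact min_le_left _ _

lemma invarianceDefect_nonneg (C γ : ℝ) (b : (Fin d ⊕ Fin d → ℤ) → ℂ) (N : ℕ) :
    0 ≤ invarianceDefect C γ b N :=
  tsum_nonneg fun r => by positivity

/-- The truncation at 2 gives a dominating series using only ∑ ‖b_r‖ < ∞, with no moment of the
Fourier coefficients. -/
lemma tendsto_invarianceDefect (C : ℝ) {γ : ℝ} (hγ : 0 < γ) {b : (Fin d ⊕ Fin d → ℤ) → ℂ}
    (hb : Summable fun r => ‖b r‖) :
    Filter.Tendsto (invarianceDefect C γ b) Filter.atTop (nhds 0) := by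
  have h0 : Filter.Tendsto (fun N : ℕ => (N : ℝ) ^ (-γ)) Filter.atTop (nhds 0) :=
    (tendsto_rpow_neg_atTop hγ).comp tendsto_natCast_atTop_atTop
  have h1 := tendsto_tsum_of_dominated_convergence (𝓕 := Filter.atTop)
    (f := fun (N : ℕ) r => ‖b r‖ *
      (2 * min 2 (|C| * ((N : ℝ) ^ (-γ) * ‖(intPt r : Phase d)‖) ^ 2)))
    (g := fun _ => (0 : ℝ)) (hb.mul_right (2 * 2)) (fun r => ?_)
    (Filter.Eventually.of_forall fun N r => ?_)
  · rw [tsum_zero] at h1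
    exact h1
  · have h2 := (((tendsto_const_nhds (x := (2 : ℝ))).min (((h0.mul_const
      ‖(intPt r : Phase d)‖).pow 2).const_mul |C|)).const_mul 2).const_mul ‖b r‖
    simpa using h2
  · rw [Real.norm_of_nonneg (by positivity)]
    gcongr
    exact min_le_left _ _

/-- Only the multiplier changes along the orbit: the expectations of the translations are exactly
invariant and bounded by 1. -/
lemma IsUnitEigenstate.abs_mu_act_sub_le (S : Reduction A) {ε₀ ε C γ : ℝ}
    (hC : ∀ N : ℕ, 1 ≤ N → ∀ j : ℤ, j.natAbs ≤ ehrenfest A ε N → ∀ x : Phase d,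
        ‖kernelHat (S.B ε₀ N) N (act (A ^ j) x) - 1‖ ≤ C * ((N : ℝ) ^ (-γ) * ‖x‖) ^ 2)
    (hN : 1 ≤ N) {ψ : 𝓢'(Conf d, ℂ)} (hψ : IsUnitEigenstate N A κ ψ)
    {b : (Fin d ⊕ Fin d → ℤ) → ℂ} {a : Phase d → ℝ}
    (h : HasTrigSeries b id fun ρ => (a ρ : ℂ)) {j : ℤ} (hj : j.natAbs ≤ ehrenfest A ε N) :
    |S.mu ε₀ N κ ψ (fun ρ => a (act (A ^ j) ρ)) - S.mu ε₀ N κ ψ a| ≤ invarianceDefect C γ b N := by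
  have hB := S.sympSelfAdjoint_B ε₀ N
  have hdet := S.det_B_ne_zero ε₀ hN
  have hE := norm_expect_le_one hN hψ.mem hψ.unit
  have hK := norm_kernelHat_le hB hdet hN
  have hsum : ∀ g : SpZ d, Summable fun r : Fin d ⊕ Fin d → ℤ =>
      b r * (kernelHat (S.B ε₀ N) N (act g (intPt r)) * expect N κ ψ r) := by
    intro g
    refine Summable.of_norm_bounded h.summable fun r => ?_
    rw [norm_mul, norm_mul]
    exact mul_le_of_le_one_right (norm_nonneg _) (mul_le_one₀ (hK _) (norm_nonneg _) (hE _))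
  have h1 := (h.comp_act (A ^ j)).mu_eq S ε₀ hN hψ.mem
  have h2 := h.mu_eq S ε₀ hN hψ.mem
  simp only [id, ← zpow_neg, hψ.expect_actZ_zpow hN, intPt_actZ] at h1 h2
  have h3 := hsum 1
  simp only [act_one] at h3
  rw [h1, h2, ← Complex.sub_re, ← (hsum _).tsum_sub h3]
  refine (Complex.abs_re_le_norm _).trans ?_
  refine tsum_of_norm_bounded (summable_invarianceDefect C γ h.summable N).hasSum fun r => ?_
  rw [← mul_sub, ← sub_mul, norm_mul, norm_mul]
  refine mul_le_mul_of_nonneg_left ((mul_le_of_le_one_right (norm_nonneg _) (hE r)).trans ?_)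
    (norm_nonneg _)
  have h4 : ∀ k : ℤ, k.natAbs ≤ ehrenfest A ε N →
      ‖kernelHat (S.B ε₀ N) N (act (A ^ k) (intPt r)) - 1‖ ≤
        min 2 (|C| * ((N : ℝ) ^ (-γ) * ‖(intPt r : Phase d)‖) ^ 2) := by
    intro k hk
    refine le_min ?_ ((hC N hN k hk _).trans (by gcongr; exact le_abs_self C))
    refine (norm_sub_le _ _).trans ?_
    rw [norm_one]
    linarith [hK (act (A ^ k) (intPt r))]
  -- Both k(A^{-j} r) and k(r) are compared with 1, which accounts for the factor 2 in the defect.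
  have h5 := h4 (-j) (by rwa [Int.natAbs_neg])
  have h6 := h4 0 (Nat.zero_le _)
  rw [zpow_zero, act_one] at h6
  calc _ = ‖(kernelHat (S.B ε₀ N) N (act (A ^ (-j)) (intPt r)) - 1) -
        (kernelHat (S.B ε₀ N) N (intPt r) - 1)‖ := by rw [sub_sub_sub_cancel_right]
    _ ≤ _ := (norm_sub_le _ _).trans (by linarith)

/-! ### The process of a partition -/

/-- The product of the letters of a word read along the dynamics from time `j` on. -/
def wordFun (A : SpZ d) {K : ℕ} (P : Fin K → Phase d → ℝ) (j : ℤ) (L : ℕ) (β : Fin L → Fin K)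
    (ρ : Phase d) : ℝ :=
  ∏ i : Fin L, P (β i) (act (A ^ (j + ((i : ℕ) : ℤ))) ρ)

variable {K : ℕ} {P : Fin K → Phase d → ℝ}

lemma refined_eq_wordFun (m : ℕ) (α : Fin (2 * m) → Fin K) (ρ : Phase d) :
    refined A P m α ρ = wordFun A P (-m) (2 * m) α ρ := by
  refine Finset.prod_congr rfl fun k _ => ?_
  rw [sub_eq_neg_add]

lemma wordFun_append (j : ℤ) {L L' : ℕ} (α : Fin L → Fin K) (β : Fin L' → Fin K) (ρ : Phase d) :
    wordFun A P j (L + L') (Fin.append α β) ρ =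
      wordFun A P j L α ρ * wordFun A P (j + L) L' β ρ := by
  rw [wordFun, Fin.prod_univ_add]
  congr 1
  · refine Finset.prod_congr rfl fun i _ => ?_
    rw [Fin.append_left, Fin.val_castAdd]
  · refine Finset.prod_congr rfl fun i _ => ?_
    rw [Fin.append_right, Fin.val_natAdd, Nat.cast_add, add_assoc]

lemma wordFun_add (j k : ℤ) {L : ℕ} (β : Fin L → Fin K) (ρ : Phase d) :
    wordFun A P (j + k) L β ρ = wordFun A P j L β (act (A ^ k) ρ) := by
  refine Finset.prod_congr rfl fun i _ => ?_
  rw [← act_mul, ← zpow_add, add_right_comm]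

lemma IsSmoothPartition.sum_wordFun_sq (hP : IsSmoothPartition P) (j : ℤ) (L : ℕ) (ρ : Phase d) :
    ∑ β, wordFun A P j L β ρ ^ 2 = 1 := by
  simp only [wordFun, ← Finset.prod_pow]
  rw [← Fintype.prod_sum fun (i : Fin L) k => P k (act (A ^ (j + ((i : ℕ) : ℤ))) ρ) ^ 2]
  simp [hP.sum_sq]

lemma IsSmoothPartition.wiener_wordFun (hP : IsSmoothPartition P) (j : ℤ) (L : ℕ)
    (β : Fin L → Fin K) : Wiener fun ρ => (wordFun A P j L β ρ : ℂ) := by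
  have h1 : ∀ i, Wiener fun ρ => (P i ρ : ℂ) := fun i =>
    wiener_of_contDiff (Complex.ofRealCLM.contDiff.comp (hP.smooth i))
      fun r ρ => by rw [hP.periodic]
  simp only [wordFun, Complex.ofReal_prod]
  exact Wiener.prod _ fun i => (h1 (β i)).comp_act _

lemma IsSmoothPartition.wiener_wordFun_sq (hP : IsSmoothPartition P) (j : ℤ) (L : ℕ)
    (β : Fin L → Fin K) : Wiener fun ρ => ((wordFun A P j L β ρ ^ 2 : ℝ) : ℂ) := by
  simp only [pow_two, Complex.ofReal_mul]
  exact (hP.wiener_wordFun j L β).mul (hP.wiener_wordFun j L β)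

/-- Consistency is exact because Op⁺ is linear and the squares of the word functions sum to 1;
positivity holds because each symbol is a square. -/
lemma IsSmoothPartition.isProcess (hP : IsSmoothPartition P) (S : Reduction A) (ε₀ : ℝ)
    (hN : 1 ≤ N) {ψ : 𝓢'(Conf d, ℂ)} (hψ : ψ ∈ states N κ) (h1 : stateInner N κ ψ ψ = 1) :
    IsProcess fun j L (β : Fin L → Fin K) => S.mu ε₀ N κ ψ fun ρ => wordFun A P j L β ρ ^ 2 where
  nonneg j L β := by
    obtain ⟨ι, _, b, r, h⟩ := hP.wiener_wordFun (A := A) j L β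
    exact h.mu_sq_nonneg S ε₀ hN hψ
  empty j β := by
    simp only [wordFun, Finset.univ_eq_empty, Finset.prod_empty, one_pow]
    exact S.mu_one ε₀ hN hψ h1
  sum_right j L L' α := by
    rw [← Wiener.mu_sum _ (fun β _ => hP.wiener_wordFun_sq j (L + L') (Fin.append α β)) S ε₀ hN hψ]
    congr 1
    ext ρ
    simp only [wordFun_append, mul_pow]
    rw [← Finset.mul_sum, hP.sum_wordFun_sq, mul_one]
  sum_left j L L' β := by
    rw [← Wiener.mu_sum _ (fun α _ => hP.wiener_wordFun_sq j (L + L') (Fin.append α β)) S ε₀ hN hψ]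
    congr 1
    ext ρ
    simp only [wordFun_append, mul_pow]
    rw [← Finset.sum_mul, hP.sum_wordFun_sq, one_mul]

lemma IsSmoothPartition.one_le_card (hP : IsSmoothPartition P) : 1 ≤ K := by
  rcases Nat.eq_zero_or_pos K with rfl | h
  · simpa using hP.sum_sq 0
  · exact h

lemma tendsto_ehrenfest (hL : 0 < lamMax A) {ε : ℝ} (hε' : ε < 1) :
    Filter.Tendsto (ehrenfest A ε) Filter.atTop Filter.atTop := by
  refine tendsto_nat_floor_atTop.comp ?_
  refine Filter.Tendsto.atTop_div_const (by positivity) ?_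
  exact (Real.tendsto_log_atTop.comp tendsto_natCast_atTop_atTop).const_mul_atTop (by linarith)

end CatMap

end

/-! ### Assembly of the remainder -/

open CatMap
theorem lemma5p2 {d : ℕ} (A : SpZ d) (hA : Quantizable A) (hexp : ∃ β ∈ spec A, 1 < ‖β‖)
    (S : Reduction A) (ε₀ : ℝ) (hε₀ : 0 < ε₀) (hε₀' : ε₀ ≤ lamMax A)
    (ε : ℝ) (hε : 0 < ε) (hε' : ε < 1)
    {K : ℕ} (P : Fin K → Phase d → ℝ) (hP : IsSmoothPartition P) :
    ∃ R : ℕ → ℕ → ℝ,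
      (∀ m₀ : ℕ, 1 ≤ m₀ → Filter.Tendsto (R m₀) Filter.atTop (nhds 0)) ∧
      ∀ m₀ N : ℕ, 1 ≤ m₀ → 1 ≤ N → 1 ≤ ehrenfest A ε N →
        ∀ (κ : Phase d) (ψ : TemperedDistribution (Conf d) ℂ), IsUnitEigenstate N A κ ψ →
          1 / (2 * (ehrenfest A ε N : ℝ)) * S.entropy ε₀ N κ P (ehrenfest A ε N) ψ ≤
            1 / (2 * (m₀ : ℝ)) * S.entropy ε₀ N κ P m₀ ψ + R m₀ N := by
  have hL := lamMax_pos hexp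
  obtain ⟨C, γ, hγ, hC⟩ := S.exists_kernelHat_act_le hL hε₀ hε₀' hε hε'
  -- Summing the defects over the finitely many words of length 2m₀ bounds all of them at once, and
  -- involves neither κ nor ψ.
  let δ : ℕ → ℕ → ℝ := fun m₀ N => ∑ β : Fin (2 * m₀) → Fin K,
    invarianceDefect C γ (fcoef fun ρ => ((wordFun A P (-m₀) (2 * m₀) β ρ ^ 2 : ℝ) : ℂ)) N
  have hseries : ∀ (m₀ : ℕ) (β : Fin (2 * m₀) → Fin K),
      HasTrigSeries (fcoef fun ρ => ((wordFun A P (-m₀) (2 * m₀) β ρ ^ 2 : ℝ) : ℂ)) id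
        fun ρ => ((wordFun A P (-m₀) (2 * m₀) β ρ ^ 2 : ℝ) : ℂ) := by
    intro m₀ β
    obtain ⟨ι, _, b, r, h⟩ := hP.wiener_wordFun_sq (A := A) (-m₀) (2 * m₀) β
    exact h.fcoef
  have hδ0 : ∀ m₀ N, 0 ≤ δ m₀ N := fun m₀ N =>
    Finset.sum_nonneg fun β _ => invarianceDefect_nonneg _ _ _ _
  refine ⟨fun m₀ N => 1 / (2 * (m₀ : ℝ)) * ((K : ℝ) ^ (2 * m₀) * entropyModulus (δ m₀ N)) +
    1 / (2 * (ehrenfest A ε N : ℝ)) * ((2 * m₀ : ℝ) * Real.log K), fun m₀ _ => ?_,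
    fun m₀ N hm₀ hN hE κ ψ hψ => ?_⟩
  · have h1 : Filter.Tendsto (δ m₀) Filter.atTop (nhds 0) := by
      have := tendsto_finsetSum (Finset.univ : Finset (Fin (2 * m₀) → Fin K))
        fun β _ => tendsto_invarianceDefect C hγ (hseries m₀ β).summable
      rw [Finset.sum_const_zero] at this
      exact this
    have h2 := tendsto_entropyModulus (hδ0 m₀) h1
    have h3 : Filter.Tendsto (fun N => 1 / (2 * (ehrenfest A ε N : ℝ))) Filter.atTop (nhds 0) := by
      refine Filter.Tendsto.div_atTop tendsto_const_nhds ?_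
      exact (tendsto_natCast_atTop_atTop.comp (tendsto_ehrenfest hL hε')).const_mul_atTop two_pos
    have h4 := ((h2.const_mul ((K : ℝ) ^ (2 * m₀))).const_mul (1 / (2 * (m₀ : ℝ)))).add
      (h3.mul_const ((2 * m₀ : ℝ) * Real.log K))
    simpa using h4
  · have h1 := (hP.isProcess S ε₀ hN hψ.mem hψ.unit).entropy_rate_le hE hm₀ hP.one_le_card
      (hδ0 m₀ N) fun j hj β => by
        have h2 : j.natAbs ≤ ehrenfest A ε N := by
          rw [Int.abs_eq_natAbs] at hj
          exact_mod_cast hj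
        have h3 := hψ.abs_mu_act_sub_le S hC hN (hseries m₀ β) h2
        simp only [← wordFun_add] at h3
        exact h3.trans (Finset.single_le_sum (f := fun β => invarianceDefect C γ (fcoef fun ρ =>
          ((wordFun A P (-m₀) (2 * m₀) β ρ ^ 2 : ℝ) : ℂ)) N)
          (fun β _ => invarianceDefect_nonneg _ _ _ _) (Finset.mem_univ β))
    have h2 : ∀ m : ℕ, S.entropy ε₀ N κ P m ψ = wordEntropy (fun j L (β : Fin L → Fin K) =>
        S.mu ε₀ N κ ψ fun ρ => wordFun A P j L β ρ ^ 2) (-m) (2 * m) := by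
      intro m
      refine Finset.sum_congr rfl fun α _ => ?_
      simp only [refined_eq_wordFun]
    rw [h2, h2]
    exact h1
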